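/- Let $p_0,q_0>1$ be odd integers. Points $x=(i,j),y=(i',j')$ of $\mathbb{Z}^2$ are adjacent if they are adjacent in the Cayley graph of $\mathbb{Z}^2$ with its standard generators, distances are taken with respect to $\rho(x,y)=\max\{|i-i'|,|j-j'|\}$, the boundary of $F\subseteq\mathbb{Z}^2$ is the set of $x\in F$ with $\rho(x,\mathbb{Z}^2\setminus F)=1$, and the total charge of a finite set $F\subseteq\mathbb{Z}^2$ is $\sum_{(i,j)\in F}(-1)^{i+j}$. The side lengths of a rectangle in $\mathbb{Z}^2$ are its numbers of columns and rows. A parity change region is a $p_0\times q_0$ rectangle (in either orientation). Adding a parity change region to a rectangle $R$ along its boundary means adjoining such a rectangle that lies outside $R$ and has one whole side placed directly against a side of $R$; subtracting one means deleting such a rectangle that is contained in $R$ and has one side contained in a side of $R$. There is a constant $a_0$, depending only on $p_0$ and $q_0$, with the following property. Let $k\ge 0$, and let $R\subseteq\mathbb{Z}^2$ be a finite rectangle both of whose side lengths are at least $\max(k,1)\,a_0$. Let $R'$ be obtained from $R$ by adding or subtracting at most $k$ parity change regions along the boundary of $R$, with the distance between any two of these parity change regions at least $a_0$ and the distance between any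 of them and any corner of $R$ at least $k a_0$. Suppose that $R'$ has total charge $0$. Then for any two adjacent points $x,y$ on the boundary of $R'$, each at distance at least $a_0$ from every corner of $R$, there is a lining of $R'$ which starts at $x$ and ends at $y$, that is, a simple path from $x$ to $y$ in the Cayley graph of $\mathbb{Z}^2$ whose vertex set is $R'$. -/

import Mathlib

/-- The Cayley graph of `ℤ²` with its standard generators. -/
def gridGraph : SimpleGraph (ℤ × ℤ) :=
  SimpleGraph.addCayley ({(1, 0), (0, 1)} : Set (ℤ × ℤ))

/-- The `ℓ^∞` distance on `ℤ²`. -/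
def rho (z w : ℤ × ℤ) : ℤ := max |z.1 - w.1| |z.2 - w.2|

/-- The charge `(-1)^(i+j)` of the point `(i, j)`. -/
def charge (z : ℤ × ℤ) : ℤ := ((z.1 + z.2).negOnePow : ℤ)

/-- The total charge of a finite region. -/
def totalCharge (F : Finset (ℤ × ℤ)) : ℤ := ∑ z ∈ F, charge z

/-- The boundary of a region: its points at `ℓ^∞` distance `1` from the complement. -/
def gridBoundary (F : Set (ℤ × ℤ)) : Set (ℤ × ℤ) :=
  {x | x ∈ F ∧ ∃ z, z ∉ F ∧ rho x z = 1}

/-- A rectangle in `ℤ²`, given by its lower left point `(x, y)`, the number `w` of its columns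
and the number `h` of its rows. -/
structure GridRect where
  x : ℤ
  y : ℤ
  w : ℕ
  h : ℕ

namespace GridRect

/-- The set of lattice points of the rectangle. -/
noncomputable def cells (R : GridRect) : Finset (ℤ × ℤ) :=
  Finset.Ico R.x (R.x + R.w) ×ˢ Finset.Ico R.y (R.y + R.h)

/-- The four corner points of a (nonempty) rectangle. -/
def corners (R : GridRect) : Finset (ℤ × ℤ) :=
  {R.x, R.x + R.w - 1} ×ˢ {R.y, R.y + R.h - 1}

/-- `P` has dimensions `p × q`, in either orientation. -/
def HasDims (P : GridRect) (p q : ℕ) : Prop :=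
  (P.w = p ∧ P.h = q) ∨ (P.w = q ∧ P.h = p)

/-- The range of columns of `P` is contained in that of `R`. -/
def ColsWithin (P R : GridRect) : Prop := R.x ≤ P.x ∧ P.x + P.w ≤ R.x + R.w

/-- The range of rows of `P` is contained in that of `R`. -/
def RowsWithin (P R : GridRect) : Prop := R.y ≤ P.y ∧ P.y + P.h ≤ R.y + R.h

/-- `P` lies outside `R` and is attached, along a whole side of `P`, to one of the sides of `R`
(bottom, top, left, right). -/
def AttachedOutside (P R : GridRect) : Prop :=
  (P.ColsWithin R ∧ (P.y + P.h = R.y ∨ P.y = R.y + R.h)) ∨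
  (P.RowsWithin R ∧ (P.x + P.w = R.x ∨ P.x = R.x + R.w))

/-- `P` lies inside `R` and one of the sides of `P` is part of a side of `R`
(bottom, top, left, right). -/
def AttachedInside (P R : GridRect) : Prop :=
  P.ColsWithin R ∧ P.RowsWithin R ∧
  (P.y = R.y ∨ P.y + P.h = R.y + R.h ∨ P.x = R.x ∨ P.x + P.w = R.x + R.w)

end GridRect

/-- The region obtained from `R` by subtracting the rectangles in `S` and adding those in `A`. -/
noncomputable def modifiedRegion (R : GridRect) (A S : Finset GridRect) : Finset (ℤ × ℤ) :=
  (R.cells \ S.biUnion GridRect.cells) ∪ A.biUnion GridRect.cells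

/-- A lining of the finite set `F` from `x` to `y`: a simple path in the Cayley graph of `ℤ²`
from `x` to `y` whose set of vertices is `F`. -/
def IsLining (F : Finset (ℤ × ℤ)) {x y : ℤ × ℤ} (L : gridGraph.Walk x y) : Prop :=
  L.IsPath ∧ ∀ z, z ∈ L.support ↔ z ∈ F

/-- `A` and `S` are sets of parity change regions of dimensions `p × q`, at most `k` in total, to
be added to, respectively subtracted from, `R` along its boundary; any two of them are at distance
at least `a`, and all of them are at distance at least `k * a` from the corners of `R`. -/
structure IsParityChange (p q k a : ℕ) (R : GridRect) (A S : Finset GridRect) : Prop where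
  dims : ∀ P : GridRect, P ∈ A ∨ P ∈ S → P.HasDims p q
  added : ∀ P ∈ A, P.AttachedOutside R
  subtracted : ∀ P ∈ S, P.AttachedInside R
  card_le : A.card + S.card ≤ k
  apart : ∀ P Q : GridRect, (P ∈ A ∨ P ∈ S) → (Q ∈ A ∨ Q ∈ S) → P ≠ Q →
    ∀ z ∈ P.cells, ∀ z' ∈ Q.cells, (a : ℤ) ≤ rho z z'
  far_from_corners : ∀ P : GridRect, P ∈ A ∨ P ∈ S →
    ∀ z ∈ P.cells, ∀ c ∈ R.corners, (k : ℤ) * a ≤ rho z c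

/-! A lining from `x` to `y` is a Hamiltonian cycle of the region through the edge `xy` with that
edge removed. Such a cycle is built from concentric rings of even thickness `b`.

Inside a ring the path zigzags: it runs through one column of the band after another, alternately
upwards and downwards. A single parity, the phase `θ`, records at which columns it enters on the
outer side. A bump of odd width and odd height (added or cut out) that is entered and left on the
inner side changes the phase (`bandPath_bump`), and so does a notch of width 3 in the inner side
that leaves one row (`bandPath_notch`). A bump next to a notch therefore leaves the phase unchanged.
Seen from the region enclosed by the ring, the notch is a new added bump, a tooth, whose position
has the same parity. Every bump, whatever its size, can thus be passed on to the inner region as a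
tooth of fixed size, and the inner region is again a rectangle with bumps. The cycle of the ring and
that of the inner region are merged by exchanging two parallel edges (`hamPath_detour`).

The parity of a bump's position, suitably normalised on the four sides, is its contribution to the
charge, up to a common sign. Zero total charge means that these signs sum to 0 if the rectangle has
even area and to 1 if it has odd area. Two consecutive teeth of opposite signs can be absorbed by a
ring: each changes the phase, and none is passed on (`exists_processes_absorbing`). Each ring either
absorbs such a pair or only switches the phase so that the next ring can make progress, so after
boundedly many rings there remains a plain rectangle of even area, or one of odd area with a single
tooth of the right sign. Both are handled by explicit paths (`hamPath_rectangle`,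
`hamPath_rectangle_tooth`), and `hamPath_toothed_rectangle` is the induction. The number of rings is
linear in `k`, which is why the room required grows with `k`.

It remains to start with the given edge. In the outermost ring the phase, and the place where a
nearby bump is passed on, are chosen so that the path uses the edge `xy`. This is the case analysis
behind `Breakable` and `exists_bandBreak_bumps`. A rotation brings the edge to the top side. -/

theorem gridGraph_adj {z w : ℤ × ℤ} : gridGraph.Adj z w ↔
    (z.1 = w.1 ∧ (z.2 = w.2 + 1 ∨ w.2 = z.2 + 1)) ∨
    (z.2 = w.2 ∧ (z.1 = w.1 + 1 ∨ w.1 = z.1 + 1)) := by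
  obtain ⟨a, b⟩ := z
  obtain ⟨c, d⟩ := w
  simp only [gridGraph, SimpleGraph.addCayley_adj', Set.mem_insert_iff, Set.mem_singleton_iff,
    exists_eq_or_imp, exists_eq_left, Prod.mk_add_mk, Prod.mk.injEq, ne_eq]
  omega

/-! ### Hamiltonian paths: concatenation and symmetries -/

/-- The set `F` carries a Hamiltonian path of the grid from `s` to `t`. -/
def HamPath (F : Set (ℤ × ℤ)) (s t : ℤ × ℤ) : Prop :=
  ∃ L : gridGraph.Walk s t, L.IsPath ∧ ∀ z, z ∈ L.support ↔ z ∈ F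

namespace HamPath

variable {F G H : Set (ℤ × ℤ)} {s t s' t' : ℤ × ℤ}

theorem congr (h : HamPath F s t) (hs : s = s') (ht : t = t') (hF : ∀ z, z ∈ F ↔ z ∈ G) :
    HamPath G s' t' := by
  subst hs ht
  obtain ⟨L, hL, hz⟩ := h
  exact ⟨L, hL, fun z => (hz z).trans (hF z)⟩

theorem single (s : ℤ × ℤ) : HamPath {s} s s :=
  ⟨SimpleGraph.Walk.nil, SimpleGraph.Walk.IsPath.nil, by simp⟩

theorem symm (h : HamPath F s t) : HamPath F t s := by
  obtain ⟨L, hL, hz⟩ := h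
  exact ⟨L.reverse, hL.reverse, by simpa using hz⟩

theorem trans (h₁ : HamPath F s t) (h₂ : HamPath G s' t') (ha : gridGraph.Adj t s')
    (hd : ∀ z, z ∈ F → z ∉ G) (hH : ∀ z, z ∈ H ↔ z ∈ F ∨ z ∈ G) : HamPath H s t' := by
  obtain ⟨L, hL, hz⟩ := h₁
  obtain ⟨L', hL', hz'⟩ := h₂
  refine ⟨L.append (SimpleGraph.Walk.cons ha L'), ?_, fun z => ?_⟩
  · rw [SimpleGraph.Walk.isPath_def, SimpleGraph.Walk.support_append]
    simp only [SimpleGraph.Walk.support_cons, List.tail_cons]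
    refine List.Nodup.append hL.support_nodup hL'.support_nodup ?_
    intro z h1 h2
    exact hd z ((hz z).1 h1) ((hz' z).1 h2)
  · rw [SimpleGraph.Walk.support_append]
    simp [hz, hz', hH]

theorem map (h : HamPath F s t) (f : ℤ × ℤ → ℤ × ℤ) (g : ℤ × ℤ → ℤ × ℤ)
    (hgf : ∀ z, g (f z) = z) (hfg : ∀ z, f (g z) = z)
    (hf : ∀ z w, gridGraph.Adj z w → gridGraph.Adj (f z) (f w))
    (hG : ∀ z, z ∈ G ↔ g z ∈ F) : HamPath G (f s) (f t) := by
  obtain ⟨L, hL, hz⟩ := h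
  let φ : gridGraph →g gridGraph := ⟨f, fun {a b} hab => hf a b hab⟩
  refine ⟨L.map φ, SimpleGraph.Walk.IsPath.map ?_ hL, fun z => ?_⟩
  · intro a b hab
    have := congrArg g (show f a = f b from hab)
    simpa [hgf] using this
  · rw [SimpleGraph.Walk.support_map, List.mem_map, hG]
    constructor
    · rintro ⟨a, ha, rfl⟩
      rw [show φ a = f a from rfl, hgf]
      exact (hz a).1 ha
    · intro h
      exact ⟨g z, (hz _).2 h, hfg z⟩

/-- Reflection in a vertical line. -/
theorem reflectX (h : HamPath F s t) (c : ℤ) (hG : ∀ z : ℤ × ℤ, z ∈ G ↔ (c - z.1, z.2) ∈ F) :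
    HamPath G (c - s.1, s.2) (c - t.1, t.2) :=
  h.map (fun z => (c - z.1, z.2)) (fun z => (c - z.1, z.2)) (by simp) (by simp)
    (by intro z w; simp only [gridGraph_adj]; omega) hG

/-- Reflection in a horizontal line. -/
theorem reflectY (h : HamPath F s t) (c : ℤ) (hG : ∀ z : ℤ × ℤ, z ∈ G ↔ (z.1, c - z.2) ∈ F) :
    HamPath G (s.1, c - s.2) (t.1, c - t.2) :=
  h.map (fun z => (z.1, c - z.2)) (fun z => (z.1, c - z.2)) (by simp) (by simp)
    (by intro z w; simp only [gridGraph_adj]; omega) hG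

theorem transpose (h : HamPath F s t) (hG : ∀ z : ℤ × ℤ, z ∈ G ↔ (z.2, z.1) ∈ F) :
    HamPath G (s.2, s.1) (t.2, t.1) :=
  h.map (fun z => (z.2, z.1)) (fun z => (z.2, z.1)) (by simp) (by simp)
    (by intro z w; simp only [gridGraph_adj]; omega) hG

theorem translate (h : HamPath F s t) (a b : ℤ)
    (hG : ∀ z : ℤ × ℤ, z ∈ G ↔ (z.1 - a, z.2 - b) ∈ F) :
    HamPath G (s.1 + a, s.2 + b) (t.1 + a, t.2 + b) :=
  h.map (fun z => (z.1 + a, z.2 + b)) (fun z => (z.1 - a, z.2 - b)) (by simp) (by simp)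
    (by intro z w; simp only [gridGraph_adj]; omega) hG

end HamPath

/-! ### Snakes in boxes -/

/-- The rectangle of the points `z` with `a ≤ z.1 < a'` and `s ≤ z.2 < s'`. -/
def box (a a' s s' : ℤ) : Set (ℤ × ℤ) := {z | a ≤ z.1 ∧ z.1 < a' ∧ s ≤ z.2 ∧ z.2 < s'}

theorem mem_box {a a' s s' : ℤ} {z : ℤ × ℤ} :
    z ∈ box a a' s s' ↔ a ≤ z.1 ∧ z.1 < a' ∧ s ≤ z.2 ∧ z.2 < s' := Iff.rfl

/-- A row, from left to right. -/
theorem hamPath_row {a a' : ℤ} (y : ℤ) (h : a < a') :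
    HamPath (box a a' y (y + 1)) (a, y) (a' - 1, y) := by
  induction a', (show a + 1 ≤ a' by omega) using Int.leInduction with
  | base =>
    refine (HamPath.single (a, y)).congr rfl (by simp) fun z => ?_
    simp only [Set.mem_singleton_iff, mem_box, Prod.ext_iff]
    omega
  | succ n hn ih =>
    refine (ih (by omega)).trans (HamPath.single (n, y)) (by simp [gridGraph_adj])
      (fun z => ?_) (fun z => ?_) |>.congr rfl (by simp) fun z => Iff.rfl
    all_goals simp only [Set.mem_singleton_iff, mem_box, Prod.ext_iff]; omega

/-- A column, upwards. -/
theorem hamPath_col {s s' : ℤ} (x : ℤ) (h : s < s') :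
    HamPath (box x (x + 1) s s') (x, s) (x, s' - 1) := by
  refine (hamPath_row x h).transpose fun z => ?_
  simp only [mem_box]
  omega

/-- The horizontal snake starting at the lower left corner of a rectangle. -/
theorem hamPath_snake {a a' s s' : ℤ} (h : a < a') (h' : s < s') :
    HamPath (box a a' s s') (a, s) (if Odd (s' - s) then a' - 1 else a, s' - 1) := by
  induction s', (show s + 1 ≤ s' by omega) using Int.leInduction with
  | base =>
    refine (hamPath_row s h).congr rfl (by simp) fun z => ?_
    simp only [mem_box]
  | succ n hn ih =>
    by_cases ho : Odd (n - s)
    · have hr := ((hamPath_row n h).symm)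
      have he : ¬ Odd (n + 1 - s) := by grind
      rw [if_pos ho] at ih
      rw [if_neg he]
      refine (ih (by omega)).trans hr (by simp [gridGraph_adj])
        (fun z => ?_) (fun z => ?_) |>.congr rfl (by simp) fun z => Iff.rfl
      all_goals simp only [mem_box]; omega
    · have hr := hamPath_row n h
      have he : Odd (n + 1 - s) := by grind
      rw [if_neg ho] at ih
      rw [if_pos he]
      refine (ih (by omega)).trans hr (by simp [gridGraph_adj])
        (fun z => ?_) (fun z => ?_) |>.congr rfl (by simp) fun z => Iff.rfl
      all_goals simp only [mem_box]; omega

section corners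

variable {a a' s s' : ℤ}

/-- Lower left to upper right corner, odd number of rows. -/
theorem hamPath_BL_TR (h : a < a') (h' : s < s') (ho : (s' - s) % 2 = 1) :
    HamPath (box a a' s s') (a, s) (a' - 1, s' - 1) := by
  simpa [Int.odd_iff, ho] using hamPath_snake h h'

/-- Lower left to upper left corner, even number of rows. -/
theorem hamPath_BL_TL (h : a < a') (h' : s < s') (ho : (s' - s) % 2 = 0) :
    HamPath (box a a' s s') (a, s) (a, s' - 1) := by
  simpa [Int.odd_iff, ho] using hamPath_snake h h'

/-- Upper left to lower right corner, odd number of rows. -/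
theorem hamPath_TL_BR (h : a < a') (h' : s < s') (ho : (s' - s) % 2 = 1) :
    HamPath (box a a' s s') (a, s' - 1) (a' - 1, s) := by
  refine ((hamPath_BL_TR h h' ho).reflectY (s + s' - 1) (G := box a a' s s') fun z => ?_).congr
    (by ext <;> simp; ring) (by ext <;> simp) fun z => Iff.rfl
  simp only [mem_box]
  omega

/-- Upper right to lower right corner, even number of rows. -/
theorem hamPath_TR_BR (h : a < a') (h' : s < s') (ho : (s' - s) % 2 = 0) :
    HamPath (box a a' s s') (a' - 1, s' - 1) (a' - 1, s) := by
  refine ((hamPath_BL_TL h h' ho).symm.reflectX (a + a' - 1) (G := box a a' s s')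
    fun z => ?_).congr (by ext <;> simp; ring) (by ext <;> simp; ring) fun z => Iff.rfl
  simp only [mem_box]
  omega

/-- Lower left to lower right corner, even number of columns. -/
theorem hamPath_BL_BR (h : a < a') (h' : s < s') (ho : (a' - a) % 2 = 0) :
    HamPath (box a a' s s') (a, s) (a' - 1, s) := by
  refine (hamPath_BL_TL h' h ho).transpose fun z => ?_
  simp only [mem_box]
  omega

/-- Upper left to upper right corner, even number of columns. -/
theorem hamPath_TL_TR (h : a < a') (h' : s < s') (ho : (a' - a) % 2 = 0) :
    HamPath (box a a' s s') (a, s' - 1) (a' - 1, s' - 1) := by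
  refine (hamPath_TR_BR h' h ho).symm.transpose fun z => ?_
  simp only [mem_box]
  omega

/-- Lower left to lower right corner, odd numbers of rows and columns. -/
theorem hamPath_BL_BR_of_odd (h : a + 1 < a') (h' : s < s') (ho : (s' - s) % 2 = 1) :
    HamPath (box a a' s s') (a, s) (a' - 1, s) := by
  refine (hamPath_col a h').trans (hamPath_TL_BR (a := a + 1) (by omega) h' ho)
    (by simp [gridGraph_adj]) (fun z => ?_) (fun z => ?_)
  all_goals simp only [mem_box]; omega

end corners

/-! ### Paths along a band and their phase -/

/-- The point at which a path along the band `-b ≤ y < 0` enters the column `m`, going to the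
right: the top or the bottom of the column, according to the parity of `m` and the phase `θ`. -/
def entry (b θ m : ℤ) : ℤ × ℤ := (m, if (m + θ) % 2 = 0 then -1 else -b)

/-- The point from which a path along the band goes on to `entry b θ m`. -/
def depart (b θ m : ℤ) : ℤ × ℤ := (m - 1, if (m + θ) % 2 = 0 then -1 else -b)

/-- The part of the band with upper profile `f` and lower profile `g` above the columns
`m, …, m' - 1`. -/
def band (b : ℤ) (f g : ℤ → ℤ) (m m' : ℤ) : Set (ℤ × ℤ) :=
  {z | m ≤ z.1 ∧ z.1 < m' ∧ -b + g z.1 ≤ z.2 ∧ z.2 < f z.1}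

theorem mem_band {b : ℤ} {f g : ℤ → ℤ} {m m' : ℤ} {z : ℤ × ℤ} :
    z ∈ band b f g m m' ↔ m ≤ z.1 ∧ z.1 < m' ∧ -b + g z.1 ≤ z.2 ∧ z.2 < f z.1 := Iff.rfl

/-- The band above the columns `m, …, m' - 1` has a Hamiltonian path from the entry point of
phase `θ` to the depart point of phase `θ'`. -/
def BandPath (b : ℤ) (f g : ℤ → ℤ) (m θ m' θ' : ℤ) : Prop :=
  (m = m' ∧ (θ' - θ) % 2 = 0) ∨
    (m < m' ∧ HamPath (band b f g m m') (entry b θ m) (depart b θ' m'))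

/-- The band above the columns `m, …, m' - 1` splits into a Hamiltonian path from the entry point
to `x` and one from `y` to the depart point. -/
def BandBreak (b : ℤ) (f g : ℤ → ℤ) (m θ m' θ' : ℤ) (x y : ℤ × ℤ) : Prop :=
  m < m' ∧ ∃ F G : Set (ℤ × ℤ), HamPath F (entry b θ m) x ∧ HamPath G y (depart b θ' m') ∧
    (∀ z, z ∈ F → z ∉ G) ∧ ∀ z, z ∈ band b f g m m' ↔ z ∈ F ∨ z ∈ G

section

variable {b : ℤ} {f g f' g' : ℤ → ℤ} {m θ m' θ' m'' θ'' : ℤ} {x y : ℤ × ℤ}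

theorem entry_eq_top (h : (m + θ) % 2 = 0) : entry b θ m = (m, -1) := by simp [entry, h]

theorem entry_eq_bot (h : (m + θ) % 2 = 1) : entry b θ m = (m, -b) := by simp [entry, h]

theorem depart_eq_top (h : (m + θ) % 2 = 0) : depart b θ m = (m - 1, -1) := by simp [depart, h]

theorem depart_eq_bot (h : (m + θ) % 2 = 1) : depart b θ m = (m - 1, -b) := by simp [depart, h]

theorem adj_depart_entry (b θ m : ℤ) : gridGraph.Adj (depart b θ m) (entry b θ m) := by
  simp [gridGraph_adj, depart, entry]

theorem entry_congr (h : (θ' - θ) % 2 = 0) : entry b θ m = entry b θ' m := by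
  have : (m + θ) % 2 = (m + θ') % 2 := by omega
  simp [entry, this]

theorem depart_congr (h : (θ' - θ) % 2 = 0) : depart b θ m = depart b θ' m := by
  have : (m + θ) % 2 = (m + θ') % 2 := by omega
  simp [depart, this]

theorem BandPath.refl (b : ℤ) (f g : ℤ → ℤ) (m θ : ℤ) : BandPath b f g m θ m θ :=
  Or.inl ⟨rfl, by simp⟩

theorem BandPath.hamPath (h : BandPath b f g m θ m' θ') (hm : m < m') :
    HamPath (band b f g m m') (entry b θ m) (depart b θ' m') := by
  obtain ⟨h, -⟩ | ⟨-, h⟩ := h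
  · omega
  · exact h

theorem BandPath.congr_phase {θ₁ θ₁' : ℤ} (h : BandPath b f g m θ m' θ')
    (h₁ : (θ₁ - θ) % 2 = 0) (h₂ : (θ₁' - θ') % 2 = 0) : BandPath b f g m θ₁ m' θ₁' := by
  obtain ⟨h, h'⟩ | ⟨h, h'⟩ := h
  · exact Or.inl ⟨h, by omega⟩
  · exact Or.inr ⟨h, h'.congr (entry_congr h₁) (depart_congr h₂) fun z => Iff.rfl⟩

theorem band_congr (hf : ∀ x, m ≤ x → x < m' → f x = f' x)
    (hg : ∀ x, m ≤ x → x < m' → g x = g' x) (z : ℤ × ℤ) :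
    z ∈ band b f g m m' ↔ z ∈ band b f' g' m m' := by
  simp only [mem_band]
  constructor <;> rintro ⟨h1, h2, h3, h4⟩ <;> refine ⟨h1, h2, ?_, ?_⟩ <;>
    have := hf z.1 h1 h2 <;> have := hg z.1 h1 h2 <;> omega

theorem BandPath.congr (h : BandPath b f g m θ m' θ') (hf : ∀ x, m ≤ x → x < m' → f x = f' x)
    (hg : ∀ x, m ≤ x → x < m' → g x = g' x) : BandPath b f' g' m θ m' θ' := by
  obtain h | ⟨h, h'⟩ := h
  · exact Or.inl h
  · exact Or.inr ⟨h, h'.congr rfl rfl (band_congr hf hg)⟩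

theorem BandPath.trans (h₁ : BandPath b f g m θ m' θ') (h₂ : BandPath b f g m' θ' m'' θ'') :
    BandPath b f g m θ m'' θ'' := by
  obtain ⟨rfl, h⟩ | ⟨h, h'⟩ := h₁
  · exact h₂.congr_phase (by omega) (by simp)
  obtain ⟨rfl, hh⟩ | ⟨hh, hh'⟩ := h₂
  · exact Or.inr ⟨h, h'.congr rfl (depart_congr hh) fun z => Iff.rfl⟩
  · refine Or.inr ⟨h.trans hh, h'.trans hh' (adj_depart_entry b θ' m') (fun z => ?_) fun z => ?_⟩
    all_goals simp only [mem_band]; omega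

theorem BandPath.trans_break (h₁ : BandPath b f g m θ m' θ')
    (h₂ : BandBreak b f g m' θ' m'' θ'' x y) : BandBreak b f g m θ m'' θ'' x y := by
  obtain ⟨hm, F, G, hF, hG, hd, hu⟩ := h₂
  obtain ⟨rfl, h⟩ | ⟨h, h'⟩ := h₁
  · exact ⟨hm, F, G, hF.congr (entry_congr (by omega)) rfl fun z => Iff.rfl, hG, hd, hu⟩
  · refine ⟨h.trans hm, band b f g m m' ∪ F, G, h'.trans hF (adj_depart_entry b θ' m') ?_
      (fun z => Iff.rfl), hG, ?_, ?_⟩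
    · intro z hz hz'
      have := (hu z).2 (Or.inl hz')
      simp only [mem_band] at hz this
      omega
    · rintro z (hz | hz) hz'
      · have := (hu z).2 (Or.inr hz')
        simp only [mem_band] at hz this
        omega
      · exact hd z hz hz'
    · intro z
      rw [Set.mem_union, or_assoc, ← hu]
      simp only [mem_band]
      omega

theorem BandBreak.trans (h₁ : BandBreak b f g m θ m' θ' x y)
    (h₂ : BandPath b f g m' θ' m'' θ'') : BandBreak b f g m θ m'' θ'' x y := by
  obtain ⟨hm, F, G, hF, hG, hd, hu⟩ := h₁
  obtain ⟨rfl, h⟩ | ⟨h, h'⟩ := h₂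
  · exact ⟨hm, F, G, hF, hG.congr rfl (depart_congr h) fun z => Iff.rfl, hd, hu⟩
  · refine ⟨hm.trans h, F, G ∪ band b f g m' m'', hF, hG.trans h' (adj_depart_entry b θ' m') ?_
      (fun z => Iff.rfl), ?_, ?_⟩
    · intro z hz hz'
      have := (hu z).2 (Or.inr hz)
      simp only [mem_band] at hz' this
      omega
    · rintro z hz (hz' | hz')
      · exact hd z hz hz'
      · have := (hu z).2 (Or.inl hz)
        simp only [mem_band] at hz' this
        omega
    · intro z
      rw [Set.mem_union, ← or_assoc, ← hu]
      simp only [mem_band]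
      omega

/-- The step from one column to the next at a cut between two pieces of the path is an edge of the
path; this makes every such step breakable. -/
theorem BandPath.break_cut (h₁ : BandPath b f g m θ m' θ')
    (h₂ : BandPath b f g m' θ' m'' θ'') (hm : m < m') (hm' : m' < m'') :
    BandBreak b f g m θ m'' θ'' (depart b θ' m') (entry b θ' m') := by
  refine ⟨hm.trans hm', _, _, h₁.hamPath hm, h₂.hamPath hm', fun z => ?_, fun z => ?_⟩
  all_goals simp only [mem_band]; omega

theorem reflect_depart (b s θ m : ℤ) :
    (s - 1 - (depart b θ m).1, (depart b θ m).2) = entry b (θ + s) (s - m) := by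
  have : (m + θ) % 2 = (s - m + (θ + s)) % 2 := by omega
  simp only [depart, entry, this]
  ext <;> simp

theorem reflect_entry (b s θ m : ℤ) :
    (s - 1 - (entry b θ m).1, (entry b θ m).2) = depart b (θ + s) (s - m) := by
  have : (m + θ) % 2 = (s - m + (θ + s)) % 2 := by omega
  simp only [depart, entry, this]
  ext <;> simp
  ring

/-- Reflection reverses the direction of travel, so entry and depart points trade places, as do `x`
and `y`. The phase moves by `s` because position `m` becomes `s - m`. -/
theorem BandBreak.reflect (h : BandBreak b f g m θ m' θ' x y) (s : ℤ) :
    BandBreak b (fun x => f (s - 1 - x)) (fun x => g (s - 1 - x)) (s - m') (θ' + s) (s - m)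
      (θ + s) (s - 1 - y.1, y.2) (s - 1 - x.1, x.2) := by
  obtain ⟨hm, F, G, hF, hG, hd, hu⟩ := h
  refine ⟨by omega, {z | (s - 1 - z.1, z.2) ∈ G}, {z | (s - 1 - z.1, z.2) ∈ F},
    (hG.symm.reflectX (s - 1) fun z => Iff.rfl).congr (reflect_depart ..) rfl fun z => Iff.rfl,
    (hF.symm.reflectX (s - 1) fun z => Iff.rfl).congr rfl (reflect_entry ..) fun z => Iff.rfl,
    fun z h h' => hd _ h' h, fun z => ?_⟩
  have := hu (s - 1 - z.1, z.2)
  simp only [Set.mem_ofPred_eq]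
  rw [or_comm, ← this]
  simp only [mem_band]
  omega

/-- Reduction of a band to a rectangle on which the profiles are constant. -/
theorem mem_band_iff_mem_box {u v : ℤ} (hf : ∀ x, m ≤ x → x < m' → f x = u)
    (hg : ∀ x, m ≤ x → x < m' → g x = v) (z : ℤ × ℤ) :
    z ∈ band b f g m m' ↔ z ∈ box m m' (-b + v) u := by
  simp only [mem_band, mem_box]
  constructor <;> rintro ⟨h1, h2, h3, h4⟩ <;> refine ⟨h1, h2, ?_, ?_⟩ <;>
    have := hf z.1 h1 h2 <;> have := hg z.1 h1 h2 <;> omega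

/-- The plain zigzag: traversing one column switches between top and bottom, which is also what
`entry` does when `m` grows by one. Hence the phase is constant. -/
theorem bandPath_flat (hb : b % 2 = 0) (hb0 : 0 < b) (θ : ℤ) (hm : m ≤ m')
    (hf : ∀ x, m ≤ x → x < m' → f x = 0) (hg : ∀ x, m ≤ x → x < m' → g x = 0) :
    BandPath b f g m θ m' θ := by
  induction m', hm using Int.leInduction with
  | base => exact BandPath.refl ..
  | succ n hn ih =>
    refine (ih (fun x h h' => hf x h (by omega)) (fun x h h' => hg x h (by omega))).trans
      (Or.inr ⟨by omega, ?_⟩)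
    have hc := hamPath_col (s := -b) (s' := 0) n (by omega)
    have hs := mem_band_iff_mem_box (b := b) (m := n) (m' := n + 1) (f := f) (g := g)
      (u := 0) (v := 0) (fun x h h' => hf x (by omega) h') (fun x h h' => hg x (by omega) h')
    simp only [add_zero] at hs
    by_cases hp : (n + θ) % 2 = 0
    · rw [entry_eq_top hp, depart_eq_bot (by omega)]
      exact hc.symm.congr (by simp) (by simp) fun z => (hs z).symm
    · rw [entry_eq_bot (by omega), depart_eq_top (by omega)]
      exact hc.congr (by simp) (by simp) fun z => (hs z).symm

/-- A bump of odd width and odd height is passed by a path entering and leaving at the bottom. -/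
theorem bandPath_bump (hb : b % 2 = 0) {c p d : ℤ} (hp : p % 2 = 1) (hp3 : 3 ≤ p)
    (hd : d % 2 = 1) (hbd : 3 ≤ b + d) (hc : (c + θ) % 2 = 1)
    (hf : ∀ x, c ≤ x → x < c + p → f x = d) (hg : ∀ x, c ≤ x → x < c + p → g x = 0) :
    BandPath b f g c θ (c + p) (θ + 1) := by
  have hs := mem_band_iff_mem_box (b := b) hf hg
  refine Or.inr ⟨by omega, ?_⟩
  rw [entry_eq_bot (by omega), depart_eq_bot (by omega)]
  exact (hamPath_BL_BR_of_odd (a := c) (a' := c + p) (s := -b + 0) (s' := d) (by omega) (by omega)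
    (by omega)).congr (by simp) (by simp) fun z => (hs z).symm

/-- A notch of width `3` leaving only one row is passed by a path staying at the top. -/
theorem bandPath_notch {n : ℤ} (hn : (n + θ) % 2 = 0)
    (hf : ∀ x, n ≤ x → x < n + 3 → f x = 0) (hg : ∀ x, n ≤ x → x < n + 3 → g x = b - 1) :
    BandPath b f g n θ (n + 3) (θ + 1) := by
  have hs := mem_band_iff_mem_box (b := b) hf hg
  refine Or.inr ⟨by omega, ?_⟩
  rw [entry_eq_top (by omega), depart_eq_top (by omega)]
  exact (hamPath_row (a := n) (a' := n + 3) (-1) (by omega)).congr (by simp) (by simp)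
    fun z => by rw [hs z, show -b + (b - 1) = -1 by ring]; simp

end

/-! ### Absorbing a bump, or passing it on as a notch -/

/-- On the columns `lo, …, hi - 1`, the profile `f` is a single bump of width `p` and height `d`
starting at column `c`. -/
def IsBumpOn (f : ℤ → ℤ) (c p d lo hi : ℤ) : Prop :=
  ∀ x, lo ≤ x → x < hi → f x = if c ≤ x ∧ x < c + p then d else 0

namespace IsBumpOn

variable {f : ℤ → ℤ} {c p d lo hi x : ℤ}

theorem eq_zero (h : IsBumpOn f c p d lo hi) (h₁ : lo ≤ x) (h₂ : x < hi)
    (h₃ : x < c ∨ c + p ≤ x) : f x = 0 := by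
  rw [h x h₁ h₂, if_neg (by omega)]

theorem eq_height (h : IsBumpOn f c p d lo hi) (h₁ : lo ≤ x) (h₂ : x < hi)
    (h₃ : c ≤ x) (h₄ : x < c + p) : f x = d := by
  rw [h x h₁ h₂, if_pos ⟨h₃, h₄⟩]

theorem reflect (h : IsBumpOn f c p d lo hi) (s : ℤ) :
    IsBumpOn (fun x => f (s - 1 - x)) (s - (c + p)) p d (s - hi) (s - lo) := by
  intro x h₁ h₂
  have := h (s - 1 - x) (by omega) (by omega)
  simp only [this]
  congr 1
  rw [eq_iff_iff]
  omega

theorem mono (h : IsBumpOn f c p d lo hi) {lo' hi' : ℤ} (h₁ : lo ≤ lo') (h₂ : hi' ≤ hi) :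
    IsBumpOn f c p d lo' hi' := fun x h h' => ‹IsBumpOn f c p d lo hi› x (by omega) (by omega)

end IsBumpOn

section

variable {b : ℤ} {f g : ℤ → ℤ} {θ c p d : ℤ}

/-- A bump is passed on to the inner side of the band at four columns to its left. -/
theorem bandPath_pass_left (hb : b % 2 = 0) (hb0 : 0 < b) (hp : p % 2 = 1) (hp3 : 3 ≤ p)
    (hd : d % 2 = 1) (hbd : 3 ≤ b + d) (hc : (c + θ) % 2 = 0)
    (hf : IsBumpOn f c p d (c - 8) (c + p + 8))
    (hg : IsBumpOn g (c - 4) 3 (b - 1) (c - 8) (c + p + 8)) :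
    BandPath b f g (c - 8) θ (c + p + 8) θ := by
  have h1 : BandPath b f g (c - 8) θ (c - 4) θ := bandPath_flat hb hb0 θ (by omega)
    (fun x h h' => hf.eq_zero (by omega) (by omega) (by omega))
    (fun x h h' => hg.eq_zero (by omega) (by omega) (by omega))
  have h2 : BandPath b f g (c - 4) θ (c - 4 + 3) (θ + 1) := bandPath_notch (by omega)
    (fun x h h' => hf.eq_zero (by omega) (by omega) (by omega))
    (fun x h h' => hg.eq_height (by omega) (by omega) (by omega) (by omega))
  have h3 : BandPath b f g (c - 4 + 3) (θ + 1) c (θ + 1) := bandPath_flat hb hb0 _ (by omega)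
    (fun x h h' => hf.eq_zero (by omega) (by omega) (by omega))
    (fun x h h' => hg.eq_zero (by omega) (by omega) (by omega))
  have h4 : BandPath b f g c (θ + 1) (c + p) (θ + 1 + 1) := bandPath_bump hb hp hp3 hd hbd
    (by omega)
    (fun x h h' => hf.eq_height (by omega) (by omega) (by omega) (by omega))
    (fun x h h' => hg.eq_zero (by omega) (by omega) (by omega))
  have h5 : BandPath b f g (c + p) (θ + 1 + 1) (c + p + 8) (θ + 1 + 1) :=
    bandPath_flat hb hb0 _ (by omega)
      (fun x h h' => hf.eq_zero (by omega) (by omega) (by omega))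
      (fun x h h' => hg.eq_zero (by omega) (by omega) (by omega))
  exact ((((h1.trans h2).trans h3).trans h4).trans h5).congr_phase (by omega) (by omega)

/-- The path past a bump that is not passed on to the inner side of the band. -/
theorem bandPath_absorb (hb : b % 2 = 0) (hb0 : 0 < b) (hp : p % 2 = 1) (hp3 : 3 ≤ p)
    (hd : d % 2 = 1) (hbd : 3 ≤ b + d) (hc : (c + θ) % 2 = 1) {lo hi : ℤ} (hlo : lo ≤ c)
    (hhi : c + p ≤ hi) (hf : IsBumpOn f c p d lo hi) (hg : ∀ x, lo ≤ x → x < hi → g x = 0) :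
    BandPath b f g lo θ hi (θ + 1) := by
  have h3 : BandPath b f g lo θ c θ := bandPath_flat hb hb0 _ (by omega)
    (fun x h h' => hf.eq_zero (by omega) (by omega) (by omega))
    (fun x h h' => hg x (by omega) (by omega))
  have h4 : BandPath b f g c θ (c + p) (θ + 1) := bandPath_bump hb hp hp3 hd hbd
    (by omega)
    (fun x h h' => hf.eq_height (by omega) (by omega) (by omega) (by omega))
    (fun x h h' => hg x (by omega) (by omega))
  have h5 : BandPath b f g (c + p) (θ + 1) hi (θ + 1) :=
    bandPath_flat hb hb0 _ (by omega)
      (fun x h h' => hf.eq_zero (by omega) (by omega) (by omega))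
      (fun x h h' => hg x (by omega) (by omega))
  exact (h3.trans h4).trans h5

/-- The part of the path past a bump to the right of it, when the bump is passed on there. -/
theorem bandPath_notch_right (hb : b % 2 = 0) (hb0 : 0 < b) (hp : p % 2 = 1) (hp3 : 3 ≤ p)
    (hc : (c + θ) % 2 = 1) (hf : IsBumpOn f c p d (c - 8) (c + p + 8))
    (hg : IsBumpOn g (c + p + 1) 3 (b - 1) (c - 8) (c + p + 8)) :
    BandPath b f g (c + p) (θ + 1) (c + p + 8) θ := by
  have h1 : BandPath b f g (c + p) (θ + 1) (c + p + 1) (θ + 1) := bandPath_flat hb hb0 _ (by omega)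
    (fun x h h' => hf.eq_zero (by omega) (by omega) (by omega))
    (fun x h h' => hg.eq_zero (by omega) (by omega) (by omega))
  have h2 : BandPath b f g (c + p + 1) (θ + 1) (c + p + 1 + 3) (θ + 1 + 1) :=
    bandPath_notch (by omega)
      (fun x h h' => hf.eq_zero (by omega) (by omega) (by omega))
      (fun x h h' => hg.eq_height (by omega) (by omega) (by omega) (by omega))
  have h3 : BandPath b f g (c + p + 1 + 3) (θ + 1 + 1) (c + p + 8) (θ + 1 + 1) :=
    bandPath_flat hb hb0 _ (by omega)
      (fun x h h' => hf.eq_zero (by omega) (by omega) (by omega))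
      (fun x h h' => hg.eq_zero (by omega) (by omega) (by omega))
  exact ((h1.trans h2).trans h3).congr_phase (by omega) (by omega)

/-- A bump is passed on to the inner side of the band right after it. -/
theorem bandPath_pass_right (hb : b % 2 = 0) (hb0 : 0 < b) (hp : p % 2 = 1) (hp3 : 3 ≤ p)
    (hd : d % 2 = 1) (hbd : 3 ≤ b + d) (hc : (c + θ) % 2 = 1)
    (hf : IsBumpOn f c p d (c - 8) (c + p + 8))
    (hg : IsBumpOn g (c + p + 1) 3 (b - 1) (c - 8) (c + p + 8)) :
    BandPath b f g (c - 8) θ (c + p + 8) θ :=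
  (bandPath_absorb hb hb0 hp hp3 hd hbd hc (by omega) le_rfl (hf.mono le_rfl (by omega))
    (fun x h h' => hg.eq_zero (by omega) (by omega) (by omega))).trans
    (bandPath_notch_right hb hb0 hp hp3 hc hf hg)

/-! ### Paths through a prescribed edge near a bump -/

/-- The edge `x y` near the bump can be made part of a path which passes the bump on to the
inner side of the band. -/
def Breakable (b c p d : ℤ) (x y : ℤ × ℤ) : Prop :=
  -- The parity condition on `n` preserves the sign of the bump. The last alternative keeps the
  -- notch from lying below a cut, where the ring would become empty; below an added bump it does no
  -- harm.
  ∃ θ n : ℤ, (n - c) % 2 = 0 ∧ c - 4 ≤ n ∧ n ≤ c + p + 1 ∧ (0 < d ∨ n + 3 ≤ c ∨ c + p ≤ n) ∧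
    ∀ f g : ℤ → ℤ, IsBumpOn f c p d (c - 8) (c + p + 8) →
      IsBumpOn g n 3 (b - 1) (c - 8) (c + p + 8) →
      BandBreak b f g (c - 8) θ (c + p + 8) θ x y ∨ BandBreak b f g (c - 8) θ (c + p + 8) θ y x

variable {x y : ℤ × ℤ}

theorem Breakable.symm (h : Breakable b c p d x y) : Breakable b c p d y x := by
  obtain ⟨θ, n, h1, h2, h3, h4, h⟩ := h
  exact ⟨θ, n, h1, h2, h3, h4, fun f g hf hg => (h f g hf hg).symm⟩

/-- Reflection in the axis of the bump reduces its right half to its left half. As `p` is odd, the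
reflected notch, which has odd width 3, still starts at a column of the parity of `c`. -/
theorem Breakable.reflect (hp : p % 2 = 1) (h : Breakable b c p d x y) :
    Breakable b c p d (2 * c + p - 1 - x.1, x.2) (2 * c + p - 1 - y.1, y.2) := by
  obtain ⟨θ, n, h1, h2, h3, h4, h⟩ := h
  refine ⟨θ + (2 * c + p), 2 * c + p - (n + 3), by omega, by omega, by omega, by omega, ?_⟩
  intro f g hf hg
  have hf' := hf.reflect (2 * c + p)
  have hg' := hg.reflect (2 * c + p)
  rw [show 2 * c + p - (c + p) = c by ring, show 2 * c + p - (c + p + 8) = c - 8 by ring,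
    show 2 * c + p - (c - 8) = c + p + 8 by ring] at hf'
  rw [show 2 * c + p - (2 * c + p - (n + 3) + 3) = n by ring,
    show 2 * c + p - (c + p + 8) = c - 8 by ring,
    show 2 * c + p - (c - 8) = c + p + 8 by ring] at hg'
  have e1 : 2 * c + p - (c + p + 8) = c - 8 := by ring
  have e2 : 2 * c + p - (c - 8) = c + p + 8 := by ring
  obtain h | h := h _ _ hf' hg'
  · right
    have := h.reflect (2 * c + p)
    simpa only [sub_sub_cancel, e1, e2] using this
  · left
    have := h.reflect (2 * c + p)
    simpa only [sub_sub_cancel, e1, e2] using this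

/-- The phase `-(m + 1)` makes the path step from column `m` to column `m + 1` along the top row, so
the edge is a cut. The side on which the bump must be passed on is then forced by parity. -/
theorem breakable_flat (hb : b % 2 = 0) (hb0 : 0 < b) (hp : p % 2 = 1) (hp3 : 3 ≤ p)
    (hd : d % 2 = 1) (hbd : 3 ≤ b + d) {m : ℤ} (hm : c - 8 ≤ m) (hmc : m + 1 < c) :
    Breakable b c p d (m, -1) (m + 1, -1) := by
  by_cases hθ : (c + -(m + 1)) % 2 = 0
  · refine ⟨-(m + 1), c - 4, by omega, by omega, by omega, by omega, fun f g hf hg => Or.inl ?_⟩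
    have h4 : BandPath b f g (c - 4 + 3) (-(m + 1) + 1) (c + p + 8) (-(m + 1) + 1 + 1) := by
      refine bandPath_absorb hb hb0 hp hp3 hd hbd (by omega) (by omega) (by omega)
        (hf.mono (by omega) le_rfl)
        (fun x h h' => hg.eq_zero (by omega) (by omega) (by omega))
    have h2 : BandPath b f g (c - 4) (-(m + 1)) (c - 4 + 3) (-(m + 1) + 1) :=
      bandPath_notch (by omega)
        (fun x h h' => hf.eq_zero (by omega) (by omega) (by omega))
        (fun x h h' => hg.eq_height (by omega) (by omega) (by omega) (by omega))
    -- The one position at which the edge lies within the single row left by the notch, instead of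
    -- at a cut between pieces.
    by_cases hm' : m + 1 = c - 2
    · have h1 : BandPath b f g (c - 8) (-(m + 1)) (c - 4) (-(m + 1)) :=
        bandPath_flat hb hb0 _ (by omega)
          (fun x h h' => hf.eq_zero (by omega) (by omega) (by omega))
          (fun x h h' => hg.eq_zero (by omega) (by omega) (by omega))
      have h3 : BandBreak b f g (c - 4) (-(m + 1)) (c - 4 + 3) (-(m + 1) + 1)
          (m, -1) (m + 1, -1) := by
        refine ⟨by omega, box (c - 4) (c - 2) (-1) (-1 + 1), box (c - 2) (c - 1) (-1) (-1 + 1),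
          ?_, ?_, fun z => ?_, fun z => ?_⟩
        · rw [entry_eq_top (by omega)]
          exact (hamPath_row (-1) (by omega)).congr rfl (by ext <;> simp; omega) fun z => Iff.rfl
        · rw [depart_eq_top (by omega)]
          exact (hamPath_row (-1) (by omega)).congr (by ext <;> simp; omega) (by ext <;> simp; omega)
            fun z => Iff.rfl
        · simp only [mem_box]; omega
        · rw [mem_band_iff_mem_box (b := b) (f := f) (g := g) (u := 0) (v := b - 1)
            (fun x h h' => hf.eq_zero (by omega) (by omega) (by omega))
            (fun x h h' => hg.eq_height (by omega) (by omega) (by omega) (by omega))]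
          simp only [mem_box]; omega
      have := (h1.trans_break h3).trans h4
      obtain ⟨hm, F, G, hF, hG, hd, hu⟩ := this
      exact ⟨hm, F, G, hF, hG.congr rfl (depart_congr (by omega)) fun z => Iff.rfl, hd, hu⟩
    · have h0 : BandPath b f g (c - 8) (-(m + 1)) (m + 1) (-(m + 1)) :=
        bandPath_flat hb hb0 _ (by omega)
          (fun x h h' => hf.eq_zero (by omega) (by omega) (by omega))
          (fun x h h' => hg.eq_zero (by omega) (by omega) (by omega))
      have h1 : BandPath b f g (m + 1) (-(m + 1)) (c - 4) (-(m + 1)) :=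
        bandPath_flat hb hb0 _ (by omega)
          (fun x h h' => hf.eq_zero (by omega) (by omega) (by omega))
          (fun x h h' => hg.eq_zero (by omega) (by omega) (by omega))
      have := h0.break_cut (((h1.trans h2).trans h4).congr_phase (by omega)
        (show (-(m + 1) - _) % 2 = 0 by omega)) (by omega) (by omega)
      rwa [entry_eq_top (by omega), depart_eq_top (by omega), add_sub_cancel_right] at this
  · refine ⟨-(m + 1), c + p + 1, by omega, by omega, by omega, by omega, fun f g hf hg => Or.inl ?_⟩
    have h0 : BandPath b f g (c - 8) (-(m + 1)) (m + 1) (-(m + 1)) :=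
      bandPath_flat hb hb0 _ (by omega)
        (fun x h h' => hf.eq_zero (by omega) (by omega) (by omega))
        (fun x h h' => hg.eq_zero (by omega) (by omega) (by omega))
    have h1 : BandPath b f g (m + 1) (-(m + 1)) (c + p) (-(m + 1) + 1) :=
      bandPath_absorb hb hb0 hp hp3 hd hbd (by omega) (by omega) (by omega)
        (hf.mono (by omega) (by omega))
        (fun x h h' => hg.eq_zero (by omega) (by omega) (by omega))
    have h2 := bandPath_notch_right (θ := -(m + 1)) hb hb0 hp hp3 (by omega) hf hg
    have := h0.break_cut (h1.trans h2) (by omega) (by omega)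
    rwa [entry_eq_top (by omega), depart_eq_top (by omega), add_sub_cancel_right] at this

/-- A column of the flat band can be broken at each of its edges. -/
theorem bandBreak_column (hb : b % 2 = 0) {m r : ℤ} (hf : f m = 0) (hg : g m = 0)
    (hr : -b ≤ r) (hr' : r + 1 < 0) (θ : ℤ) :
    BandBreak b f g m θ (m + 1) θ (m, r) (m, r + 1) ∨
      BandBreak b f g m θ (m + 1) θ (m, r + 1) (m, r) := by
  have hs := mem_band_iff_mem_box (b := b) (m := m) (m' := m + 1) (f := f) (g := g)
    (u := 0) (v := 0) (fun x h h' => by rwa [show x = m by omega])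
    (fun x h h' => by rwa [show x = m by omega])
  have h1 := hamPath_col (s := -b) (s' := r + 1) m (by omega)
  have h2 := hamPath_col (s := r + 1) (s' := 0) m (by omega)
  by_cases hp : (m + θ) % 2 = 0
  · right
    refine ⟨by omega, _, _, h2.symm.congr ?_ rfl fun z => Iff.rfl,
      h1.symm.congr (by simp) ?_ fun z => Iff.rfl, fun z => ?_, fun z => ?_⟩
    · rw [entry_eq_top hp]; simp
    · rw [depart_eq_bot (by omega)]; simp
    · simp only [mem_box]; omega
    · rw [hs]; simp only [mem_box]; omega
  · left
    refine ⟨by omega, _, _, h1.congr ?_ (by simp) fun z => Iff.rfl,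
      h2.congr rfl ?_ fun z => Iff.rfl, fun z => ?_, fun z => ?_⟩
    · rw [entry_eq_bot (by omega)]
    · rw [depart_eq_top (by omega)]; simp
    · simp only [mem_box]; omega
    · rw [hs]; simp only [mem_box]; omega

/-- Vertical edges outside the bump lie on full columns of the zigzag, so any phase uses them. The
phase `1 - c`, which enters the bump at the bottom and passes it on to the right, keeps the columns
before the bump free of notches. Such edges are on the boundary when they border a cut. -/
theorem breakable_column (hb : b % 2 = 0) (hb0 : 0 < b) (hp : p % 2 = 1) (hp3 : 3 ≤ p)
    (hd : d % 2 = 1) (hbd : 3 ≤ b + d) {m r : ℤ} (hm : c - 8 ≤ m) (hmc : m < c)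
    (hr : -b ≤ r) (hr' : r + 1 < 0) :
    Breakable b c p d (m, r) (m, r + 1) := by
  refine ⟨1 - c, c + p + 1, by omega, by omega, by omega, by omega, fun f g hf hg => ?_⟩
  have h0 : BandPath b f g (c - 8) (1 - c) m (1 - c) :=
    bandPath_flat hb hb0 _ (by omega)
      (fun x h h' => hf.eq_zero (by omega) (by omega) (by omega))
      (fun x h h' => hg.eq_zero (by omega) (by omega) (by omega))
  have h1 : BandPath b f g (m + 1) (1 - c) (c + p) (1 - c + 1) :=
    bandPath_absorb hb hb0 hp hp3 hd hbd (by omega) (by omega) (by omega)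
      (hf.mono (by omega) (by omega))
      (fun x h h' => hg.eq_zero (by omega) (by omega) (by omega))
  have h2 := bandPath_notch_right (θ := 1 - c) hb hb0 hp hp3 (by omega) hf hg
  have h3 := bandBreak_column (f := f) (g := g) hb (m := m) (r := r)
    (hf.eq_zero (by omega) (by omega) (by omega))
    (hg.eq_zero (by omega) (by omega) (by omega)) hr hr' (1 - c)
  exact h3.imp (fun h => (h0.trans_break h).trans (h1.trans h2))
    (fun h => (h0.trans_break h).trans (h1.trans h2))

/-- It suffices to break the path from the bump on, or from two columns before it on. -/
theorem breakable_of_break (hb : b % 2 = 0) (hb0 : 0 < b) (hp : p % 2 = 1) (hp3 : 3 ≤ p)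
    {m : ℤ} (hm : c - 8 ≤ m) (hmc : m ≤ c)
    (h : ∀ f g : ℤ → ℤ, IsBumpOn f c p d (c - 8) (c + p + 8) →
      (∀ x, c - 8 ≤ x → x < c + p → g x = 0) → BandBreak b f g m (1 - c) (c + p) (1 - c + 1) x y) :
    Breakable b c p d x y := by
  refine ⟨1 - c, c + p + 1, by omega, by omega, by omega, by omega, fun f g hf hg => Or.inl ?_⟩
  have h0 : BandPath b f g (c - 8) (1 - c) m (1 - c) :=
    bandPath_flat hb hb0 _ (by omega)
      (fun x h h' => hf.eq_zero (by omega) (by omega) (by omega))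
      (fun x h h' => hg.eq_zero (by omega) (by omega) (by omega))
  have h2 := bandPath_notch_right (θ := 1 - c) hb hb0 hp hp3 (by omega) hf hg
  exact (h0.trans_break (h f g hf fun x h h' => hg.eq_zero (by omega) (by omega)
    (by omega))).trans h2

/-- The path climbs the first column of the bump completely and then snakes from the upper left to
the lower right corner of the rest, which has an odd number of rows. -/
theorem breakable_left_side (hb : b % 2 = 0) (hb0 : 0 < b) (hp : p % 2 = 1) (hp3 : 3 ≤ p)
    (hd : d % 2 = 1) (hbd : 3 ≤ b + d) {r : ℤ} (hr : -b ≤ r) (hr' : r + 1 < d) :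
    Breakable b c p d (c, r) (c, r + 1) := by
  refine breakable_of_break hb hb0 hp hp3 (m := c) (by omega) le_rfl fun f g hf hg => ?_
  have hs := mem_band_iff_mem_box (b := b) (m := c) (m' := c + p) (f := f) (g := g)
    (u := d) (v := 0) (fun x h h' => hf.eq_height (by omega) (by omega) (by omega) (by omega))
    (fun x h h' => hg x (by omega) (by omega))
  have h1 := hamPath_col (s := -b) (s' := r + 1) c (by omega)
  have h2 := hamPath_col (s := r + 1) (s' := d) c (by omega)
  have h3 := hamPath_TL_BR (a := c + 1) (a' := c + p) (s := -b) (s' := d) (by omega) (by omega)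
    (by omega)
  have h4 := h2.trans h3 (H := box c (c + 1) (r + 1) d ∪ box (c + 1) (c + p) (-b) d)
    (by simp [gridGraph_adj]) (fun z => by simp only [mem_box]; omega) (fun z => Iff.rfl)
  refine ⟨by omega, _, _, h1.congr ?_ (by simp) fun z => Iff.rfl, h4.congr rfl ?_ fun z => Iff.rfl,
    fun z => ?_, fun z => ?_⟩
  · rw [entry_eq_bot (by omega)]
  · rw [depart_eq_bot (by omega)]
  · simp only [mem_box, Set.mem_union]; omega
  · rw [hs]; simp only [mem_box, Set.mem_union]; omega

/-- The path climbs the first column, runs along the whole top row, and returns to the bottom by a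
snake through the rest, which has the even number `b + d - 1` of rows. -/
theorem breakable_top_side (hb : b % 2 = 0) (hb0 : 0 < b) (hp : p % 2 = 1) (hp3 : 3 ≤ p)
    (hd : d % 2 = 1) (hbd : 3 ≤ b + d) {m : ℤ} (hm : c ≤ m) (hm' : m + 1 < c + p) :
    Breakable b c p d (m, d - 1) (m + 1, d - 1) := by
  refine breakable_of_break hb hb0 hp hp3 (m := c) (by omega) le_rfl fun f g hf hg => ?_
  have hs := mem_band_iff_mem_box (b := b) (m := c) (m' := c + p) (f := f) (g := g)
    (u := d) (v := 0) (fun x h h' => hf.eq_height (by omega) (by omega) (by omega) (by omega))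
    (fun x h h' => hg x (by omega) (by omega))
  have h1 := (hamPath_col (s := -b) (s' := d - 1) c (by omega)).trans
    (hamPath_row (a := c) (a' := m + 1) (d - 1) (by omega))
    (H := box c (c + 1) (-b) (d - 1) ∪ box c (m + 1) (d - 1) (d - 1 + 1))
    (by simp [gridGraph_adj]) (fun z => by simp only [mem_box]; omega) (fun z => Iff.rfl)
  have h2 := (hamPath_row (a := m + 1) (a' := c + p) (d - 1) (by omega)).trans
    (hamPath_TR_BR (a := c + 1) (a' := c + p) (s := -b) (s' := d - 1) (by omega) (by omega)
      (by omega))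
    (H := box (m + 1) (c + p) (d - 1) (d - 1 + 1) ∪ box (c + 1) (c + p) (-b) (d - 1))
    (by simp [gridGraph_adj]) (fun z => by simp only [mem_box]; omega) (fun z => Iff.rfl)
  refine ⟨by omega, _, _, h1.congr ?_ (by simp) fun z => Iff.rfl, h2.congr rfl ?_ fun z => Iff.rfl,
    fun z => ?_, fun z => ?_⟩
  · rw [entry_eq_bot (by omega)]
  · rw [depart_eq_bot (by omega)]
  · simp only [mem_box, Set.mem_union]; omega
  · rw [hs]; simp only [mem_box, Set.mem_union]; omega

/-- This edge leads from beside the cut to the top row below it; its left end is a boundary point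
only because of its diagonal neighbour inside the cut. The zigzag of the two columns before the cut
is rearranged so that the path leaves them at height `d - 1`, directly towards the upper left corner
of what remains below the cut. -/
theorem breakable_corner_cut (hb : b % 2 = 0) (hb0 : 0 < b) (hp : p % 2 = 1) (hp3 : 3 ≤ p)
    (hd : d % 2 = 1) (hbd : 3 ≤ b + d) (hd0 : d < 0) :
    Breakable b c p d (c - 1, d - 1) (c, d - 1) := by
  refine breakable_of_break hb hb0 hp hp3 (m := c - 2) (by omega) (by omega) fun f g hf hg => ?_
  have h1 := (hamPath_BL_TL (a := c - 2) (a' := c) (s := -b) (s' := d - 1) (by omega) (by omega)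
    (by omega)).trans (hamPath_BL_BR (a := c - 2) (a' := c) (s := d - 1) (s' := 0) (by omega)
    (by omega) (by omega)) (H := box (c - 2) c (-b) 0)
    (by simp [gridGraph_adj]) (fun z => by simp only [mem_box]; omega)
    (fun z => by simp only [mem_box]; omega)
  have h2 := hamPath_TL_BR (a := c) (a' := c + p) (s := -b) (s' := d) (by omega) (by omega)
    (by omega)
  refine ⟨by omega, _, _, h1.congr ?_ rfl fun z => Iff.rfl, h2.congr rfl ?_ fun z => Iff.rfl,
    fun z => ?_, fun z => ?_⟩
  · rw [entry_eq_bot (by omega)]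
  · rw [depart_eq_bot (by omega)]
  · simp only [mem_box]; omega
  · have hf1 : c - 8 ≤ z.1 → z.1 < c → f z.1 = 0 := fun h h' =>
      hf.eq_zero (by omega) (by omega) (by omega)
    have hf2 : c ≤ z.1 → z.1 < c + p → f z.1 = d := fun h h' =>
      hf.eq_height (by omega) (by omega) (by omega) (by omega)
    have hg1 := hg z.1
    simp only [mem_box, mem_band]; omega

/-- This edge passes below the lower left corner of an added bump; its right end is a boundary point
only because of a diagonal neighbour. The notch is placed below the columns `c - 2`, `c - 1`, `c`,
so that the path must follow row `-1` into the bump. It fills the bump above row `-1` and then the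
band below it without the first column. -/
theorem breakable_corner_add (hb : b % 2 = 0) (hb0 : 0 < b) (hp : p % 2 = 1) (hp3 : 3 ≤ p)
    (hd : d % 2 = 1) (hd0 : 0 < d) :
    Breakable b c p d (c - 1, -1) (c, -1) := by
  refine ⟨-c, c - 2, by omega, by omega, by omega, by omega, fun f g hf hg => Or.inl ?_⟩
  have h0 : BandPath b f g (c - 8) (-c) (c - 2) (-c) := bandPath_flat hb hb0 _ (by omega)
      (fun x h h' => hf.eq_zero (by omega) (by omega) (by omega))
      (fun x h h' => hg.eq_zero (by omega) (by omega) (by omega))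
  have h4 : BandPath b f g (c + p) (-c) (c + p + 8) (-c) := bandPath_flat hb hb0 _ (by omega)
      (fun x h h' => hf.eq_zero (by omega) (by omega) (by omega))
      (fun x h h' => hg.eq_zero (by omega) (by omega) (by omega))
  refine (h0.trans_break ?_).trans h4
  have h1 := hamPath_row (a := c - 2) (a' := c) (-1) (by omega)
  have h2 := ((hamPath_row (a := c) (a' := c + 1) (-1) (by omega)).trans
    (hamPath_BL_BR_of_odd (a := c) (a' := c + p) (s := 0) (s' := d) (by omega) (by omega)
      (by omega))
    (H := box c (c + 1) (-1) (-1 + 1) ∪ box c (c + p) 0 d)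
    (by simp [gridGraph_adj]) (fun z => by simp only [mem_box]; omega) (fun z => Iff.rfl)).trans
    (hamPath_TR_BR (a := c + 1) (a' := c + p) (s := -b) (s' := 0) (by omega) (by omega) (by omega))
    (H := (box c (c + 1) (-1) (-1 + 1) ∪ box c (c + p) 0 d) ∪ box (c + 1) (c + p) (-b) 0)
    (by simp [gridGraph_adj]) (fun z => by simp only [mem_box, Set.mem_union]; omega)
    (fun z => Iff.rfl)
  refine ⟨by omega, _, _, h1.congr ?_ rfl fun z => Iff.rfl, h2.congr rfl ?_ fun z => Iff.rfl,
    fun z => ?_, fun z => ?_⟩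
  · rw [entry_eq_top (by omega)]
  · rw [depart_eq_bot (by omega)]
  · simp only [mem_box, Set.mem_union]; omega
  · have hf1 : c - 8 ≤ z.1 → z.1 < c → f z.1 = 0 := fun h h' =>
      hf.eq_zero (by omega) (by omega) (by omega)
    have hf2 : c ≤ z.1 → z.1 < c + p → f z.1 = d := fun h h' =>
      hf.eq_height (by omega) (by omega) (by omega) (by omega)
    have hg1 : c - 2 ≤ z.1 → z.1 < c + 1 → g z.1 = b - 1 := fun h h' =>
      hg.eq_height (by omega) (by omega) (by omega) (by omega)
    have hg2 : c + 1 ≤ z.1 → z.1 < c + p → g z.1 = 0 := fun h h' =>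
      hg.eq_zero (by omega) (by omega) (by omega)
    simp only [mem_box, mem_band, Set.mem_union]; omega

end

/-! ### The ring around a region and what it encloses -/

/-- The lengths of the four sides (top, right, bottom, left) of a rectangle. -/
def sideLen (W H : ℤ) : Fin 4 → ℤ := ![W, H, W, H]

/-- The region obtained from the rectangle `0 ≤ x < W`, `-H ≤ y < 0` by changing its top, right,
bottom and left sides according to the profiles `f 0, …, f 3`, as functions of the position on the
side (clockwise): the value is the height of what is added or minus the depth of what is cut. -/
def Region (W H : ℤ) (f : Fin 4 → ℤ → ℤ) : Set (ℤ × ℤ) :=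
  {z | z.2 < f 0 z.1 ∧ z.1 - W < f 1 (-1 - z.2) ∧ -H - 1 - z.2 < f 2 (W - 1 - z.1) ∧
    -1 - z.1 < f 3 (z.2 + H)}

theorem mem_region {W H : ℤ} {f : Fin 4 → ℤ → ℤ} {z : ℤ × ℤ} :
    z ∈ Region W H f ↔ z.2 < f 0 z.1 ∧ z.1 - W < f 1 (-1 - z.2) ∧
      -H - 1 - z.2 < f 2 (W - 1 - z.1) ∧ -1 - z.1 < f 3 (z.2 + H) := Iff.rfl

/-- The region enclosed by a ring of thickness `b` with inner profiles `g`. -/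
def innerRegion (b W H : ℤ) (g : Fin 4 → ℤ → ℤ) : Set (ℤ × ℤ) :=
  {z | z.2 + b < g 0 z.1 ∧ z.1 - W + b < g 1 (-1 - z.2) ∧ -H - 1 - z.2 + b < g 2 (W - 1 - z.1) ∧
    -1 - z.1 + b < g 3 (z.2 + H)}

theorem mem_innerRegion {b W H : ℤ} {g : Fin 4 → ℤ → ℤ} {z : ℤ × ℤ} :
    z ∈ innerRegion b W H g ↔ z.2 + b < g 0 z.1 ∧ z.1 - W + b < g 1 (-1 - z.2) ∧
      -H - 1 - z.2 + b < g 2 (W - 1 - z.1) ∧ -1 - z.1 + b < g 3 (z.2 + H) := Iff.rfl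

/-- The path through the corner block at the end of a side, to the next side. -/
theorem exists_hamPath_corner {b : ℤ} (hb : b % 2 = 0) (hb0 : 0 < b) (len θ : ℤ) :
    ∃ X, HamPath (box (len - b) len (-b) 0) (entry b θ (len - b)) X ∧
      gridGraph.Adj X (len + (entry b (θ + len + 1) b).2, -1 - b) := by
  -- A path entering the corner block on the outer side leaves it for the next side on the inner
  -- one, and conversely. This is the shift of the phase by `len + 1`.
  by_cases h : (len - b + θ) % 2 = 0
  · refine ⟨(len - b, -b), ?_, ?_⟩
    · rw [entry_eq_top h]
      exact (hamPath_BL_TL (a := len - b) (a' := len) (s := -b) (s' := 0) (by omega) (by omega)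
        (by omega)).symm
    · rw [entry_eq_bot (by omega)]
      simp only [gridGraph_adj]; omega
  · refine ⟨(len - 1, -b), ?_, ?_⟩
    · rw [entry_eq_bot (by omega)]
      exact hamPath_BL_BR (by omega) (by omega) (by omega)
    · rw [entry_eq_top (by omega)]
      simp only [gridGraph_adj]; omega

/-- The path along a side and through the corner block at its end, to the next side. -/
theorem exists_hamPath_side {b len θ θ' : ℤ} {f g : ℤ → ℤ} (hb : b % 2 = 0) (hb0 : 0 < b)
    (hlen : 2 * b < len) (h : BandPath b f g b θ (len - b) θ')
    (hz : ∀ x, x < b ∨ len - b ≤ x → f x = 0 ∧ g x = 0) :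
    ∃ X, HamPath (band b f g b len) (entry b θ b) X ∧
      gridGraph.Adj X (len + (entry b (θ' + len + 1) b).2, -1 - b) := by
  obtain ⟨X, hX, hX'⟩ := exists_hamPath_corner hb hb0 len θ'
  refine ⟨X, (h.hamPath (by omega)).trans hX (adj_depart_entry ..) (fun z => ?_) fun z => ?_, hX'⟩
  all_goals
    have := hz z.1
    simp only [mem_band, mem_box]; omega

section

variable {W H : ℤ}

/-- From the coordinates along the right side to those along the top. -/
def ofRight (W : ℤ) (z : ℤ × ℤ) : ℤ × ℤ := (W + z.2, -1 - z.1)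

/-- From the coordinates along the top to those along the right side. -/
def toRight (W : ℤ) (z : ℤ × ℤ) : ℤ × ℤ := (-1 - z.2, z.1 - W)

theorem HamPath.ofRight {F : Set (ℤ × ℤ)} {s t : ℤ × ℤ} (h : HamPath F s t) (W : ℤ) :
    HamPath {z | toRight W z ∈ F} (ofRight W s) (ofRight W t) :=
  h.map (_root_.ofRight W) (toRight W) (by intro z; simp [_root_.ofRight, toRight])
    (by intro z; simp [_root_.ofRight, toRight])
    (by intro z w; simp only [gridGraph_adj, _root_.ofRight]; omega) fun z => Iff.rfl

theorem ofRight_adj {z w : ℤ × ℤ} (h : gridGraph.Adj z w) :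
    gridGraph.Adj (ofRight W z) (ofRight W w) := by
  revert h; simp only [gridGraph_adj, ofRight]; omega

theorem ofRight_toRight (W : ℤ) (z : ℤ × ℤ) : ofRight W (toRight W z) = z := by
  simp [toRight, ofRight]

theorem toRight_mem_region {f : Fin 4 → ℤ → ℤ} (z : ℤ × ℤ) :
    toRight W z ∈ Region H W (fun i => f (i + 1)) ↔ z ∈ Region W H f := by
  simp only [mem_region, toRight, Fin.isValue, zero_add, Fin.reduceAdd]
  rw [show -1 - (z.1 - W) = W - 1 - z.1 by ring, show H - 1 - (-1 - z.2) = z.2 + H by ring,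
    show z.1 - W + W = z.1 by ring]
  constructor <;> rintro ⟨h1, h2, h3, h4⟩ <;> refine ⟨?_, ?_, ?_, ?_⟩ <;> omega

end

/-- The path around a ring, from a point `q` on its top side to a point `p` there. What the ring
encloses is supposed to be covered by the parts of the path on the top side. -/
theorem hamPath_region {b W H : ℤ} {f g : Fin 4 → ℤ → ℤ} {θ θ' : Fin 4 → ℤ} {p q : ℤ × ℤ}
    {F G : Set (ℤ × ℤ)} (hb : b % 2 = 0) (hb0 : 0 < b) (hW : 2 * b < W) (hH : 2 * b < H)
    (hz : ∀ i x, x < b ∨ sideLen W H i - b ≤ x → f i x = 0 ∧ g i x = 0)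
    (hg : ∀ i x, 0 ≤ g i x) (hgf : ∀ i x, g i x - b < f i x)
    (hside : ∀ i, i ≠ 0 → BandPath b (f i) (g i) b (θ i) (sideLen W H i - b) (θ' i))
    (hθ : ∀ i, (θ (i + 1) - (θ' i + sideLen W H i + 1)) % 2 = 0)
    (hF : HamPath F (entry b (θ 0) b) p) (hG : HamPath G q (depart b (θ' 0) (W - b)))
    (hd : ∀ z, z ∈ F → z ∉ G)
    (hu : ∀ z, z ∈ F ∨ z ∈ G ↔ z ∈ band b (f 0) (g 0) b (W - b) ∨ z ∈ innerRegion b W H g) :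
    HamPath (Region W H f) q p := by
  obtain ⟨X₀, h₀, a₀⟩ := exists_hamPath_corner hb hb0 W (θ' 0)
  obtain ⟨X₁, h₁, a₁⟩ := exists_hamPath_side hb hb0 hH (hside 1 (by decide)) (hz 1)
  obtain ⟨X₂, h₂, a₂⟩ := exists_hamPath_side hb hb0 hW (hside 2 (by decide)) (hz 2)
  obtain ⟨X₃, h₃, a₃⟩ := exists_hamPath_side hb hb0 hH (hside 3 (by decide)) (hz 3)
  -- The phases of consecutive sides match at the corners. The relation for the last side, `e0`,
  -- says that the phase has returned to its initial value, so that the ring closes up.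
  have e1 := entry_congr (b := b) (m := b) (hθ 0)
  have e2 := entry_congr (b := b) (m := b) (hθ 1)
  have e3 := entry_congr (b := b) (m := b) (hθ 2)
  have e0 := entry_congr (b := b) (m := b) (hθ 3)
  simp only [Fin.isValue, zero_add, Fin.reduceAdd, sideLen, Matrix.cons_val] at e0 e1 e2 e3
  rw [e1] at a₀
  rw [e2] at a₁
  rw [e3] at a₂
  rw [e0] at a₃
  have hz0 := hz 0
  have hz1 := hz 1
  have hz2 := hz 2
  have hz3 := hz 3
  simp only [Fin.isValue, sideLen, Matrix.cons_val] at hz0 hz1 hz2 hz3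
  have k₁ : HamPath {z | b ≤ -1 - z.2 ∧ -1 - z.2 < H ∧ -b + g 1 (-1 - z.2) ≤ z.1 - W ∧
      z.1 - W < f 1 (-1 - z.2)} (ofRight W (entry b (θ 1) b)) (ofRight W X₁) :=
    (h₁.ofRight W).congr rfl rfl fun z => by
      simp only [Set.mem_ofPred_eq, toRight, mem_band]
  have k₂ : HamPath {z | b ≤ W - 1 - z.1 ∧ W - 1 - z.1 < W ∧
      -b + g 2 (W - 1 - z.1) ≤ -H - 1 - z.2 ∧ -H - 1 - z.2 < f 2 (W - 1 - z.1)}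
      (ofRight W (ofRight H (entry b (θ 2) b))) (ofRight W (ofRight H X₂)) :=
    ((h₂.ofRight H).ofRight W).congr rfl rfl fun z => by
      simp only [Set.mem_ofPred_eq, toRight, mem_band]
      rw [show -1 - (z.1 - W) = W - 1 - z.1 by ring, show -1 - z.2 - H = -H - 1 - z.2 by ring]
  have k₃ : HamPath {z | b ≤ z.2 + H ∧ z.2 + H < H ∧
      -b + g 3 (z.2 + H) ≤ -1 - z.1 ∧ -1 - z.1 < f 3 (z.2 + H)}
      (ofRight W (ofRight H (ofRight W (entry b (θ 3) b)))) (ofRight W (ofRight H (ofRight W X₃))) :=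
    (((h₃.ofRight W).ofRight H).ofRight W).congr rfl rfl fun z => by
      simp only [Set.mem_ofPred_eq, toRight, mem_band]
      rw [show -1 - (-1 - z.2 - H) = z.2 + H by ring, show -1 - (z.1 - W) - W = -1 - z.1 by ring]
  have b₀ : gridGraph.Adj X₀ (ofRight W (entry b (θ 1) b)) := a₀
  have b₁ : gridGraph.Adj X₁ (ofRight H (entry b (θ 2) b)) := a₁
  have b₂ : gridGraph.Adj X₂ (ofRight W (entry b (θ 3) b)) := a₂
  have b₃ : gridGraph.Adj X₃ (ofRight H (entry b (θ 0) b)) := a₃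
  have b₃' : gridGraph.Adj (ofRight W (ofRight H (ofRight W X₃))) (entry b (θ 0) b) := by
    have := ofRight_adj (W := W) (ofRight_adj (W := H) (ofRight_adj (W := W) b₃))
    rwa [show ofRight W (ofRight H (ofRight W (ofRight H (entry b (θ 0) b)))) = entry b (θ 0) b by
      simp only [ofRight, entry]; ext <;> dsimp only <;> ring] at this
  have c₂ := k₂.trans k₃ (ofRight_adj (ofRight_adj b₂))
    (fun z => by simp only [Set.mem_ofPred_eq]; have := hg 2 (W - 1 - z.1); omega) (H := _ ∪ _)
    (fun z => Iff.rfl)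
  have c₁ := k₁.trans c₂ (ofRight_adj b₁)
    (fun z => by
      simp only [Set.mem_ofPred_eq, Set.mem_union]
      have := hg 1 (-1 - z.2)
      have := hg 2 (W - 1 - z.1)
      have := hg 3 (z.2 + H)
      omega) (H := _ ∪ _)
    (fun z => Iff.rfl)
  have c₀ := h₀.trans c₁ b₀
    (fun z => by
      simp only [Set.mem_ofPred_eq, Set.mem_union, mem_box]
      have := hg 1 (-1 - z.2)
      have := hg 2 (W - 1 - z.1)
      have := hg 3 (z.2 + H)
      omega) (H := _ ∪ _)
    (fun z => Iff.rfl)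
  have cF := c₀.trans hF b₃'
    (fun z hzC hzF => by
      have := (hu z).1 (Or.inl hzF)
      simp only [Set.mem_ofPred_eq, Set.mem_union, mem_box, mem_band, mem_innerRegion] at this hzC
      have := hg 0 z.1
      have := hg 1 (-1 - z.2)
      have := hg 2 (W - 1 - z.1)
      have := hg 3 (z.2 + H)
      have := hz0 z.1
      have := hz1 (-1 - z.2)
      have := hz3 (z.2 + H)
      have := hz2 (W - 1 - z.1)
      omega) (H := _ ∪ _)
    (fun z => Iff.rfl)
  refine hG.trans cF (adj_depart_entry ..) (fun z hzG => ?_) fun z => ?_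
  · have := (hu z).1 (Or.inr hzG)
    rintro (hzC | hzF)
    · simp only [Set.mem_ofPred_eq, Set.mem_union, mem_box, mem_band, mem_innerRegion] at this hzC
      have := hg 0 z.1
      have := hg 1 (-1 - z.2)
      have := hg 2 (W - 1 - z.1)
      have := hg 3 (z.2 + H)
      have := hz0 z.1
      have := hz1 (-1 - z.2)
      have := hz3 (z.2 + H)
      have := hz2 (W - 1 - z.1)
      omega
    · exact hd z hzF hzG
  · have hu := hu z
    rw [Set.mem_union, or_left_comm, or_comm (a := z ∈ G), hu]
    simp only [Set.mem_ofPred_eq, Set.mem_union, mem_box, mem_band, mem_innerRegion, mem_region]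
    have := hg 0 z.1
    have := hg 1 (-1 - z.2)
    have := hg 2 (W - 1 - z.1)
    have := hg 3 (z.2 + H)
    have := hgf 0 z.1
    have := hgf 1 (-1 - z.2)
    have := hgf 2 (W - 1 - z.1)
    have := hgf 3 (z.2 + H)
    have := hz0 z.1
    have := hz1 (-1 - z.2)
    have := hz3 (z.2 + H)
    have := hz2 (W - 1 - z.1)
    omega

/-- What a ring encloses is, after a translation, a region of the same kind with sides shorter by `2
* b`; this is what lets the construction be iterated. -/
theorem HamPath.innerRegion {b W H : ℤ} {g : Fin 4 → ℤ → ℤ} {s t : ℤ × ℤ}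
    (h : HamPath (Region (W - 2 * b) (H - 2 * b) fun i x => g i (x + b)) s t) :
    HamPath (innerRegion b W H g) (s.1 + b, s.2 - b) (t.1 + b, t.2 - b) := by
  refine h.translate b (-b) fun z => ?_
  simp only [mem_innerRegion, mem_region]
  rw [show z.1 - b + b = z.1 by ring, show -1 - (z.2 - -b) + b = -1 - z.2 by ring,
    show W - 2 * b - 1 - (z.1 - b) + b = W - 1 - z.1 by ring,
    show z.2 - -b + (H - 2 * b) + b = z.2 + H by ring]
  constructor <;> rintro ⟨h1, h2, h3, h4⟩ <;> refine ⟨?_, ?_, ?_, ?_⟩ <;> omega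

section

variable {b W H : ℤ} {f g : Fin 4 → ℤ → ℤ} {θ θ' : Fin 4 → ℤ}

/-- A path through the band above a top side, with a detour through the enclosed region. -/
theorem hamPath_detour {m m' m₂ θ₀ : ℤ} {p : ℤ × ℤ} {F : Set (ℤ × ℤ)}
    (h₁ : BandPath b (f 0) (g 0) m θ₀ m₂ θ₀) (hm₂ : m < m₂)
    (h₂ : HamPath F (entry b θ₀ m₂) p) (hF : ∀ z, z ∈ F → z ∈ band b (f 0) (g 0) m₂ m')
    (hθ₂ : (m₂ + θ₀) % 2 = 1)
    (hin : HamPath (Region (W - 2 * b) (H - 2 * b) fun i x => g i (x + b))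
      (m₂ - b, -1) (m₂ - b - 1, -1)) :
    HamPath (band b (f 0) (g 0) m m₂ ∪ innerRegion b W H g ∪ F) (entry b θ₀ m) p := by
  have h3 := (h₁.hamPath hm₂).trans hin.innerRegion.symm
    (by rw [depart_eq_bot hθ₂]; simp only [gridGraph_adj]; omega)
    (fun z => by
      simp only [mem_band, mem_innerRegion]
      omega)
    (H := _ ∪ _) (fun z => Iff.rfl)
  refine h3.trans h₂ (by rw [entry_eq_bot hθ₂]; simp only [gridGraph_adj]; omega)
    (fun z hz hzF => ?_) (fun z => Iff.rfl)
  have := hF z hzF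
  simp only [mem_band, mem_innerRegion, Set.mem_union] at this hz
  omega

/-- At `m₁` the zigzag crosses along the outer row, at `m₂` along the inner row. The first crossing
is the edge at which the cycle is opened, the second one is replaced by the detour through the
enclosed region. -/
theorem hamPath_region_of_cut {m₁ m₂ : ℤ} (hb : b % 2 = 0) (hb0 : 0 < b) (hH : 2 * b < H)
    (hz : ∀ i x, x < b ∨ sideLen W H i - b ≤ x → f i x = 0 ∧ g i x = 0)
    (hg : ∀ i x, 0 ≤ g i x) (hgf : ∀ i x, g i x - b < f i x)
    (hside : ∀ i, i ≠ 0 → BandPath b (f i) (g i) b (θ i) (sideLen W H i - b) (θ' i))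
    (hθ : ∀ i, (θ (i + 1) - (θ' i + sideLen W H i + 1)) % 2 = 0)
    (h₁ : BandPath b (f 0) (g 0) b (θ 0) m₁ (θ 0)) (h₂ : BandPath b (f 0) (g 0) m₁ (θ 0) m₂ (θ 0))
    (h₃ : BandPath b (f 0) (g 0) m₂ (θ 0) (W - b) (θ' 0))
    (hm₁ : b < m₁) (hm₂ : m₁ < m₂) (hm₃ : m₂ < W - b) (hθ₁ : (m₁ + θ 0) % 2 = 0)
    (hθ₂ : (m₂ + θ 0) % 2 = 1)
    (hin : HamPath (Region (W - 2 * b) (H - 2 * b) fun i x => g i (x + b))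
      (m₂ - b, -1) (m₂ - b - 1, -1)) :
    HamPath (Region W H f) (m₁, -1) (m₁ - 1, -1) := by
  have hG := hamPath_detour h₂ hm₂ (h₃.hamPath hm₃)
    (fun z h => h) hθ₂ hin
  have hF := h₁.hamPath hm₁
  rw [entry_eq_top hθ₁] at hG
  rw [depart_eq_top hθ₁] at hF
  refine hamPath_region hb hb0 (by omega) hH hz hg hgf hside hθ hF hG (fun z => ?_) fun z => ?_
  · simp only [mem_band, mem_innerRegion, Set.mem_union]
    have := (hz 0 z.1)
    simp only [sideLen, Matrix.cons_val] at this
    have := hg 0 z.1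
    omega
  · simp only [mem_band, Set.mem_union]
    by_cases h : z ∈ innerRegion b W H g
    · simp [h]
    · simp only [h, or_false]; omega

/-- The same merging of ring and enclosed region, with the cycle opened at an arbitrary edge further
along the top side. -/
theorem hamPath_region_of_break {m₂ : ℤ} {x y : ℤ × ℤ} (hb : b % 2 = 0) (hb0 : 0 < b)
    (hH : 2 * b < H)
    (hz : ∀ i x, x < b ∨ sideLen W H i - b ≤ x → f i x = 0 ∧ g i x = 0)
    (hg : ∀ i x, 0 ≤ g i x) (hgf : ∀ i x, g i x - b < f i x)
    (hside : ∀ i, i ≠ 0 → BandPath b (f i) (g i) b (θ i) (sideLen W H i - b) (θ' i))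
    (hθ : ∀ i, (θ (i + 1) - (θ' i + sideLen W H i + 1)) % 2 = 0)
    (h₁ : BandPath b (f 0) (g 0) b (θ 0) m₂ (θ 0))
    (h₂ : BandBreak b (f 0) (g 0) m₂ (θ 0) (W - b) (θ' 0) x y)
    (hm₂ : b < m₂) (hθ₂ : (m₂ + θ 0) % 2 = 1)
    (hin : HamPath (Region (W - 2 * b) (H - 2 * b) fun i x => g i (x + b))
      (m₂ - b, -1) (m₂ - b - 1, -1)) :
    HamPath (Region W H f) y x := by
  obtain ⟨hm₃, F, G, hF, hG, hd, hu⟩ := h₂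
  have hF' := hamPath_detour h₁ hm₂ hF
    (fun z h => (hu z).2 (Or.inl h)) hθ₂ hin
  refine hamPath_region hb hb0 (by omega) hH hz hg hgf hside hθ hF' hG (fun z h h' => ?_)
    fun z => ?_
  · obtain h | h := h
    · have := (hu z).2 (Or.inr h')
      simp only [mem_band, mem_innerRegion, Set.mem_union] at h this
      omega
    · exact hd z h h'
  · rw [Set.mem_union, or_assoc, ← hu, Set.mem_union]
    simp only [mem_band]
    by_cases h : z ∈ innerRegion b W H g
    · simp [h]
    · simp only [h, or_false]; omega

end

/-! ### Teeth: which are absorbed and which are passed on -/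

/-- The profile with a tooth of width `3` and height `b - 1` at each of the columns in `T`. -/
def teeth (b : ℤ) (T : List ℤ) (x : ℤ) : ℤ := if ∃ c ∈ T, c ≤ x ∧ x < c + 3 then b - 1 else 0

section teeth

variable {b : ℤ} {T : List ℤ} {x c : ℤ}

theorem teeth_cons : teeth b (c :: T) x = if c ≤ x ∧ x < c + 3 then b - 1 else teeth b T x := by
  by_cases h : c ≤ x ∧ x < c + 3 <;> simp [teeth, h]

theorem teeth_eq_zero (h : ∀ c ∈ T, x < c ∨ c + 3 ≤ x) : teeth b T x = 0 := by
  rw [teeth, if_neg]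
  rintro ⟨c, hc, h1, h2⟩
  have := h c hc
  omega

theorem teeth_nonneg (hb : 0 < b) (T : List ℤ) (x : ℤ) : 0 ≤ teeth b T x := by
  rw [teeth]; split_ifs <;> omega

theorem teeth_lt (hb : 0 < b) (T : List ℤ) (x : ℤ) : teeth b T x < b := by
  rw [teeth]; split_ifs <;> omega

theorem teeth_map_sub (b k : ℤ) (T : List ℤ) (x : ℤ) :
    teeth b (T.map (· - k)) x = teeth b T (x + k) := by
  induction T with
  | nil => simp [teeth]
  | cons c T ih =>
    rw [List.map_cons, teeth_cons, teeth_cons, ih]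
    congr 1
    rw [eq_iff_iff]
    omega

end teeth

/-- The list `l` of teeth can be processed by a path starting with phase `θ` and ending with phase
`θ'`: the marked teeth are absorbed, changing the phase, and the other ones are passed on when
the phase is `θ₀`. -/
def Processes (θ₀ : ℤ) : ℤ → List (ℤ × Bool) → ℤ → Prop
  | θ, [], θ' => (θ' - θ) % 2 = 0
  | θ, (_, false) :: l, θ' => (θ - θ₀) % 2 = 0 ∧ Processes θ₀ θ l θ'
  | θ, (c, true) :: l, θ' => (c + θ) % 2 = 1 ∧ Processes θ₀ (θ + 1) l θ'

/-- The teeth that are not absorbed. -/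
def unmarked (l : List (ℤ × Bool)) : List ℤ := (l.filter fun e => !e.2).map Prod.fst

/-- The place on the inner side of the band to which a tooth is passed on. -/
def passTo (θ c : ℤ) : ℤ := if (c + θ) % 2 = 0 then c - 4 else c + 4

theorem unmarked_cons_false (c : ℤ) (l : List (ℤ × Bool)) :
    unmarked ((c, false) :: l) = c :: unmarked l := by simp [unmarked]

theorem unmarked_cons_true (c : ℤ) (l : List (ℤ × Bool)) :
    unmarked ((c, true) :: l) = unmarked l := by simp [unmarked]

theorem mem_of_mem_unmarked {l : List (ℤ × Bool)} {c : ℤ} (h : c ∈ unmarked l) :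
    c ∈ l.map Prod.fst := by
  simp only [unmarked, List.mem_map, List.mem_filter] at h ⊢
  obtain ⟨e, ⟨he, -⟩, rfl⟩ := h
  exact ⟨e, he, rfl⟩

theorem unmarked_sublist (l : List (ℤ × Bool)) :
    (unmarked l).Sublist (l.map Prod.fst) := (List.filter_sublist).map _

theorem unmarked_append (l l' : List (ℤ × Bool)) :
    unmarked (l ++ l') = unmarked l ++ unmarked l' := by simp [unmarked]

theorem passTo_bounds (θ c : ℤ) : c - 4 ≤ passTo θ c ∧ passTo θ c ≤ c + 4 := by
  rw [passTo]; split_ifs <;> omega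

/-- `Processes` is the phase bookkeeping of an actual path: a marked tooth must be entered at the
bottom and changes the phase, an unmarked one is followed or preceded by its notch. The teeth are
far enough apart for a tooth and its notch to be treated separately from the others. -/
theorem bandPath_teeth {b : ℤ} (hb : b % 2 = 0) (hb4 : 4 ≤ b) {f g : ℤ → ℤ} {θ₀ hi : ℤ}
    (l : List (ℤ × Bool)) : ∀ {lo θ θ' : ℤ}, Processes θ₀ θ l θ' → lo ≤ hi →
    (∀ c ∈ l.map Prod.fst, lo + 8 ≤ c ∧ c + 11 ≤ hi) →
    (l.map Prod.fst).Pairwise (fun c c' => c + 19 ≤ c') →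
    (∀ x, lo ≤ x → x < hi → f x = teeth b (l.map Prod.fst) x) →
    (∀ x, lo ≤ x → x < hi → g x = teeth b ((unmarked l).map (passTo θ₀)) x) →
    BandPath b f g lo θ hi θ' := by
  induction l with
  | nil =>
    intro lo θ θ' hP hlo _ _ hf hg
    refine (bandPath_flat hb (by omega) θ hlo (fun x h h' => ?_)
      (fun x h h' => ?_)).congr_phase (by simp) hP
    · rw [hf x h h']; exact teeth_eq_zero (by simp)
    · rw [hg x h h']; exact teeth_eq_zero (by simp [unmarked])
  | cons e l ih =>
    obtain ⟨c, fl⟩ := e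
    intro lo θ θ' hP hlo hpos hgap hf hg
    simp only [List.map_cons, List.forall_mem_cons, List.pairwise_cons] at hpos hgap hf
    have hfb : IsBumpOn f c 3 (b - 1) lo (c + 3 + 8) := by
      intro x h h'
      rw [hf x h (by omega), teeth_cons, teeth_eq_zero]
      intro c' hc'
      have := hgap.1 c' hc'
      omega
    have hf' : ∀ x, c + 3 + 8 ≤ x → x < hi → f x = teeth b (l.map Prod.fst) x := by
      intro x h h'
      rw [hf x (by omega) h', teeth_cons, if_neg (by omega)]
    have hpos' : ∀ c' ∈ l.map Prod.fst, c + 3 + 8 + 8 ≤ c' ∧ c' + 11 ≤ hi := by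
      intro c' hc'
      have := hgap.1 c' hc'
      have := hpos.2 c' hc'
      omega
    have hfar : ∀ x, x < c + 3 + 8 → teeth b ((unmarked l).map (passTo θ₀)) x = 0 := by
      intro x hx
      refine teeth_eq_zero fun c' hc' => ?_
      obtain ⟨c'', hc'', rfl⟩ := List.mem_map.1 hc'
      have := hgap.1 c'' (mem_of_mem_unmarked hc'')
      have := passTo_bounds θ₀ c''
      omega
    have hc8 : c + 3 + 8 ≤ hi := by omega
    cases fl with
    | true =>
      obtain ⟨hc, hP⟩ := hP
      rw [unmarked_cons_true] at hg
      exact (bandPath_absorb hb (by omega) (by norm_num) le_rfl (by omega) (by omega) hc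
        (by omega) (by omega) hfb
        (fun x h h' => by rw [hg x h (by omega), hfar x h'])).trans
        (ih hP hc8 hpos' hgap.2 hf' fun x h h' => hg x (by omega) h')
    | false =>
      obtain ⟨hc, hP⟩ := hP
      rw [unmarked_cons_false, List.map_cons] at hg
      have hgb : IsBumpOn g (passTo θ₀ c) 3 (b - 1) lo (c + 3 + 8) := by
        intro x h h'
        rw [hg x h (by omega), teeth_cons, hfar x h']
      have hg' : ∀ x, c + 3 + 8 ≤ x → x < hi →
          g x = teeth b ((unmarked l).map (passTo θ₀)) x := by
        intro x h h'
        have := passTo_bounds θ₀ c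
        rw [hg x (by omega) h', teeth_cons, if_neg (by omega)]
      have hflat : BandPath b f g lo θ (c - 8) θ := bandPath_flat hb (by omega) θ (by omega)
        (fun x h h' => hfb.eq_zero (by omega) (by omega) (by omega))
        (fun x h h' => by
          have := passTo_bounds θ₀ c
          exact hgb.eq_zero (by omega) (by omega) (by omega))
      refine (hflat.trans ?_).trans (ih hP hc8 hpos' hgap.2 hf' hg')
      by_cases h : (c + θ₀) % 2 = 0
      · rw [passTo, if_pos h] at hgb
        exact bandPath_pass_left hb (by omega) (by norm_num) le_rfl (by omega) (by omega)
          (by omega) (hfb.mono (by omega) le_rfl) (hgb.mono (by omega) le_rfl)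
      · rw [passTo, if_neg h, show c + 4 = c + 3 + 1 by ring] at hgb
        exact bandPath_pass_right hb (by omega) (by norm_num) le_rfl (by omega) (by omega)
          (by omega) (hfb.mono (by omega) le_rfl) (hgb.mono (by omega) le_rfl)

namespace Processes

variable {θ₀ θ θ' α : ℤ} {l l' : List (ℤ × Bool)}

theorem congr_phase {θ₁ θ₁' : ℤ} (h : Processes θ₀ θ l θ') (h₁ : (θ₁ - θ) % 2 = 0)
    (h₁' : (θ₁' - θ') % 2 = 0) : Processes θ₀ θ₁ l θ₁' := by
  induction l generalizing θ θ₁ with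
  | nil => simp only [Processes] at h ⊢; omega
  | cons e l ih =>
    obtain ⟨c, _ | _⟩ := e
    · exact ⟨by have := h.1; omega, ih h.2 h₁⟩
    · exact ⟨by have := h.1; omega, ih h.2 (by omega)⟩

theorem of_append (h : Processes θ₀ θ (l ++ l') θ') :
    ∃ θ₁, Processes θ₀ θ l θ₁ ∧ Processes θ₀ θ₁ l' θ' := by
  induction l generalizing θ with
  | nil => exact ⟨θ, by simp [Processes], h⟩
  | cons e l ih =>
    obtain ⟨c, _ | _⟩ := e
    · obtain ⟨θ₁, h1, h2⟩ := ih h.2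
      exact ⟨θ₁, ⟨h.1, h1⟩, h2⟩
    · obtain ⟨θ₁, h1, h2⟩ := ih h.2
      exact ⟨θ₁, ⟨h.1, h1⟩, h2⟩

/-- Only the parities of position plus phase and of the difference of two phases matter, so
positions and phases may be shifted in opposite directions. This transfers a processing of the
normalised types to the individual sides. -/
theorem shift (h : Processes θ₀ θ l θ') (α : ℤ) :
    Processes (θ₀ + α) (θ + α) (l.map fun e => (e.1 - α, e.2)) (θ' + α) := by
  induction l generalizing θ with
  | nil => simp only [Processes, List.map_nil] at h ⊢; omega
  | cons e l ih =>
    obtain ⟨c, _ | _⟩ := e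
    · exact ⟨by have := h.1; omega, ih h.2⟩
    · exact ⟨by have := h.1; omega, (ih h.2).congr_phase (by omega) (by omega)⟩

theorem of_unmarked (L : List ℤ) (h : (θ - θ₀) % 2 = 0) :
    Processes θ₀ θ (L.map fun c => (c, false)) θ := by
  induction L with
  | nil => simp [Processes]
  | cons c L ih => exact ⟨h, ih⟩

end Processes

theorem unmarked_map_false (L : List ℤ) : unmarked (L.map fun c => (c, false)) = L := by
  induction L with
  | nil => rfl
  | cons c L ih => rw [List.map_cons, unmarked_cons_false, ih]

theorem map_fst_map_false (L : List ℤ) :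
    (L.map fun c => (c, false)).map Prod.fst = L := by simp [Function.comp_def]

/-- The sign `(-1) ^ t`. -/
def parSign (t : ℤ) : ℤ := if t % 2 = 0 then 1 else -1

theorem parSign_eq_of_emod {s t : ℤ} (h : s % 2 = t % 2) : parSign s = parSign t := by
  simp [parSign, h]

/-- An adjacent pair of teeth of opposite types can be absorbed, all others being passed on. -/
theorem exists_processes_absorbing {θ : ℤ} (L : List ℤ) : ∀ t : ℤ, (t + θ) % 2 = 1 →
    (∃ t' ∈ L, (t' + θ) % 2 = 0) →
    ∃ l θ', l.map Prod.fst = t :: L ∧ Processes θ θ l θ' ∧ (θ' - θ) % 2 = 0 ∧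
      (unmarked l).length + 1 = L.length ∧
      ((unmarked l).map parSign).sum = ((t :: L).map parSign).sum := by
  induction L with
  | nil => simp
  | cons u L ih =>
    intro t ht hex
    by_cases hu : (u + θ) % 2 = 0
    · refine ⟨(t, true) :: (u, true) :: L.map fun c => (c, false), θ + 1 + 1, ?_, ?_, by omega,
        ?_, ?_⟩
      · simp only [List.map_cons, map_fst_map_false]
      · exact ⟨ht, by omega, Processes.of_unmarked L (by omega)⟩
      · simp [unmarked_cons_true, unmarked_map_false]
      · simp only [unmarked_cons_true, unmarked_map_false, List.map_cons, List.sum_cons]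
        have : parSign t + parSign u = 0 := by
          simp only [parSign]; split_ifs <;> omega
        omega
    -- If `u` has the same type as `t`, then `t` is passed on and the search for an adjacent
    -- opposite pair continues from `u`.
    · obtain ⟨l, θ', h1, h2, h3, h4, h5⟩ := ih u (by omega) (by
        obtain ⟨t', h, h'⟩ := hex
        rcases List.mem_cons.1 h with rfl | h
        · exact absurd h' hu
        · exact ⟨t', h, h'⟩)
      refine ⟨(t, false) :: l, θ', by simp [h1], ⟨by simp, h2⟩, h3, ?_, ?_⟩
      · simp [unmarked_cons_false, h4]
      · simp [unmarked_cons_false, h5]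

/-! ### The innermost rectangle -/

section base

variable {b W H m : ℤ}

theorem mem_region_teeth_nil (z : ℤ × ℤ) :
    z ∈ Region W H (fun _ => teeth b []) ↔ z ∈ box 0 W (-H) 0 := by
  simp only [mem_region, mem_box, teeth, List.not_mem_nil, false_and, exists_false, if_false]
  omega

/-- A rectangle of even area has a Hamiltonian cycle through any given edge of its top side. -/
theorem hamPath_rectangle (hWH : W % 2 = 0 ∨ H % 2 = 0) (hm : 0 < m) (hm' : m < W) (hH : 1 < H) :
    HamPath (box 0 W (-H) 0) (m, -1) (m - 1, -1) := by
  by_cases h : H % 2 = 0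
  · exact (hamPath_BL_TL (a := m) (a' := W) (s := -H) (s' := 0) (by omega) (by omega)
      (by omega)).symm.trans (hamPath_TR_BR (a := 0) (a' := m) (s := -H) (s' := 0) (by omega)
      (by omega) (by omega)).symm (by simp [gridGraph_adj])
      (fun z => by simp only [mem_box]; omega) (fun z => by simp only [mem_box]; omega)
  · exact ((hamPath_row (a := m) (a' := W) (-1) (by omega)).trans
      (hamPath_TL_TR (a := 0) (a' := W) (s := -H) (s' := -1) (by omega) (by omega)
        (by omega)).symm (H := _ ∪ _) (by simp [gridGraph_adj])
      (fun z => by simp only [mem_box]; omega) (fun z => Iff.rfl)).trans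
      (hamPath_row (a := 0) (a' := m) (-1) (by omega)) (by simp [gridGraph_adj])
      (fun z => by simp only [mem_box, Set.mem_union]; omega)
      (fun z => by simp only [mem_box, Set.mem_union]; omega)

/-- A rectangle with sides of odd lengths and a tooth of the right parity on its top side has a
Hamiltonian cycle through any given edge of the top side to the left of the tooth. -/
theorem hamPath_rectangle_tooth {z₀ : ℤ} (hb : b % 2 = 0) (hb0 : 0 < b) (hW : W % 2 = 1)
    (hH : H % 2 = 1) (hH3 : 1 < H) (hm : 0 < m) (hz : m < z₀) (hzW : z₀ + 3 < W)
    (hz₀ : z₀ % 2 = 0) :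
    HamPath (box 0 W (-H) 0 ∪ box z₀ (z₀ + 3) 0 (b - 1)) (m, -1) (m - 1, -1) := by
  have h1 := hamPath_row (a := m) (a' := z₀) (-1) (by omega)
  have h2 := hamPath_col (s := -1) (s' := b - 1) z₀ (by omega)
  have h3 := (hamPath_BL_TL (a := z₀ + 1) (a' := z₀ + 3) (s := -H + 2) (s' := b - 1) (by omega)
    (by omega) (by omega)).symm
  have h4 := hamPath_row (a := z₀ + 1) (a' := z₀ + 3) (-H + 1) (by omega)
  have h5 := hamPath_BL_BR (a := z₀ + 3) (a' := W) (s := -H + 1) (s' := 0) (by omega)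
    (by omega) (by omega)
  have h6 := (hamPath_row (a := z₀) (a' := W) (-H) (by omega)).symm
  have h7 := hamPath_col (s := -H + 1) (s' := -1) z₀ (by omega)
  have h8 := (hamPath_TL_TR (a := 0) (a' := z₀) (s := -H) (s' := -1) (by omega) (by omega)
    (by omega)).symm
  have h9 := hamPath_row (a := 0) (a' := m) (-1) (by omega)
  have k3 := h3.trans h4 (H := box (z₀ + 1) (z₀ + 3) (-H + 1) (b - 1))
    (by rw [gridGraph_adj]; dsimp only; omega)
    (fun z => by simp only [mem_box]; omega) (fun z => by simp only [mem_box]; omega)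
  have k5 := h5.trans h6 (H := _ ∪ _) (by rw [gridGraph_adj]; dsimp only; omega)
    (fun z => by simp only [mem_box]; omega) (fun z => Iff.rfl)
  have l3 := k3.trans k5 (H := box (z₀ + 1) W (-H) 0 ∪ (box (z₀ + 1) (z₀ + 3) 0 (b - 1) ∪
    box z₀ (z₀ + 1) (-H) (-H + 1))) (by rw [gridGraph_adj]; dsimp only; omega)
    (fun z => by simp only [mem_box, Set.mem_union]; omega)
    (fun z => by simp only [mem_box, Set.mem_union]; omega)
  have l7 := l3.trans h7 (H := box (z₀ + 1) W (-H) 0 ∪ (box (z₀ + 1) (z₀ + 3) 0 (b - 1) ∪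
    box z₀ (z₀ + 1) (-H) (-1))) (by rw [gridGraph_adj]; dsimp only; omega)
    (fun z => by simp only [mem_box, Set.mem_union]; omega)
    (fun z => by simp only [mem_box, Set.mem_union]; omega)
  have l2 := h2.trans l7 (H := box z₀ W (-H) 0 ∪ box z₀ (z₀ + 3) 0 (b - 1))
    (by rw [gridGraph_adj]; dsimp only; omega)
    (fun z => by simp only [mem_box, Set.mem_union]; omega)
    (fun z => by simp only [mem_box, Set.mem_union]; omega)
  have l8 := h8.trans h9 (H := _ ∪ _) (by rw [gridGraph_adj]; dsimp only; omega)
    (fun z => by simp only [mem_box]; omega) (fun z => Iff.rfl)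
  have l1 := h1.trans l2 (H := box m z₀ (-1) (-1 + 1) ∪ (box z₀ W (-H) 0 ∪
    box z₀ (z₀ + 3) 0 (b - 1))) (by rw [gridGraph_adj]; dsimp only; omega)
    (fun z => by simp only [mem_box, Set.mem_union]; omega) (fun z => Iff.rfl)
  exact l1.trans l8 (by rw [gridGraph_adj]; dsimp only; omega)
    (fun z => by simp only [mem_box, Set.mem_union]; omega)
    (fun z => by simp only [mem_box, Set.mem_union]; omega)

end base

/-! ### The induction over concentric rings -/

/-- The parity shifts which make the parities of positions on different sides comparable. -/
def sideShift (W H : ℤ) : Fin 4 → ℤ := ![0, W + 1, W + H + 2, 2 * W + H + 3]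

/-- The positions of all teeth, shifted so that their parities are comparable. -/
def allTypes (W H : ℤ) (T : Fin 4 → List ℤ) : List ℤ :=
  (T 0).map (· + sideShift W H 0) ++ ((T 1).map (· + sideShift W H 1) ++
    ((T 2).map (· + sideShift W H 2) ++ (T 3).map (· + sideShift W H 3)))

section

variable {b W H : ℤ}

/-- The ring theorem for regions given by teeth. -/
theorem hamPath_region_teeth {T G : Fin 4 → List ℤ} {θs θs' : Fin 4 → ℤ} {θ m₁ m₂ : ℤ}
    (hb : b % 2 = 0) (hb0 : 0 < b) (hH : 2 * b < H)
    (hT : ∀ i, ∀ c ∈ T i, b ≤ c ∧ c + 3 ≤ sideLen W H i - b)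
    (hG : ∀ i, ∀ c ∈ G i, b ≤ c ∧ c + 3 ≤ sideLen W H i - b)
    (hT0 : ∀ c ∈ T 0, m₂ ≤ c) (hG0 : ∀ c ∈ G 0, m₂ ≤ c)
    (hside : ∀ i, i ≠ 0 → BandPath b (teeth b (T i)) (teeth b (G i)) b (θs i)
      (sideLen W H i - b) (θs' i))
    (r1 : (θs 1 - (θs' 0 + W + 1)) % 2 = 0) (r2 : (θs 2 - (θs' 1 + H + 1)) % 2 = 0)
    (r3 : (θs 3 - (θs' 2 + W + 1)) % 2 = 0) (r0 : (θ - (θs' 3 + H + 1)) % 2 = 0)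
    (htop : BandPath b (teeth b (T 0)) (teeth b (G 0)) m₂ θ (W - b) (θs' 0))
    (hm₁ : b < m₁) (hm₂ : m₁ < m₂) (hm₃ : m₂ < W - b) (hθ₁ : (m₁ + θ) % 2 = 0)
    (hθ₂ : (m₂ + θ) % 2 = 1)
    (hin : HamPath (Region (W - 2 * b) (H - 2 * b) fun i => teeth b ((G i).map (· - b)))
      (m₂ - b, -1) (m₂ - b - 1, -1)) :
    HamPath (Region W H fun i => teeth b (T i)) (m₁, -1) (m₁ - 1, -1) := by
  refine hamPath_region_of_cut (g := fun i => teeth b (G i)) (m₂ := m₂)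
    (θ := fun i => if i = 0 then θ else θs i) (θ' := θs') hb hb0 hH
    (fun i x hx => ⟨teeth_eq_zero fun c hc => ?_, teeth_eq_zero fun c hc => ?_⟩)
    (fun i x => teeth_nonneg hb0 ..) (fun i x => ?_) (fun i hi => ?_) (fun i => ?_)
    (bandPath_flat hb hb0 _ (by omega) (fun x _ _ => teeth_eq_zero fun c hc => ?_)
      (fun x _ _ => teeth_eq_zero fun c hc => ?_))
    (bandPath_flat hb hb0 _ (by omega) (fun x _ _ => teeth_eq_zero fun c hc => ?_)
      (fun x _ _ => teeth_eq_zero fun c hc => ?_)) htop hm₁ hm₂ hm₃ hθ₁ hθ₂ ?_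
  · have := hT i c hc; omega
  · have := hG i c hc; omega
  · have := teeth_lt hb0 (G i) x
    have := teeth_nonneg hb0 (T i) x
    omega
  · simpa only [hi, if_false] using hside i hi
  · fin_cases i
    exacts [r1, r2, r3, r0]
  · have := hT0 c hc; omega
  · have := hG0 c hc; omega
  · have := hT0 c hc; omega
  · have := hG0 c hc; omega
  · have : (fun i => teeth b ((G i).map (· - b))) = fun i x => teeth b (G i) (x + b) := by
      funext i x
      exact teeth_map_sub ..
    rwa [this] at hin

/-- Distribution of the processing of all teeth over the four sides. -/
theorem exists_processes_sides {T : Fin 4 → List ℤ} {θ₀ θ θ' : ℤ} {l : List (ℤ × Bool)}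
    (hl : l.map Prod.fst = allTypes W H T) (hP : Processes θ₀ θ l θ') :
    ∃ (ls : Fin 4 → List (ℤ × Bool)) (θs θs' : Fin 4 → ℤ), (∀ i, (ls i).map Prod.fst = T i) ∧
      (∀ i, Processes (θ₀ + sideShift W H i) (θs i) (ls i) (θs' i)) ∧ θs 0 = θ ∧
      (θs 1 - (θs' 0 + W + 1)) % 2 = 0 ∧ (θs 2 - (θs' 1 + H + 1)) % 2 = 0 ∧
      (θs 3 - (θs' 2 + W + 1)) % 2 = 0 ∧ (θ' - (θs' 3 + H + 1)) % 2 = 0 ∧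
      allTypes W H (fun i => unmarked (ls i)) = unmarked l := by
  obtain ⟨l₀, l', rfl, h₀, hl'⟩ := List.map_eq_append_iff.1 hl
  obtain ⟨l₁, l'', rfl, h₁, hl''⟩ := List.map_eq_append_iff.1 hl'
  obtain ⟨l₂, l₃, rfl, h₂, h₃⟩ := List.map_eq_append_iff.1 hl''
  obtain ⟨θ₁, p₀, hP⟩ := hP.of_append
  obtain ⟨θ₂, p₁, hP⟩ := hP.of_append
  obtain ⟨θ₃, p₂, p₃⟩ := hP.of_append
  have hmap : ∀ {l : List (ℤ × Bool)} {T : List ℤ} {k : ℤ}, l.map Prod.fst = T.map (· + k) →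
      (l.map fun e => (e.1 - k, e.2)).map Prod.fst = T := by
    intro l T k h
    have := congrArg (List.map (· - k)) h
    simpa [Function.comp_def] using this
  have hun : ∀ (l : List (ℤ × Bool)) (k : ℤ),
      (unmarked (l.map fun e => (e.1 - k, e.2))).map (· + k) = unmarked l := by
    intro l k
    simp [unmarked, List.filter_map, Function.comp_def]
  refine ⟨![l₀.map fun e => (e.1 - sideShift W H 0, e.2),
    l₁.map fun e => (e.1 - sideShift W H 1, e.2), l₂.map fun e => (e.1 - sideShift W H 2, e.2),
    l₃.map fun e => (e.1 - sideShift W H 3, e.2)],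
    ![θ + sideShift W H 0, θ₁ + sideShift W H 1, θ₂ + sideShift W H 2, θ₃ + sideShift W H 3],
    ![θ₁ + sideShift W H 0, θ₂ + sideShift W H 1, θ₃ + sideShift W H 2, θ' + sideShift W H 3],
    fun i => ?_, fun i => ?_, ?_, ?_, ?_, ?_, ?_, ?_⟩
  · fin_cases i
    exacts [hmap h₀, hmap h₁, hmap h₂, hmap h₃]
  · fin_cases i
    exacts [p₀.shift _, p₁.shift _, p₂.shift _, p₃.shift _]
  · simp [sideShift]
  · simp [sideShift]; omega
  · simp [sideShift]; omega
  · simp [sideShift]; omega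
  · simp [sideShift]; omega
  · simp only [allTypes, unmarked_append]
    simp only [Matrix.cons_val, hun]

/-- The position of a tooth, corrected so that it is invariant under passing on. -/
def home (θ c : ℤ) : ℤ := if (c + θ) % 2 = 0 then c - 2 else c + 2

theorem home_bounds (θ c : ℤ) : c - 2 ≤ home θ c ∧ home θ c ≤ c + 2 := by
  rw [home]; split_ifs <;> omega

/-- Consecutive rings have opposite phases, so a tooth moved by `-4` in one ring is moved by `+4` in
the next: it oscillates about its home instead of drifting. The separation of the teeth thus
survives any number of rings. -/
theorem home_passTo (hb : b % 2 = 0) {θ θ' : ℤ} (h : (θ' - θ) % 2 = 1) (c : ℤ) :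
    home θ' (passTo θ c - b) = home θ c - b := by
  simp only [home, passTo]; split_ifs <;> omega

/-- The teeth given by `T` are far from the corners and from each other. -/
structure Spread (W H M θ : ℤ) (T : Fin 4 → List ℤ) : Prop where
  len : ∀ i, 2 * M ≤ sideLen W H i
  pos : ∀ i, ∀ c ∈ T i, M ≤ c ∧ c + M ≤ sideLen W H i
  gap : ∀ i, (T i).Pairwise fun c c' =>
    home (θ + sideShift W H i) c + 32 ≤ home (θ + sideShift W H i) c'

/-- One ring: the teeth that are not absorbed are passed on to the rectangle inside. -/
theorem exists_step {M θ θ' m₁ : ℤ} {T : Fin 4 → List ℤ} {l : List (ℤ × Bool)}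
    (hb : b % 2 = 0) (hb4 : 4 ≤ b) (hs : Spread W H M θ T) (hM : 4 * (b + 8) ≤ M)
    (hl : l.map Prod.fst = allTypes W H T) (hP : Processes θ θ l θ') (hθ' : (θ' - θ) % 2 = 0)
    (hm₁ : b + 2 ≤ m₁) (hm₁' : m₁ ≤ b + 3) (hθ₁ : (m₁ + θ) % 2 = 0) :
    ∃ T', Spread (W - 2 * b) (H - 2 * b) (M - (b + 8)) (θ + 1) T' ∧
      (allTypes (W - 2 * b) (H - 2 * b) T').map (· % 2) = (unmarked l).map (· % 2) ∧
      (HamPath (Region (W - 2 * b) (H - 2 * b) fun i => teeth b (T' i))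
        (2 * b + 5 - m₁, -1) (2 * b + 5 - m₁ - 1, -1) →
      HamPath (Region W H fun i => teeth b (T i)) (m₁, -1) (m₁ - 1, -1)) := by
  obtain ⟨ls, θs, θs', hls, hPs, h0, r1, r2, r3, r0, hall⟩ := exists_processes_sides hl hP
  have hlen := hs.len
  have hW := hlen 0
  have hH := hlen 1
  simp only [sideLen, Fin.isValue, Matrix.cons_val] at hW hH
  have hpos : ∀ i, ∀ c ∈ (ls i).map Prod.fst, M ≤ c ∧ c + M ≤ sideLen W H i := by
    intro i; rw [hls i]; exact hs.pos i
  have hpos' : ∀ i, ∀ c ∈ unmarked (ls i), M ≤ c ∧ c + M ≤ sideLen W H i :=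
    fun i c hc => hpos i c (mem_of_mem_unmarked hc)
  have hGpos : ∀ i, ∀ c ∈ (unmarked (ls i)).map (passTo (θ + sideShift W H i)),
      M - 4 ≤ c ∧ c - 4 + M ≤ sideLen W H i := by
    intro i c hc
    obtain ⟨c', hc', rfl⟩ := List.mem_map.1 hc
    have := hpos' i c' hc'
    have := passTo_bounds (θ + sideShift W H i) c'
    omega
  have hband : ∀ i lo, lo ≤ 3 * b → BandPath b (teeth b (T i))
      (teeth b ((unmarked (ls i)).map (passTo (θ + sideShift W H i)))) lo (θs i)
      (sideLen W H i - b) (θs' i) := by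
    intro i lo hlo
    have := hlen i
    refine bandPath_teeth hb hb4 (ls i) (hPs i) (by omega) (fun c hc => ?_) ?_
      (fun x _ _ => by rw [hls i]) (fun x _ _ => rfl)
    · have := hpos i c hc
      omega
    · rw [hls i]
      refine (hs.gap i).imp fun {c c'} h => ?_
      have := home_bounds (θ + sideShift W H i) c
      have := home_bounds (θ + sideShift W H i) c'
      omega
  have hlen' : ∀ i, sideLen (W - 2 * b) (H - 2 * b) i = sideLen W H i - 2 * b := by
    intro i; fin_cases i <;> rfl
  have hshift : ∀ i, sideShift (W - 2 * b) (H - 2 * b) i % 2 = sideShift W H i % 2 := by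
    intro i; fin_cases i <;> simp [sideShift] <;> omega
  refine ⟨fun i => ((unmarked (ls i)).map (passTo (θ + sideShift W H i))).map (· - b),
    ⟨fun i => ?_, fun i c hc => ?_, fun i => ?_⟩, ?_, fun hin => ?_⟩
  · have := hlen i
    rw [hlen']
    omega
  · obtain ⟨c', hc', rfl⟩ := List.mem_map.1 hc
    have := hGpos i c' hc'
    rw [hlen']
    omega
  · have hsub : (unmarked (ls i)).Sublist (T i) := hls i ▸ unmarked_sublist (ls i)
    rw [List.map_map, List.pairwise_map]
    refine ((hs.gap i).sublist hsub).imp fun {c c'} h => ?_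
    have h' : (θ + 1 + sideShift (W - 2 * b) (H - 2 * b) i - (θ + sideShift W H i)) % 2 = 1 := by
      have := hshift i
      omega
    simp only [Function.comp_apply, home_passTo hb h']
    omega
  · rw [← hall]
    simp only [allTypes, List.map_append, List.map_map]
    have : ∀ i, (fun x : ℤ => x % 2) ∘ (fun x => x + sideShift (W - 2 * b) (H - 2 * b) i) ∘
        (fun x => x - b) ∘ passTo (θ + sideShift W H i) =
        (fun x : ℤ => x % 2) ∘ (fun x => x + sideShift W H i) := by
      intro i
      funext c
      have := hshift i
      simp only [Function.comp_apply, passTo]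
      split_ifs <;> omega
    simp only [this]
  -- This `m₂` has parity opposite to `m₁`, and `m₂ - b` is the other element of `{b + 2, b + 3}`:
  -- the inner rectangle is opened at an edge in the same standard position, with the phase
  -- switched.
  · refine hamPath_region_teeth (m₂ := 3 * b + 5 - m₁) hb (by omega) (by omega) (fun i c hc => ?_)
      (fun i c hc => ?_) (fun c hc => ?_) (fun c hc => ?_) (fun i _ => hband i b (by omega)) r1 r2
      r3 ?_ (h0 ▸ hband 0 _ (by omega)) (by omega) (by omega) (by omega) hθ₁ (by omega) ?_
    · have := hs.pos i c hc
      omega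
    · have := hGpos i c hc
      omega
    · have := hs.pos 0 c hc
      omega
    · have := hGpos 0 c hc
      omega
    · omega
    · rwa [show 3 * b + 5 - m₁ - b = 2 * b + 5 - m₁ by ring]

end

section

variable {b W H M θ m₁ : ℤ} {T : Fin 4 → List ℤ}

theorem mem_region_teeth_single (hb0 : 0 < b) {z₀ : ℤ} (hz₀ : 0 ≤ z₀) (hz₀' : z₀ + 3 ≤ W)
    (hH : 0 < H) (z : ℤ × ℤ) :
    z ∈ Region W H (fun i => teeth b (![[z₀], [], [], []] i)) ↔
      z ∈ box 0 W (-H) 0 ∪ box z₀ (z₀ + 3) 0 (b - 1) := by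
  simp only [mem_region, mem_box, Set.mem_union, Matrix.cons_val, teeth, List.not_mem_nil,
    false_and, exists_false, if_false, List.mem_singleton, exists_eq_left]
  split_ifs <;> omega

/-- The case of a single tooth, which can be moved to the left part of the top side. -/
theorem hamPath_region_single_tooth (hb : b % 2 = 0) (hb4 : 4 ≤ b) (hs : Spread W H M θ T)
    (hM : 4 * (b + 8) ≤ M) {t : ℤ} (hT : allTypes W H T = [t]) (htθ : (t + θ) % 2 = 0)
    (ht : t % 2 = 0) (hW : W % 2 = 1) (hH : H % 2 = 1)
    (hm₁ : b + 2 ≤ m₁) (hm₁' : m₁ ≤ b + 3) (hθ₁ : (m₁ + θ) % 2 = 0) :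
    HamPath (Region W H fun i => teeth b (T i)) (m₁, -1) (m₁ - 1, -1) := by
  -- A new notch near the start of the top side raises the phase to `θ + 1`; the tooth is then
  -- absorbed, giving `θ + 2`, which agrees with `θ`. In effect the tooth is moved to a known place
  -- of the inner rectangle.
  have hP : Processes (θ + 1) (θ + 1) [(t, true)] (θ + 2) := ⟨by omega, by simp [Processes]; omega⟩
  obtain ⟨ls, θs, θs', hls, hPs, h0, r1, r2, r3, r0, hall⟩ :=
    exists_processes_sides (W := W) (H := H) (T := T) (by simp [hT]) hP
  have hun : ∀ i, unmarked (ls i) = [] := by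
    have h : allTypes W H (fun i => unmarked (ls i)) = [] := by rw [hall]; rfl
    simp only [allTypes, List.append_eq_nil_iff, List.map_eq_nil_iff] at h
    intro i
    fin_cases i
    exacts [h.1, h.2.1, h.2.2.1, h.2.2.2]
  have hlen := hs.len
  have hW' := hlen 0
  have hH' := hlen 1
  simp only [sideLen, Fin.isValue, Matrix.cons_val] at hW' hH'
  have hband : ∀ i lo, lo ≤ 3 * b + 8 → BandPath b (teeth b (T i)) (teeth b []) lo (θs i)
      (sideLen W H i - b) (θs' i) := by
    intro i lo hlo
    have := hlen i
    refine bandPath_teeth hb hb4 (ls i) (hPs i) (by omega) (fun c hc => ?_) ?_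
      (fun x _ _ => by rw [hls i]) (fun x _ _ => by rw [hun i]; rfl)
    · have := hs.pos i c (hls i ▸ hc)
      omega
    · rw [hls i]
      refine (hs.gap i).imp fun {c c'} h => ?_
      have := home_bounds (θ + sideShift W H i) c
      have := home_bounds (θ + sideShift W H i) c'
      omega
  have hT0 : ∀ x, x < M → teeth b (T 0) x = 0 := fun x hx => teeth_eq_zero fun c hc => by
    have := hs.pos 0 c hc
    omega
  have htop : BandPath b (teeth b (T 0)) (teeth b [3 * b + 6 - m₁]) (3 * b + 5 - m₁) θ
      (W - b) (θs' 0) := by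
    have h1 : BandPath b (teeth b (T 0)) (teeth b [3 * b + 6 - m₁]) (3 * b + 5 - m₁) θ
        (3 * b + 6 - m₁) θ :=
      bandPath_flat hb (by omega) θ (by omega) (fun x _ _ => hT0 x (by omega))
        (fun x _ _ => teeth_eq_zero (by simp; omega))
    have h2 : BandPath b (teeth b (T 0)) (teeth b [3 * b + 6 - m₁]) (3 * b + 6 - m₁) θ
        (3 * b + 6 - m₁ + 3) (θ + 1) :=
      bandPath_notch (by omega) (fun x _ _ => hT0 x (by omega))
        (fun x _ _ => by rw [teeth_cons, if_pos (by omega)])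
    refine (h1.trans h2).trans ?_
    rw [← h0]
    refine (hband 0 _ (by omega)).congr (fun x _ _ => rfl) fun x h h' => ?_
    rw [teeth_cons, if_neg (by omega)]
  refine hamPath_region_teeth (G := ![[3 * b + 6 - m₁], [], [], []]) (θs := θs) (θs' := θs')
    (m₂ := 3 * b + 5 - m₁) hb (by omega) (by omega) (fun i c hc => ?_)
    (fun i c hc => ?_) (fun c hc => ?_) (fun c hc => ?_) (fun i hi => ?_) r1 r2 r3 (by omega) htop
    (by omega) (by omega) (by omega) hθ₁ (by omega) ?_
  · have := hs.pos i c hc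
    omega
  · fin_cases i
    · simp only [Fin.zero_eta, Fin.isValue, Matrix.cons_val, List.mem_singleton] at hc
      simp only [sideLen, Fin.zero_eta, Fin.isValue, Matrix.cons_val]
      omega
    all_goals simp at hc
  · have := hs.pos 0 c hc
    omega
  · simp only [Fin.isValue, Matrix.cons_val, List.mem_singleton] at hc
    omega
  · have := hband i b (by omega)
    fin_cases i
    · exact absurd rfl hi
    all_goals exact this
  -- Since `t` and `t + θ` are even, so are `θ` and `m₁`. The new tooth thus has an even position,
  -- as required for a rectangle with odd sides.
  · have h := hamPath_rectangle_tooth (b := b) (W := W - 2 * b) (H := H - 2 * b)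
      (m := 2 * b + 5 - m₁) (z₀ := 2 * b + 6 - m₁) hb (by omega) (by omega) (by omega) (by omega)
      (by omega) (by omega) (by omega) (by omega)
    have hfun : (fun i => teeth b ((![[3 * b + 6 - m₁], [], [], []] i : List ℤ).map (· - b))) =
        fun i => teeth b (![[2 * b + 6 - m₁], [], [], []] i) := by
      funext i
      fin_cases i
      · simp [show 3 * b + 6 - m₁ - b = 2 * b + 6 - m₁ by ring]
      all_goals rfl
    rw [hfun]
    refine h.congr (by ext <;> simp; ring) (by ext <;> simp; ring) fun z => ?_
    rw [mem_region_teeth_single (by omega) (by omega) (by omega) (by omega)]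

/-- The list of types is such that the next ring makes progress. -/
def Progressive (θ : ℤ) : List ℤ → Prop
  | [] => True
  | [t] => (t + θ) % 2 = 0
  | t :: _ :: _ => (t + θ) % 2 = 1

/-- For a nonempty list, being progressive is a condition on the parity of the first type plus the
phase, so switching the phase repairs it. -/
theorem Progressive.of_not {L L' : List ℤ} (h : ¬ Progressive θ L)
    (hL : L'.map (· % 2) = L.map (· % 2)) : Progressive (θ + 1) L' := by
  rcases L with _ | ⟨t, _ | ⟨u, L⟩⟩ <;> rcases L' with _ | ⟨t', _ | ⟨u', L'⟩⟩ <;>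
    simp only [List.map_cons, List.map_nil, List.cons.injEq, reduceCtorEq, and_true, and_false,
      Progressive, not_true_eq_false] at h hL ⊢ <;> omega

theorem sum_parSign_congr {L L' : List ℤ} (hL : L'.map (· % 2) = L.map (· % 2)) :
    (L'.map parSign).sum = (L.map parSign).sum := by
  have : ∀ L : List ℤ, L.map parSign = (L.map (· % 2)).map parSign := by
    intro L
    rw [List.map_map]
    congr 1
    funext t
    exact parSign_eq_of_emod (Int.emod_emod_of_dvd t dvd_rfl).symm
  rw [this L, this L', hL]

theorem sum_parSign_const {L : List ℤ} {s : ℤ} (h : ∀ t ∈ L, parSign t = s) :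
    (L.map parSign).sum = L.length * s := by
  rw [List.map_congr_left h]
  simp

/-- A rectangle with teeth on its sides, of total charge `0`, has a Hamiltonian cycle through
a given edge of its top side. -/
theorem hamPath_toothed_rectangle (hb : b % 2 = 0) (hb4 : 4 ≤ b) (n : ℕ) :
    ∀ {W H M θ m₁ : ℤ} {T : Fin 4 → List ℤ}, Spread W H M θ T → (allTypes W H T).length = n →
    ((allTypes W H T).map parSign).sum = (if W % 2 = 1 ∧ H % 2 = 1 then 1 else 0) →
    b + 2 ≤ m₁ → m₁ ≤ b + 3 → (m₁ + θ) % 2 = 0 → (2 * n + 5) * (b + 8) ≤ M →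
    HamPath (Region W H fun i => teeth b (T i)) (m₁, -1) (m₁ - 1, -1) := by
  induction n using Nat.strong_induction_on with
  | _ n ih =>
  have key : ∀ {W H M θ m₁ : ℤ} {T : Fin 4 → List ℤ}, Spread W H M θ T →
      (allTypes W H T).length = n →
      ((allTypes W H T).map parSign).sum = (if W % 2 = 1 ∧ H % 2 = 1 then 1 else 0) →
      b + 2 ≤ m₁ → m₁ ≤ b + 3 → (m₁ + θ) % 2 = 0 → (2 * n + 4) * (b + 8) ≤ M →
      Progressive θ (allTypes W H T) →
      HamPath (Region W H fun i => teeth b (T i)) (m₁, -1) (m₁ - 1, -1) := by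
    intro W H M θ m₁ T hs hn hsum hm₁ hm₁' hθ₁ hM hprog
    have hM4 : 4 * (b + 8) ≤ M := le_trans (by nlinarith) hM
    match hL : allTypes W H T with
    | [] =>
      rw [hL] at hsum
      have hWH : W % 2 = 0 ∨ H % 2 = 0 := by
        simp only [List.map_nil, List.sum_nil] at hsum
        split_ifs at hsum <;> omega
      have h0 : ∀ i, T i = [] := by
        simp only [allTypes, List.append_eq_nil_iff, List.map_eq_nil_iff] at hL
        intro i
        fin_cases i
        exacts [hL.1, hL.2.1, hL.2.2.1, hL.2.2.2]
      have hW := hs.len 0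
      have hH := hs.len 1
      simp only [sideLen, Fin.isValue, Matrix.cons_val] at hW hH
      refine (hamPath_rectangle hWH (by omega) (by omega) (by omega)).congr rfl rfl fun z => ?_
      simp only [h0]
      exact (mem_region_teeth_nil z).symm
    | [t] =>
      rw [hL] at hsum hprog
      simp only [List.map_cons, List.map_nil, List.sum_cons, List.sum_nil, parSign] at hsum
      refine hamPath_region_single_tooth hb hb4 hs hM4 hL hprog ?_ ?_ ?_ hm₁ hm₁' hθ₁ <;>
        (split_ifs at hsum <;> omega)
    | t :: u :: L =>
      rw [hL] at hsum hprog hn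
      -- If all teeth had the same type, the signs would sum to plus or minus their number, which is
      -- at least 2, whereas the charge condition makes the sum 0 or 1.
      obtain ⟨l, θ', h1, h2, h3, h4, h5⟩ := exists_processes_absorbing (u :: L) t hprog (by
        by_contra hcon
        push Not at hcon
        have hc : ∀ t' ∈ t :: u :: L, parSign t' = parSign t := by
          intro t' ht'
          rcases List.mem_cons.1 ht' with rfl | ht'
          · rfl
          · have := hcon t' ht'
            simp only [Progressive] at hprog
            exact parSign_eq_of_emod (by omega)
        rw [sum_parSign_const hc] at hsum
        simp only [List.length_cons, parSign] at hsum
        push_cast at hsum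
        split_ifs at hsum <;> omega)
      obtain ⟨T', hs', hT', himp⟩ := exists_step hb hb4 hs hM4 (h1.trans hL.symm) h2 h3 hm₁ hm₁' hθ₁
      have hlen : (allTypes (W - 2 * b) (H - 2 * b) T').length = (unmarked l).length := by
        simpa using congrArg List.length hT'
      simp only [List.length_cons] at h4 hn
      refine himp (ih (n - 2) (by omega) hs' (by omega) ?_ (by omega) (by omega) (by omega) ?_)
      · rw [sum_parSign_congr hT', h5, hsum]
        congr 1
        rw [eq_iff_iff]
        omega
      · obtain ⟨k, rfl⟩ : ∃ k, n = k + 2 := ⟨n - 2, by omega⟩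
        rw [Nat.add_sub_cancel]
        push_cast at hM
        linarith
  intro W H M θ m₁ T hs hn hsum hm₁ hm₁' hθ₁ hM
  by_cases hprog : Progressive θ (allTypes W H T)
  · exact key hs hn hsum hm₁ hm₁' hθ₁ (le_trans (by nlinarith) hM) hprog
  -- A ring that passes on all teeth serves only to switch the phase.
  · have hM4 : 4 * (b + 8) ≤ M := le_trans (by nlinarith) hM
    obtain ⟨T', hs', hT', himp⟩ := exists_step hb hb4 hs hM4 (map_fst_map_false _)
      (Processes.of_unmarked _ (by simp)) (by simp) hm₁ hm₁' hθ₁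
    rw [unmarked_map_false] at hT'
    have hlen : (allTypes (W - 2 * b) (H - 2 * b) T').length = (allTypes W H T).length := by
      simpa using congrArg List.length hT'
    refine himp (key hs' (by omega) ?_ (by omega) (by omega) (by omega) (by linarith)
      (Progressive.of_not hprog hT'))
    rw [sum_parSign_congr hT', hsum]
    congr 1
    rw [eq_iff_iff]
    omega

end

/-! ### The outermost ring: bumps of arbitrary odd size -/

/-- A rectangular bump on a side: its position on the side, its width, and its height, which is
negative if it is cut out. -/
structure Bump where
  pos : ℤ
  width : ℤ
  height : ℤ

/-- The profile of a side with the bumps in `L`. -/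
def bumpProfile : List Bump → ℤ → ℤ
  | [], _ => 0
  | e :: L, x => if e.pos ≤ x ∧ x < e.pos + e.width then e.height else bumpProfile L x

section profile

variable {L : List Bump} {x : ℤ}

theorem bumpProfile_eq_zero (h : ∀ e ∈ L, x < e.pos ∨ e.pos + e.width ≤ x) :
    bumpProfile L x = 0 := by
  induction L with
  | nil => rfl
  | cons e L ih =>
    rw [List.forall_mem_cons] at h
    rw [bumpProfile, if_neg (by omega), ih h.2]

theorem bumpProfile_eq_height {e : Bump} (he : e ∈ L)
    (hL : L.Pairwise fun e e' => e.pos + e.width + 50 ≤ e'.pos) (h : e.pos ≤ x)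
    (h' : x < e.pos + e.width) : bumpProfile L x = e.height := by
  induction L with
  | nil => simp at he
  | cons e' L ih =>
    rw [List.pairwise_cons] at hL
    rcases List.mem_cons.1 he with rfl | he
    · rw [bumpProfile, if_pos ⟨h, h'⟩]
    · have := hL.1 e he
      rw [bumpProfile, if_neg (by omega), ih he hL.2]

theorem bumpProfile_induction {P : ℤ → Prop} (h0 : P 0) (h : ∀ e ∈ L, P e.height) (x : ℤ) :
    P (bumpProfile L x) := by
  induction L with
  | nil => exact h0
  | cons e L ih =>
    rw [List.forall_mem_cons] at h
    rw [bumpProfile]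
    split_ifs
    exacts [h.1, ih h.2]

theorem bump_far_of_ne {L : List Bump} (hL : L.Pairwise fun e e' => e.pos + e.width + 50 ≤ e'.pos)
    {e e' : Bump} (he : e ∈ L) (he' : e' ∈ L) (hne : e ≠ e') :
    e.pos + e.width + 50 ≤ e'.pos ∨ e'.pos + e'.width + 50 ≤ e.pos :=
  List.Pairwise.forall_of_forall_of_flip (R := fun e e' : Bump => e = e' ∨
    e.pos + e.width + 50 ≤ e'.pos ∨ e'.pos + e'.width + 50 ≤ e.pos) (by simp)
    (hL.imp fun h => Or.inr (Or.inl h)) (hL.imp fun h => Or.inr (Or.inr h)) he he'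
    |>.resolve_left hne

theorem isBumpOn_bumpProfile {e : Bump} (he : e ∈ L)
    (hL : L.Pairwise fun e e' => e.pos + e.width + 50 ≤ e'.pos) (hw : ∀ e ∈ L, 3 ≤ e.width) :
    IsBumpOn (bumpProfile L) e.pos e.width e.height (e.pos - 10) (e.pos + e.width + 10) := by
  intro x h h'
  split_ifs with hx
  · exact bumpProfile_eq_height he hL hx.1 hx.2
  · refine bumpProfile_eq_zero fun e' he' => ?_
    by_cases hee : e = e'
    · subst hee; omega
    · have h1 := hw e he
      have h2 := hw e' he'
      have := bump_far_of_ne hL he he' hee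
      omega

end profile

/-- Where a bump is passed on to. -/
def bumpTo (θ : ℤ) (e : Bump) : ℤ :=
  if (e.pos + θ) % 2 = 0 then e.pos - 4 else e.pos + e.width + 1

theorem bumpTo_bounds {θ : ℤ} {e : Bump} (hw : e.width % 2 = 1) (hw3 : 3 ≤ e.width) :
    (bumpTo θ e - e.pos) % 2 = 0 ∧ e.pos - 4 ≤ bumpTo θ e ∧ bumpTo θ e ≤ e.pos + e.width + 1 ∧
      (0 < e.height ∨ bumpTo θ e + 3 ≤ e.pos ∨ e.pos + e.width ≤ bumpTo θ e) := by
  rw [bumpTo]; split_ifs <;> omega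

/-- Every bump in range is passed on, so the phase never changes. Bumps out of range are allowed in
the list, with any value of `s` near the bump: this permits using the statement on both sides of the
bump at which the path is broken. -/
theorem bandPath_bumps {b θ : ℤ} (hb : b % 2 = 0) (hb4 : 4 ≤ b) {f g : ℤ → ℤ} {hi : ℤ}
    (s : Bump → ℤ) (L : List Bump) : ∀ {lo : ℤ}, lo ≤ hi →
    (∀ e ∈ L, e.width % 2 = 1 ∧ 3 ≤ e.width ∧ e.height % 2 = 1 ∧ 3 ≤ b + e.height) →
    (∀ e ∈ L, e.pos - 4 ≤ s e ∧ s e ≤ e.pos + e.width + 1) →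
    (∀ e ∈ L, (lo ≤ e.pos - 8 ∧ e.pos + e.width + 8 ≤ hi ∧ s e = bumpTo θ e) ∨
      e.pos + e.width + 8 ≤ lo ∨ hi ≤ e.pos - 8) →
    L.Pairwise (fun e e' => e.pos + e.width + 50 ≤ e'.pos) →
    (∀ x, lo ≤ x → x < hi → f x = bumpProfile L x) →
    (∀ x, lo ≤ x → x < hi → g x = teeth b (L.map s) x) →
    BandPath b f g lo θ hi θ := by
  induction L with
  | nil =>
    intro lo hlo _ _ _ _ hf hg
    refine bandPath_flat hb (by omega) θ hlo (fun x h h' => ?_) (fun x h h' => ?_)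
    · rw [hf x h h']; rfl
    · rw [hg x h h']; exact teeth_eq_zero (by simp)
  | cons e L ih =>
    intro lo hlo hodd hs hpos hgap hf hg
    simp only [List.map_cons, List.forall_mem_cons, List.pairwise_cons] at hodd hs hpos hgap hf hg
    have hss := hs.1
    have hw := hodd.1.2.1
    obtain ⟨h1, h2, hse⟩ | hout := hpos.1
    · have hfb : IsBumpOn f e.pos e.width e.height lo (e.pos + e.width + 8) := by
        intro x h h'
        rw [hf x h (by omega), bumpProfile, bumpProfile_eq_zero]
        intro e' he'
        have := hgap.1 e' he'
        omega
      have hgb : IsBumpOn g (s e) 3 (b - 1) lo (e.pos + e.width + 8) := by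
        intro x h h'
        rw [hg x h (by omega), teeth_cons, teeth_eq_zero (T := L.map s)]
        intro c hc
        obtain ⟨e', he', rfl⟩ := List.mem_map.1 hc
        have := hgap.1 e' he'
        have := hs.2 e' he'
        omega
      have hrest : BandPath b f g (e.pos + e.width + 8) θ hi θ := by
        refine ih h2 hodd.2 hs.2 (fun e' he' => ?_) hgap.2 (fun x h h' => ?_) fun x h h' => ?_
        · have := hgap.1 e' he'
          have := (hodd.2 e' he').2.1
          have := hpos.2 e' he'
          omega
        · rw [hf x (by omega) h', bumpProfile, if_neg (by omega)]
        · rw [hg x (by omega) h', teeth_cons, if_neg (by omega)]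
      have hflat : BandPath b f g lo θ (e.pos - 8) θ := bandPath_flat hb (by omega) θ h1
        (fun x h h' => hfb.eq_zero (by omega) (by omega) (by omega))
        (fun x h h' => hgb.eq_zero (by omega) (by omega) (by omega))
      refine (hflat.trans ?_).trans hrest
      by_cases h : (e.pos + θ) % 2 = 0
      · rw [hse, bumpTo, if_pos h] at hgb
        exact bandPath_pass_left hb (by omega) hodd.1.1 hw hodd.1.2.2.1 hodd.1.2.2.2 h
          (hfb.mono (by omega) le_rfl) (hgb.mono (by omega) le_rfl)
      · rw [hse, bumpTo, if_neg h] at hgb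
        exact bandPath_pass_right hb (by omega) hodd.1.1 hw hodd.1.2.2.1 hodd.1.2.2.2 (by omega)
          (hfb.mono (by omega) le_rfl) (hgb.mono (by omega) le_rfl)
    · refine ih hlo hodd.2 hs.2 hpos.2 hgap.2 (fun x h h' => ?_) fun x h h' => ?_
      · rw [hf x h h', bumpProfile, if_neg (by omega)]
      · rw [hg x h h', teeth_cons, if_neg (by omega)]

/-! ### Boundary edges on the top side -/

/-- Points below the profile with a point above the profile next to them. -/
def OnProfile (f : ℤ → ℤ) (x : ℤ × ℤ) : Prop :=
  x.2 < f x.1 ∧ ∃ m, x.1 - 1 ≤ m ∧ m ≤ x.1 + 1 ∧ f m ≤ x.2 + 1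

section

variable {b c p d m r : ℤ} {f : ℤ → ℤ}

/-- Being on the profile determines the row in each position relative to the bump: `-1` outside, `d
- 1` on the bump, and at a corner the lower of the two. The right half is the mirror image of the
left. -/
theorem breakable_horizontal (hb : b % 2 = 0) (hb0 : 0 < b) (hp : p % 2 = 1) (hp3 : 3 ≤ p)
    (hd : d % 2 = 1) (hbd : 3 ≤ b + d) (hf : IsBumpOn f c p d (c - 10) (c + p + 10))
    (hx : OnProfile f (m, r)) (hy : OnProfile f (m + 1, r)) (hm : c - 8 ≤ m)
    (hm' : m + 1 < c + p + 8) : Breakable b c p d (m, r) (m + 1, r) := by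
  obtain ⟨hx1, k, hk1, hk2, hk⟩ := hx
  obtain ⟨hy1, l, hl1, hl2, hl⟩ := hy
  dsimp only at hx1 hk1 hk2 hk hy1 hl1 hl2 hl
  rw [hf m (by omega) (by omega)] at hx1
  rw [hf k (by omega) (by omega)] at hk
  rw [hf (m + 1) (by omega) (by omega)] at hy1
  rw [hf l (by omega) (by omega)] at hl
  have hcases : m + 1 < c ∨ m + 1 = c ∨ (c ≤ m ∧ m + 1 < c + p) ∨ m + 1 = c + p ∨ c + p ≤ m := by
    omega
  rcases hcases with h | h | h | h | h
  · obtain rfl : r = -1 := by split_ifs at hx1 hk <;> omega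
    exact breakable_flat hb hb0 hp hp3 hd hbd hm h
  · by_cases hd0 : 0 < d
    · obtain rfl : r = -1 := by split_ifs at hx1 hk <;> omega
      obtain rfl : m = c - 1 := by omega
      rw [sub_add_cancel]
      exact breakable_corner_add hb hb0 hp hp3 hd hd0
    · obtain rfl : r = d - 1 := by split_ifs at hy1 hl <;> omega
      obtain rfl : m = c - 1 := by omega
      rw [sub_add_cancel]
      exact breakable_corner_cut hb hb0 hp hp3 hd hbd (by omega)
  · obtain rfl : r = d - 1 := by split_ifs at hx1 hy1 hl hk <;> omega
    exact breakable_top_side hb hb0 hp hp3 hd hbd h.1 h.2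
  · obtain rfl : m = c + p - 1 := by omega
    by_cases hd0 : 0 < d
    · obtain rfl : r = -1 := by split_ifs at hy1 hl <;> omega
      have := ((breakable_corner_add (c := c) hb hb0 hp hp3 hd hd0).reflect hp).symm
      convert this using 2 <;> ring
    · obtain rfl : r = d - 1 := by split_ifs at hx1 hk <;> omega
      have := ((breakable_corner_cut (c := c) hb hb0 hp hp3 hd hbd (by omega)).reflect hp).symm
      convert this using 2 <;> ring
  · obtain rfl : r = -1 := by split_ifs at hy1 hl <;> omega
    have := ((breakable_flat (c := c) (m := 2 * c + p - 2 - m) hb hb0 hp hp3 hd hbd (by omega)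
      (by omega)).reflect hp).symm
    convert this using 2 <;> ring

/-- A vertical boundary edge runs along a flank of the bump, either in an end column of an added
bump or in the column beside a cut. In the columns strictly inside the bump there is none. -/
theorem breakable_vertical (hb : b % 2 = 0) (hb0 : 0 < b) (hp : p % 2 = 1) (hp3 : 3 ≤ p)
    (hd : d % 2 = 1) (hbd : 3 ≤ b + d) (hf : IsBumpOn f c p d (c - 10) (c + p + 10))
    (hx : OnProfile f (m, r)) (hy : OnProfile f (m, r + 1)) (hm : c - 8 ≤ m)
    (hm' : m < c + p + 8) : Breakable b c p d (m, r) (m, r + 1) := by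
  obtain ⟨hx1, k, hk1, hk2, hk⟩ := hx
  obtain ⟨hy1, -⟩ := hy
  dsimp only at hx1 hk1 hk2 hk hy1
  rw [hf m (by omega) (by omega)] at hx1 hy1
  rw [hf k (by omega) (by omega)] at hk
  have hr : -b ≤ r := by split_ifs at hk <;> omega
  have hcases : m < c ∨ m = c ∨ (c < m ∧ m + 1 < c + p) ∨ m + 1 = c + p ∨ c + p ≤ m := by
    omega
  rcases hcases with h | h | h | h | h
  · exact breakable_column hb hb0 hp hp3 hd hbd hm h hr (by split_ifs at hy1 <;> omega)
  · subst h
    exact breakable_left_side hb hb0 hp hp3 hd hbd hr (by split_ifs at hy1 <;> omega)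
  · split_ifs at hk hy1 <;> omega
  · obtain rfl : m = c + p - 1 := by omega
    have := (breakable_left_side (c := c) hb hb0 hp hp3 hd hbd hr
      (by split_ifs at hy1 <;> omega)).reflect hp
    convert this using 2 <;> ring
  · have := (breakable_column (c := c) (m := 2 * c + p - 1 - m) hb hb0 hp hp3 hd hbd (by omega)
      (by omega) hr (by split_ifs at hy1 <;> omega)).reflect hp
    convert this using 2 <;> ring

end

/-- The bumps on the four sides of the rectangle are of odd sizes, of height bounded in terms of
`b`, far from the corners and from each other. -/
structure Bumpy (b W H M : ℤ) (L : Fin 4 → List Bump) : Prop where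
  odd : ∀ i, ∀ e ∈ L i, e.width % 2 = 1 ∧ 3 ≤ e.width ∧ e.height % 2 = 1 ∧ 3 ≤ b + e.height
  len : ∀ i, 2 * M ≤ sideLen W H i
  pos : ∀ i, ∀ e ∈ L i, M ≤ e.pos ∧ e.pos + e.width + M ≤ sideLen W H i
  gap : ∀ i, (L i).Pairwise fun e e' => e.pos + e.width + 50 ≤ e'.pos

/-- The path on the top side of a bumpy rectangle can be broken at any edge of its boundary. -/
theorem exists_bandBreak_bumps {b W H M : ℤ} {L : Fin 4 → List Bump} (hb : b % 2 = 0)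
    (hb4 : 4 ≤ b) (hL : Bumpy b W H M L) (hM : 5 * (b + 8) ≤ M) {x y : ℤ × ℤ}
    (hxy : y = (x.1 + 1, x.2) ∨ y = (x.1, x.2 + 1))
    (hx : OnProfile (bumpProfile (L 0)) x) (hy : OnProfile (bumpProfile (L 0)) y)
    (hlo : 3 * b + 10 ≤ x.1) (hhi : x.1 + 3 * b + 10 ≤ W) :
    ∃ (θ : ℤ) (s : Bump → ℤ), (∀ e ∈ L 0, (s e - e.pos) % 2 = 0 ∧ e.pos - 4 ≤ s e ∧
      s e ≤ e.pos + e.width + 1 ∧ (0 < e.height ∨ s e + 3 ≤ e.pos ∨ e.pos + e.width ≤ s e)) ∧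
      ∀ m₂, m₂ ≤ 2 * b + 3 →
      BandBreak b (bumpProfile (L 0)) (teeth b ((L 0).map s)) m₂ θ (W - b) θ x y ∨
      BandBreak b (bumpProfile (L 0)) (teeth b ((L 0).map s)) m₂ θ (W - b) θ y x := by
  have hodd := hL.odd 0
  have hpos := hL.pos 0
  have hgap := hL.gap 0
  simp only [sideLen, Fin.isValue, Matrix.cons_val] at hpos
  have hbump := fun e (he : e ∈ L 0) => isBumpOn_bumpProfile he hgap fun e he => (hodd e he).2.1
  obtain ⟨m, r⟩ := x
  dsimp only at hxy hlo hhi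
  have hbt : ∀ θ, ∀ e ∈ L 0, _ := fun θ e he => bumpTo_bounds (θ := θ) (hodd e he).1
    (hodd e he).2.1
  by_cases hnear : ∃ e ∈ L 0, Breakable b e.pos e.width e.height (m, r) y
  · obtain ⟨e, he, θ, n, h1, h2, h3, h4, hbr⟩ := hnear
    classical
    have hs : ∀ e' ∈ L 0, ((if e' = e then n else bumpTo θ e') - e'.pos) % 2 = 0 ∧
        e'.pos - 4 ≤ (if e' = e then n else bumpTo θ e') ∧
        (if e' = e then n else bumpTo θ e') ≤ e'.pos + e'.width + 1 ∧
        (0 < e'.height ∨ (if e' = e then n else bumpTo θ e') + 3 ≤ e'.pos ∨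
          e'.pos + e'.width ≤ (if e' = e then n else bumpTo θ e')) := by
      intro e' he'
      split_ifs with hee
      · subst hee; exact ⟨h1, h2, h3, h4⟩
      · exact hbt θ e' he'
    refine ⟨θ, fun e' => if e' = e then n else bumpTo θ e', hs, fun m₂ hm₂ => ?_⟩
    have hfar : ∀ e' ∈ L 0, e' ≠ e → e.pos + e.width + 50 ≤ e'.pos ∨
        e'.pos + e'.width + 50 ≤ e.pos := by
      intro e' he' hee
      exact (bump_far_of_ne hgap he' he hee).symm
    have hp := hpos e he
    have hw := hodd e he
    have hl : BandPath b (bumpProfile (L 0))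
        (teeth b ((L 0).map fun e' => if e' = e then n else bumpTo θ e')) m₂ θ (e.pos - 8) θ := by
      refine bandPath_bumps hb hb4 _ (L 0) (by omega) hodd
        (fun e' he' => ⟨(hs e' he').2.1, (hs e' he').2.2.1⟩)
        (fun e' he' => ?_) hgap (fun x _ _ => rfl) (fun x _ _ => rfl)
      by_cases hee : e' = e
      · subst hee; omega
      · have := hfar e' he' hee
        have := hpos e' he'
        have := hodd e' he'
        simp only [hee, if_false, and_true]
        omega
    have hr : BandPath b (bumpProfile (L 0))
        (teeth b ((L 0).map fun e' => if e' = e then n else bumpTo θ e'))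
        (e.pos + e.width + 8) θ (W - b) θ := by
      refine bandPath_bumps hb hb4 _ (L 0) (by omega) hodd
        (fun e' he' => ⟨(hs e' he').2.1, (hs e' he').2.2.1⟩)
        (fun e' he' => ?_) hgap (fun x _ _ => rfl) (fun x _ _ => rfl)
      by_cases hee : e' = e
      · subst hee; omega
      · have := hfar e' he' hee
        have := hpos e' he'
        have := hodd e' he'
        simp only [hee, if_false, and_true]
        omega
    refine (hbr (bumpProfile (L 0)) _ ((hbump e he).mono (by omega) (by omega))
      fun x hx1 hx2 => ?_).imp (fun h => (hl.trans_break h).trans hr)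
      (fun h => (hl.trans_break h).trans hr)
    split_ifs with hx
    · rw [teeth, if_pos ⟨n, List.mem_map.2 ⟨e, he, by simp⟩, hx⟩]
    · refine teeth_eq_zero fun c hc => ?_
      obtain ⟨e', he', rfl⟩ := List.mem_map.1 hc
      by_cases hee : e' = e
      · simp only [hee, if_true]; omega
      · have := hfar e' he' hee
        have := hs e' he'
        have := hodd e' he'
        omega
  · push Not at hnear
    have hno : ∀ e ∈ L 0, e.pos + e.width + 8 ≤ m + 1 ∨ m + 1 ≤ e.pos - 8 := by
      intro e he
      by_contra hcon
      have hw := hodd e he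
      refine hnear e he ?_
      rcases hxy with rfl | rfl
      · exact breakable_horizontal hb (by omega) hw.1 hw.2.1 hw.2.2.1 hw.2.2.2 (hbump e he) hx hy
          (by omega) (by omega)
      · exact breakable_vertical hb (by omega) hw.1 hw.2.1 hw.2.2.1 hw.2.2.2 (hbump e he) hx hy
          (by omega) (by omega)
    -- The edge is far from all bumps, so it is a horizontal edge of row `-1`, and the phase `-(m +
    -- 1)` makes it a cut of the zigzag.
    have hz : ∀ k, m - 2 ≤ k → k ≤ m + 2 → bumpProfile (L 0) k = 0 := by
      intro k hk hk'
      refine bumpProfile_eq_zero fun e he => ?_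
      have := hno e he
      omega
    obtain ⟨hx1, k, hk1, hk2, hk⟩ := hx
    obtain ⟨hy1, -⟩ := hy
    dsimp only at hx1 hk1 hk2 hk
    rw [hz m (by omega) (by omega)] at hx1
    rw [hz k (by omega) (by omega)] at hk
    obtain rfl : r = -1 := by omega
    obtain rfl : y = (m + 1, -1) := by
      rcases hxy with rfl | rfl
      · rfl
      · dsimp only at hy1
        rw [hz m (by omega) (by omega)] at hy1
        omega
    refine ⟨-(m + 1), bumpTo (-(m + 1)), hbt _, fun m₂ hm₂ => Or.inl ?_⟩
    have hl : BandPath b (bumpProfile (L 0)) (teeth b ((L 0).map (bumpTo (-(m + 1)))))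
        m₂ (-(m + 1)) (m + 1) (-(m + 1)) := by
      refine bandPath_bumps hb hb4 _ (L 0) (by omega) hodd
        (fun e' he' => ⟨(hbt _ e' he').2.1, (hbt _ e' he').2.2.1⟩)
        (fun e' he' => ?_) hgap (fun x _ _ => rfl) (fun x _ _ => rfl)
      have := hno e' he'
      have := hpos e' he'
      omega
    have hr : BandPath b (bumpProfile (L 0)) (teeth b ((L 0).map (bumpTo (-(m + 1)))))
        (m + 1) (-(m + 1)) (W - b) (-(m + 1)) := by
      refine bandPath_bumps hb hb4 _ (L 0) (by omega) hodd
        (fun e' he' => ⟨(hbt _ e' he').2.1, (hbt _ e' he').2.2.1⟩)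
        (fun e' he' => ?_) hgap (fun x _ _ => rfl) (fun x _ _ => rfl)
      have := hno e' he'
      have := hpos e' he'
      omega
    have := hl.break_cut hr (by omega) (by omega)
    rwa [entry_eq_top (by omega), depart_eq_top (by omega), add_sub_cancel_right] at this

theorem bumpProfile_nonneg {L : List Bump} {x : ℤ}
    (h : ∀ e ∈ L, e.pos ≤ x → x < e.pos + e.width → 0 ≤ e.height) : 0 ≤ bumpProfile L x := by
  induction L with
  | nil => exact le_rfl
  | cons e L ih =>
    rw [List.forall_mem_cons] at h
    rw [bumpProfile]
    split_ifs with hx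
    exacts [h.1 hx.1 hx.2, ih h.2]

section

variable {b W H M : ℤ} {L : Fin 4 → List Bump}

/-- A bumpy rectangle of total charge `0` has a Hamiltonian cycle through any given edge of its
boundary at the top side. -/
theorem hamPath_bumpy_top (hb : b % 2 = 0) (hb4 : 4 ≤ b) (hL : Bumpy b W H M L) {n : ℕ}
    (hn : ∑ i, (L i).length ≤ n)
    (hsum : ∑ i, ((L i).map fun e => parSign (e.pos + sideShift W H i)).sum =
      if W % 2 = 1 ∧ H % 2 = 1 then 1 else 0)
    (hM : (2 * n + 6) * (b + 8) ≤ M) {x y : ℤ × ℤ}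
    (hxy : y = (x.1 + 1, x.2) ∨ y = (x.1, x.2 + 1))
    (hx : OnProfile (bumpProfile (L 0)) x) (hy : OnProfile (bumpProfile (L 0)) y)
    (hlo : 3 * b + 10 ≤ x.1) (hhi : x.1 + 3 * b + 10 ≤ W) :
    HamPath (Region W H fun i => bumpProfile (L i)) x y := by
  have hM6 : 6 * (b + 8) ≤ M := le_trans (by nlinarith) hM
  obtain ⟨θ, s₀, hs₀, hbr⟩ := exists_bandBreak_bumps hb hb4 hL (by omega) hxy hx hy hlo hhi
  -- The place of the detour: a crossing on the inner row such that `m₂ - b` is one of the standard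
  -- positions `b + 2`, `b + 3` of the induction.
  obtain ⟨m₂, hm₂, hm₂', hθ₂⟩ : ∃ m₂, 2 * b + 2 ≤ m₂ ∧ m₂ ≤ 2 * b + 3 ∧ (m₂ + θ) % 2 = 1 := by
    by_cases h : (2 * b + 2 + θ) % 2 = 1
    · exact ⟨2 * b + 2, by omega, by omega, h⟩
    · exact ⟨2 * b + 3, by omega, by omega, by omega⟩
  set s : Fin 4 → Bump → ℤ := fun i => if i = 0 then s₀ else bumpTo (θ + sideShift W H i) with hsdef
  have hs0 : s 0 = s₀ := by simp [hsdef]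
  have hs : ∀ i, ∀ e ∈ L i, (s i e - e.pos) % 2 = 0 ∧ e.pos - 4 ≤ s i e ∧
      s i e ≤ e.pos + e.width + 1 ∧
      (0 < e.height ∨ s i e + 3 ≤ e.pos ∨ e.pos + e.width ≤ s i e) := by
    intro i e he
    by_cases hi : i = 0
    · subst hi; rw [hs0]; exact hs₀ e he
    · simp only [hsdef, hi, if_false]
      exact bumpTo_bounds (hL.odd i e he).1 (hL.odd i e he).2.1
  have hlen := hL.len
  have hW := hlen 0
  have hH := hlen 1
  simp only [sideLen, Fin.isValue, Matrix.cons_val] at hW hH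
  have hlen' : ∀ i, sideLen (W - 2 * b) (H - 2 * b) i = sideLen W H i - 2 * b := by
    intro i; fin_cases i <;> rfl
  have hshift : ∀ i, sideShift (W - 2 * b) (H - 2 * b) i % 2 = sideShift W H i % 2 := by
    intro i; fin_cases i <;> simp [sideShift] <;> omega
  have hθ0 : θ + sideShift W H 0 = θ := by simp [sideShift]
  have hspread : Spread (W - 2 * b) (H - 2 * b) (M - (b + 8)) (θ + 1)
      fun i => ((L i).map (s i)).map (· - b) := by
    refine ⟨fun i => ?_, fun i c hc => ?_, fun i => ?_⟩
    · have := hlen i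
      rw [hlen']; omega
    · simp only [List.mem_map, exists_exists_and_eq_and] at hc
      obtain ⟨e, he, rfl⟩ := hc
      have := hs i e he
      have := hL.pos i e he
      rw [hlen']; omega
    · rw [List.map_map, List.pairwise_map]
      refine List.Pairwise.imp_of_mem (fun {e e'} he he' h => ?_) (hL.gap i)
      have := hs i e he
      have := hs i e' he'
      have h1 := home_bounds (θ + 1 + sideShift (W - 2 * b) (H - 2 * b) i) (s i e - b)
      have h2 := home_bounds (θ + 1 + sideShift (W - 2 * b) (H - 2 * b) i) (s i e' - b)
      simp only [Function.comp_apply]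
      omega
  have hcount : (allTypes (W - 2 * b) (H - 2 * b)
      fun i => ((L i).map (s i)).map (· - b)).length ≤ n := by
    simpa [allTypes, Fin.sum_univ_four, add_assoc] using hn
  have hbal : ((allTypes (W - 2 * b) (H - 2 * b)
      fun i => ((L i).map (s i)).map (· - b)).map parSign).sum =
      if (W - 2 * b) % 2 = 1 ∧ (H - 2 * b) % 2 = 1 then 1 else 0 := by
    rw [show (W - 2 * b) % 2 = W % 2 by omega, show (H - 2 * b) % 2 = H % 2 by omega, ← hsum,
      Fin.sum_univ_four]
    have : ∀ i, (((((L i).map (s i)).map (· - b)).map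
        (· + sideShift (W - 2 * b) (H - 2 * b) i)).map parSign) =
        (L i).map fun e => parSign (e.pos + sideShift W H i) := by
      intro i
      rw [List.map_map, List.map_map, List.map_map]
      refine List.map_congr_left fun e he => parSign_eq_of_emod ?_
      have := hs i e he
      have := hshift i
      dsimp only [Function.comp_apply]
      omega
    simp only [allTypes, List.map_append, List.sum_append, this, add_assoc]
  have hin := hamPath_toothed_rectangle hb hb4 _ hspread rfl hbal (m₁ := m₂ - b) (by omega)
    (by omega) (by omega) (by
      have : (2 * ((allTypes (W - 2 * b) (H - 2 * b)
        fun i => ((L i).map (s i)).map (· - b)).length : ℤ) + 5) * (b + 8) ≤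
        (2 * n + 5) * (b + 8) := by gcongr
      linarith)
  have hteeth : (fun i => teeth b (((L i).map (s i)).map (· - b))) =
      fun i x => teeth b ((L i).map (s i)) (x + b) := by
    funext i x
    exact teeth_map_sub ..
  rw [hteeth] at hin
  have key : ∀ {x y}, BandBreak b (bumpProfile (L 0)) (teeth b ((L 0).map s₀)) m₂ θ (W - b) θ x y →
      HamPath (Region W H fun i => bumpProfile (L i)) y x := by
    intro x y hbr
    refine hamPath_region_of_break (m₂ := m₂) (θ := fun i => θ + sideShift W H i)
      (θ' := fun i => θ + sideShift W H i) (g := fun i => teeth b ((L i).map (s i))) hb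
      (by omega) (by omega) (fun i x hx => ?_) (fun i x => teeth_nonneg (by omega) ..)
      (fun i x => ?_) (fun i hi => ?_) (fun i => ?_) ?_ ?_ (by omega) (by rwa [hθ0]) hin
    · refine ⟨bumpProfile_eq_zero fun e he => ?_, teeth_eq_zero fun c hc => ?_⟩
      · have := hL.pos i e he
        omega
      · obtain ⟨e, he, rfl⟩ := List.mem_map.1 hc
        have := hL.pos i e he
        have := hs i e he
        omega
    -- The ring has to be nonempty over every column. Over a notch just one row is left, so no cut
    -- may lie there; elsewhere a cut leaves at least three of the `b` rows.
    · by_cases h : ∃ c ∈ (L i).map (s i), c ≤ x ∧ x < c + 3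
      · have h0 : 0 ≤ bumpProfile (L i) x := by
          obtain ⟨c, hc, hx1, hx2⟩ := h
          obtain ⟨e, he, rfl⟩ := List.mem_map.1 hc
          refine bumpProfile_nonneg fun e' he' h1 h2 => ?_
          have := hs i e he
          by_cases hee : e = e'
          · subst hee; omega
          · have := bump_far_of_ne (hL.gap i) he he' hee
            have := (hL.odd i e he)
            have := (hL.odd i e' he')
            omega
        have := teeth_lt (b := b) (by omega) ((L i).map (s i)) x
        omega
      · have h0 : -b < bumpProfile (L i) x := bumpProfile_induction (P := fun t => -b < t)
          (by omega) (fun e he => by have := hL.odd i e he; omega) x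
        rw [teeth, if_neg h]
        omega
    · have := hlen i
      refine bandPath_bumps hb hb4 (s i) (L i) (by omega) (hL.odd i)
        (fun e he => ⟨(hs i e he).2.1, (hs i e he).2.2.1⟩) (fun e he => Or.inl ?_) (hL.gap i)
        (fun x _ _ => rfl) (fun x _ _ => rfl)
      have := hL.pos i e he
      exact ⟨by omega, by omega, by simp only [hsdef, hi, if_false]⟩
    · fin_cases i <;> simp [sideLen, sideShift] <;> omega
    · refine bandPath_flat hb (by omega) _ (by omega)
        (fun x _ _ => bumpProfile_eq_zero fun e he => ?_)
        (fun x _ _ => teeth_eq_zero fun c hc => ?_)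
      · have := hL.pos 0 e he
        omega
      · obtain ⟨e, he, rfl⟩ := List.mem_map.1 hc
        have := hL.pos 0 e he
        have := hs 0 e he
        omega
    · simp only [hθ0, hs0]
      exact hbr
  exact (hbr m₂ hm₂').elim (fun h => (key h).symm) key

/-! ### Rotation to an arbitrary side -/

/-- The coordinates along and across the sides of a rectangle. -/
def sideCoord (W H : ℤ) (i : Fin 4) (z : ℤ × ℤ) : ℤ × ℤ :=
  (![z.1, -1 - z.2, W - 1 - z.1, z.2 + H] i, ![z.2, z.1 - W, -H - 1 - z.2, -1 - z.1] i)

theorem mem_region_iff_sideCoord {f : Fin 4 → ℤ → ℤ} {z : ℤ × ℤ} :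
    z ∈ Region W H f ↔ ∀ i, (sideCoord W H i z).2 < f i (sideCoord W H i z).1 := by
  rw [mem_region, Fin.forall_fin_succ, Fin.forall_fin_succ, Fin.forall_fin_succ,
    Fin.forall_fin_one]
  rfl

theorem sideCoord_toRight (i : Fin 4) (z : ℤ × ℤ) :
    sideCoord H W i (toRight W z) = sideCoord W H (i + 1) z := by
  fin_cases i <;> simp [sideCoord, toRight] <;> ring_nf <;> trivial

theorem sideLen_succ (i : Fin 4) : sideLen W H (i + 1) = sideLen H W i := by
  fin_cases i <;> rfl

theorem Bumpy.rotate (hL : Bumpy b W H M L) : Bumpy b H W M fun i => L (i + 1) :=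
  ⟨fun i => hL.odd (i + 1), fun i => sideLen_succ (W := W) i ▸ hL.len (i + 1),
    fun i => sideLen_succ (W := W) i ▸ hL.pos (i + 1), fun i => hL.gap (i + 1)⟩

/-- Rotation multiplies all normalised signs by the common factor `parSign (W + 1)`. If both sides
are odd this factor is 1; otherwise the sum is 0 and the factor is irrelevant. -/
theorem sum_parSign_rotate (h : ∑ i, ((L i).map fun e => parSign (e.pos + sideShift W H i)).sum =
      if W % 2 = 1 ∧ H % 2 = 1 then 1 else 0) :
    ∑ i, ((L (i + 1)).map fun e => parSign (e.pos + sideShift H W i)).sum =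
      if H % 2 = 1 ∧ W % 2 = 1 then 1 else 0 := by
  rw [← Equiv.sum_comp (Equiv.addRight (1 : Fin 4))] at h
  simp only [Equiv.coe_addRight] at h
  have key : ∀ i (t : ℤ), parSign (t + sideShift H W i) =
      parSign (W + 1) * parSign (t + sideShift W H (i + 1)) := by
    intro i t
    fin_cases i <;> simp [sideShift, parSign] <;> split_ifs <;> omega
  simp only [key, List.sum_map_mul_left, ← Finset.mul_sum]
  rw [h]
  simp only [parSign]
  split_ifs <;> omega

/-- A bumpy rectangle of total charge `0` has a Hamiltonian cycle through any given edge of its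
boundary that is far from the corners. -/
theorem hamPath_bumpy (hb : b % 2 = 0) (hb4 : 4 ≤ b) {n : ℕ} (hM : (2 * n + 6) * (b + 8) ≤ M)
    (i : Fin 4) : ∀ {W H : ℤ} {L : Fin 4 → List Bump}, Bumpy b W H M L →
    ∑ i, (L i).length ≤ n →
    (∑ i, ((L i).map fun e => parSign (e.pos + sideShift W H i)).sum =
      if W % 2 = 1 ∧ H % 2 = 1 then 1 else 0) → ∀ {x y : ℤ × ℤ}, gridGraph.Adj x y →
    (∀ z, z = x ∨ z = y → OnProfile (bumpProfile (L i)) (sideCoord W H i z) ∧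
      3 * b + 10 ≤ (sideCoord W H i z).1 ∧ (sideCoord W H i z).1 + 3 * b + 10 ≤ sideLen W H i) →
    HamPath (Region W H fun i => bumpProfile (L i)) x y := by
  induction i using Fin.induction with
  | zero =>
    intro W H L hL hn hsum x y hxy h
    obtain ⟨hx, hx1, hx2⟩ := h x (Or.inl rfl)
    obtain ⟨hy, hy1, hy2⟩ := h y (Or.inr rfl)
    simp only [sideCoord, sideLen, Fin.isValue, Matrix.cons_val] at hx hx1 hx2 hy hy1 hy2
    rw [gridGraph_adj] at hxy
    have : (y = (x.1 + 1, x.2) ∨ y = (x.1, x.2 + 1)) ∨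
        (x = (y.1 + 1, y.2) ∨ x = (y.1, y.2 + 1)) := by
      simp only [Prod.ext_iff]
      omega
    rcases this with h | h
    · exact hamPath_bumpy_top hb hb4 hL hn hsum hM h hx hy hx1 hx2
    · exact (hamPath_bumpy_top hb hb4 hL hn hsum hM h hy hx hy1 hy2).symm
  | succ i ih =>
    intro W H L hL hn hsum x y hxy h
    have h1 : HamPath (Region H W fun i => bumpProfile (L (i + 1))) (toRight W x) (toRight W y) := by
      refine ih hL.rotate ?_ (sum_parSign_rotate hsum) ?_ ?_
      · exact (Equiv.sum_comp (Equiv.addRight (1 : Fin 4)) fun i => (L i).length).trans_le hn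
      · rw [gridGraph_adj] at hxy ⊢
        simp only [toRight]
        omega
      · have hi : i.castSucc + 1 = i.succ := by simp
        have : ∀ z, z = x ∨ z = y → OnProfile (bumpProfile (L (i.castSucc + 1)))
            (sideCoord H W i.castSucc (toRight W z)) ∧
            3 * b + 10 ≤ (sideCoord H W i.castSucc (toRight W z)).1 ∧
            (sideCoord H W i.castSucc (toRight W z)).1 + 3 * b + 10 ≤
              sideLen H W i.castSucc := by
          intro z hz
          rw [sideCoord_toRight, ← sideLen_succ, hi]
          exact h z hz
        rintro z (rfl | rfl)
        exacts [this x (Or.inl rfl), this y (Or.inr rfl)]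
    refine (h1.ofRight W).congr (ofRight_toRight W x) (ofRight_toRight W y) fun z => ?_
    exact toRight_mem_region (f := fun i => bumpProfile (L i)) z

end

/-! ### Charge of a rectangle -/

section charge

theorem parSign_add (s t : ℤ) : parSign (s + t) = parSign s * parSign t := by
  simp only [parSign]; split_ifs <;> omega

theorem charge_eq_parSign (z : ℤ × ℤ) : charge z = parSign (z.1 + z.2) := by
  rw [charge, parSign]
  split_ifs with h
  · rw [Int.negOnePow_even _ (Int.even_iff.2 h)]; rfl
  · rw [Int.negOnePow_odd _ (Int.odd_iff.2 (by omega))]; rfl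

theorem sum_parSign_Ico (a : ℤ) (n : ℕ) :
    ∑ j ∈ Finset.Ico a (a + n), parSign j = if n % 2 = 0 then 0 else parSign a := by
  induction n with
  | zero => simp
  | succ n ih =>
    have h : Finset.Ico a (a + (n + 1 : ℕ)) = insert (a + n) (Finset.Ico a (a + n)) := by
      ext; simp only [Finset.mem_Ico, Finset.mem_insert]; omega
    rw [h, Finset.sum_insert (by simp), ih]
    simp only [parSign]; split_ifs <;> omega

theorem totalCharge_cells (P : GridRect) : totalCharge P.cells =
    if P.w % 2 = 1 ∧ P.h % 2 = 1 then parSign (P.x + P.y) else 0 := by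
  simp only [totalCharge, GridRect.cells, Finset.sum_product, charge_eq_parSign, parSign_add,
    ← Finset.mul_sum, ← Finset.sum_mul, sum_parSign_Ico]
  split_ifs <;> omega

end charge

/-! ### From parity change regions to bumps -/

namespace GridRect

theorem mem_cells {P : GridRect} {z : ℤ × ℤ} : z ∈ P.cells ↔
    (P.x ≤ z.1 ∧ z.1 < P.x + P.w) ∧ P.y ≤ z.2 ∧ z.2 < P.y + P.h := by
  simp [cells]

/-- The coordinates of a point along and across a side of `R`. -/
def side (R : GridRect) (i : Fin 4) (z : ℤ × ℤ) : ℤ × ℤ :=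
  sideCoord R.w R.h i (z.1 - R.x, z.2 - (R.y + R.h))

variable {R P : GridRect} {i j : Fin 4} {z w : ℤ × ℤ}

theorem exists_side_eq (R : GridRect) (i : Fin 4) (w : ℤ × ℤ) : ∃ z, R.side i z = w := by
  fin_cases i
  · exact ⟨(w.1 + R.x, w.2 + (R.y + R.h)), by simp [side, sideCoord]⟩
  · exact ⟨(w.2 + R.w + R.x, -1 - w.1 + (R.y + R.h)), by simp [side, sideCoord]⟩
  · exact ⟨(R.w - 1 - w.1 + R.x, -R.h - 1 - w.2 + (R.y + R.h)), by simp [side, sideCoord]⟩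
  · exact ⟨(-1 - w.2 + R.x, w.1 - R.h + (R.y + R.h)), by ext <;> simp [side, sideCoord]; ring⟩

theorem rho_side : rho (R.side i z) (R.side i w) = rho z w := by
  have key : ∀ a b c d : ℤ, a - b = c - d ∨ a - b = d - c → |a - b| = |c - d| := by
    rintro a b c d (h | h)
    · rw [h]
    · rw [h, abs_sub_comm]
  fin_cases i <;> simp only [side, sideCoord, rho, Fin.isValue, Fin.zero_eta, Fin.mk_one,
    Fin.reduceFinMk, Matrix.cons_val]
  · congr 1 <;> exact key _ _ _ _ (by omega)
  · rw [max_comm]; congr 1 <;> exact key _ _ _ _ (by omega)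
  · congr 1 <;> exact key _ _ _ _ (by omega)
  · rw [max_comm]; congr 1 <;> exact key _ _ _ _ (by omega)

/-- The three alternatives are that `j` is the side after `i`, the side before `i`, or the opposite
side. -/
theorem side_of_ne (h : i ≠ j) (z : ℤ × ℤ) :
    (R.side j z).1 = -1 - (R.side i z).2 ∧ (R.side j z).2 = (R.side i z).1 - sideLen R.w R.h i ∨
    (R.side j z).1 = sideLen R.w R.h j + (R.side i z).2 ∧ (R.side j z).2 = -1 - (R.side i z).1 ∨
    (R.side j z).2 + (R.side i z).2 = -1 - sideLen R.w R.h (i + 1) := by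
  have cases : ∀ i : Fin 4, i = 0 ∨ i = 1 ∨ i = 2 ∨ i = 3 := by decide
  obtain rfl | rfl | rfl | rfl := cases i <;> obtain rfl | rfl | rfl | rfl := cases j <;>
    first | exact absurd rfl h | skip
  all_goals
    simp only [side, sideCoord, sideLen, Fin.isValue, Fin.reduceAdd, Matrix.cons_val, and_true,
      true_or] <;> omega

theorem side_fst (R : GridRect) (i : Fin 4) (z : ℤ × ℤ) :
    (R.side i z).1 = -1 - (R.side (i + 3) z).2 ∧
      (R.side i z).1 = sideLen R.w R.h i + (R.side (i + 1) z).2 := by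
  have cases : i = 0 ∨ i = 1 ∨ i = 2 ∨ i = 3 := by omega
  obtain rfl | rfl | rfl | rfl := cases <;>
    simp only [side, sideCoord, sideLen, Fin.isValue, Fin.reduceAdd, Matrix.cons_val, zero_add] <;>
    constructor <;> first | trivial | ring

theorem mem_cells_iff_side : z ∈ R.cells ↔ ∀ i, (R.side i z).2 < 0 := by
  rw [mem_cells, Fin.forall_fin_succ, Fin.forall_fin_succ, Fin.forall_fin_succ,
    Fin.forall_fin_one]
  simp only [side, sideCoord, Fin.isValue, Fin.succ_zero_eq_one, Fin.succ_one_eq_two,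
    Fin.reduceSucc, Matrix.cons_val]
  omega

theorem le_rho_side_corners {a : ℤ} (h : ∀ c ∈ R.corners, a ≤ rho z c) (i : Fin 4) :
    a ≤ rho (R.side i z) (0, -1) ∧ a ≤ rho (R.side i z) (sideLen R.w R.h i - 1, -1) := by
  simp only [corners, Finset.mem_product, Finset.mem_insert, Finset.mem_singleton] at h
  have h1 := h (R.x, R.y) (by simp)
  have h2 := h (R.x + R.w - 1, R.y) (by simp)
  have h3 := h (R.x, R.y + R.h - 1) (by simp)
  have h4 := h (R.x + R.w - 1, R.y + R.h - 1) (by simp)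
  simp only [rho, le_max_iff, le_abs] at h1 h2 h3 h4 ⊢
  fin_cases i <;> simp only [side, sideCoord, sideLen, Fin.isValue, Fin.zero_eta, Fin.mk_one,
    Fin.reduceFinMk, Matrix.cons_val] <;> omega

/-- The rectangle `P` is the bump `e` on a side of `R`. -/
structure IsBump (R P : GridRect) (i : Fin 4) (e : Bump) : Prop where
  pos : 0 ≤ e.pos
  le : e.pos + e.width ≤ sideLen R.w R.h i
  dims : e.width = P.w ∧ (e.height = P.h ∨ e.height = -P.h) ∨
    e.width = P.h ∧ (e.height = P.w ∨ e.height = -P.w)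
  mem : ∀ z, z ∈ P.cells ↔ e.pos ≤ (R.side i z).1 ∧ (R.side i z).1 < e.pos + e.width ∧
    (0 ≤ (R.side i z).2 ∧ (R.side i z).2 < e.height ∨
      e.height ≤ (R.side i z).2 ∧ (R.side i z).2 < 0)

/-- The charge of a rectangle with odd sides is that of any of its corners. Up to the common factor
`parSign (R.x + R.y + R.h)` it is determined by the parity of the position, once `sideShift` has
made the four sides comparable. -/
theorem AttachedOutside.exists_isBump (h : P.AttachedOutside R) (hw : P.w % 2 = 1)
    (hh : P.h % 2 = 1) : ∃ i e, R.IsBump P i e ∧ 0 < e.height ∧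
      totalCharge P.cells = parSign (R.x + R.y + R.h) * parSign (e.pos + sideShift R.w R.h i) := by
  simp only [totalCharge_cells, if_pos (And.intro hw hh), ← parSign_add]
  simp only [AttachedOutside, ColsWithin, RowsWithin] at h
  obtain ⟨h1, h2 | h2⟩ | ⟨h1, h2 | h2⟩ := h
  · refine ⟨2, ⟨R.x + R.w - (P.x + P.w), P.w, P.h⟩, ⟨?_, ?_, Or.inl ⟨rfl, Or.inl rfl⟩, fun z => ?_⟩,
      ?_, parSign_eq_of_emod ?_⟩ <;> simp only [mem_cells, side, sideCoord, sideLen, sideShift,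
        Fin.isValue, Matrix.cons_val] <;> omega
  · refine ⟨0, ⟨P.x - R.x, P.w, P.h⟩, ⟨?_, ?_, Or.inl ⟨rfl, Or.inl rfl⟩, fun z => ?_⟩,
      ?_, parSign_eq_of_emod ?_⟩ <;> simp only [mem_cells, side, sideCoord, sideLen, sideShift,
        Fin.isValue, Matrix.cons_val] <;> omega
  · refine ⟨3, ⟨P.y - R.y, P.h, P.w⟩, ⟨?_, ?_, Or.inr ⟨rfl, Or.inl rfl⟩, fun z => ?_⟩,
      ?_, parSign_eq_of_emod ?_⟩ <;> simp only [mem_cells, side, sideCoord, sideLen, sideShift,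
        Fin.isValue, Matrix.cons_val] <;> omega
  · refine ⟨1, ⟨R.y + R.h - (P.y + P.h), P.h, P.w⟩, ⟨?_, ?_, Or.inr ⟨rfl, Or.inl rfl⟩, fun z => ?_⟩,
      ?_, parSign_eq_of_emod ?_⟩ <;> simp only [mem_cells, side, sideCoord, sideLen, sideShift,
        Fin.isValue, Matrix.cons_val] <;> omega

/-- A region cut out starts one layer deeper than an added one at the same position, so its charge
has the opposite sign. Since it is subtracted, both kinds contribute to the total charge by the same
formula. -/
theorem AttachedInside.exists_isBump (h : P.AttachedInside R) (hw : P.w % 2 = 1)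
    (hh : P.h % 2 = 1) : ∃ i e, R.IsBump P i e ∧ e.height < 0 ∧
      totalCharge P.cells =
        -(parSign (R.x + R.y + R.h) * parSign (e.pos + sideShift R.w R.h i)) := by
  have hneg : ∀ s, -parSign s = parSign (s + 1) := by
    intro s; simp only [parSign]; split_ifs <;> omega
  simp only [totalCharge_cells, if_pos (And.intro hw hh), ← parSign_add, hneg]
  simp only [AttachedInside, ColsWithin, RowsWithin] at h
  obtain ⟨h1, h2, h3 | h3 | h3 | h3⟩ := h
  · refine ⟨2, ⟨R.x + R.w - (P.x + P.w), P.w, -P.h⟩, ⟨?_, ?_, Or.inl ⟨rfl, Or.inr rfl⟩, fun z => ?_⟩,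
      ?_, parSign_eq_of_emod ?_⟩ <;> simp only [mem_cells, side, sideCoord, sideLen, sideShift,
        Fin.isValue, Matrix.cons_val] <;> omega
  · refine ⟨0, ⟨P.x - R.x, P.w, -P.h⟩, ⟨?_, ?_, Or.inl ⟨rfl, Or.inr rfl⟩, fun z => ?_⟩,
      ?_, parSign_eq_of_emod ?_⟩ <;> simp only [mem_cells, side, sideCoord, sideLen, sideShift,
        Fin.isValue, Matrix.cons_val] <;> omega
  · refine ⟨3, ⟨P.y - R.y, P.h, -P.w⟩, ⟨?_, ?_, Or.inr ⟨rfl, Or.inr rfl⟩, fun z => ?_⟩,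
      ?_, parSign_eq_of_emod ?_⟩ <;> simp only [mem_cells, side, sideCoord, sideLen, sideShift,
        Fin.isValue, Matrix.cons_val] <;> omega
  · refine ⟨1, ⟨R.y + R.h - (P.y + P.h), P.h, -P.w⟩, ⟨?_, ?_, Or.inr ⟨rfl, Or.inr rfl⟩, fun z => ?_⟩,
      ?_, parSign_eq_of_emod ?_⟩ <;> simp only [mem_cells, side, sideCoord, sideLen, sideShift,
        Fin.isValue, Matrix.cons_val] <;> omega

end GridRect

theorem totalCharge_modifiedRegion {R : GridRect} {A S : Finset GridRect}
    (hd : ∀ P Q : GridRect, (P ∈ A ∨ P ∈ S) → (Q ∈ A ∨ Q ∈ S) → P ≠ Q →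
      Disjoint P.cells Q.cells)
    (hA : ∀ P ∈ A, Disjoint R.cells P.cells) (hS : ∀ P ∈ S, P.cells ⊆ R.cells) :
    totalCharge (modifiedRegion R A S) =
      totalCharge R.cells - ∑ P ∈ S, totalCharge P.cells + ∑ P ∈ A, totalCharge P.cells := by
  have h1 : Disjoint (R.cells \ S.biUnion GridRect.cells) (A.biUnion GridRect.cells) :=
    Finset.disjoint_of_subset_left Finset.sdiff_subset
      ((Finset.disjoint_biUnion_right _ _ _).2 hA)
  rw [totalCharge, modifiedRegion, Finset.sum_union h1,
    Finset.sum_sdiff_eq_sub (Finset.biUnion_subset.2 hS), Finset.sum_biUnion, Finset.sum_biUnion]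
  · rfl
  · exact fun P hP Q hQ hne => hd P Q (Or.inl hP) (Or.inl hQ) hne
  · exact fun P hP Q hQ hne => hd P Q (Or.inr hP) (Or.inr hQ) hne

/-- Bumps far from each other can be listed in order. -/
theorem exists_sorted_bumps {ι : Type*} (s : Finset ι) (β : ι → Bump)
    (h : ∀ P ∈ s, ∀ Q ∈ s, P ≠ Q → (β P).pos + (β P).width + 50 ≤ (β Q).pos ∨
      (β Q).pos + (β Q).width + 50 ≤ (β P).pos) (hw : ∀ P ∈ s, 0 ≤ (β P).width) :
    ∃ L : List Bump, L.Perm (s.toList.map β) ∧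
      L.Pairwise fun e e' => e.pos + e.width + 50 ≤ e'.pos := by
  refine ⟨(s.toList.map β).insertionSort fun e e' => e.pos ≤ e'.pos,
    List.perm_insertionSort _ _, ?_⟩
  have h1 : (s.toList.map β).Pairwise fun e e' => e.pos + e.width + 50 ≤ e'.pos ∨
      e'.pos + e'.width + 50 ≤ e.pos := by
    rw [List.pairwise_map]
    refine (s.nodup_toList).imp_of_mem fun {P Q} hP hQ hne => ?_
    exact h P (Finset.mem_toList.1 hP) Q (Finset.mem_toList.1 hQ) hne
  have h2 := (List.perm_insertionSort (fun e e' : Bump => e.pos ≤ e'.pos)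
    (s.toList.map β)).symm.pairwise h1 fun h => h.symm
  have : IsTrans Bump fun e e' => e.pos ≤ e'.pos := ⟨fun _ _ _ => le_trans⟩
  have : Std.Total fun e e' : Bump => e.pos ≤ e'.pos := ⟨fun a b => le_total a.pos b.pos⟩
  have h3 := List.pairwise_insertionSort (fun e e' : Bump => e.pos ≤ e'.pos) (s.toList.map β)
  refine List.Pairwise.imp_of_mem (fun {e e'} he he' h => ?_) (h2.and h3)
  have hw' : 0 ≤ e'.width := by
    rw [(List.perm_insertionSort _ _).mem_iff] at he'
    obtain ⟨P, hP, rfl⟩ := List.mem_map.1 he'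
    exact hw P (Finset.mem_toList.1 hP)
  omega

theorem bumpProfile_cases (L : List Bump) (x : ℤ) : bumpProfile L x = 0 ∨
    ∃ e ∈ L, e.pos ≤ x ∧ x < e.pos + e.width ∧ bumpProfile L x = e.height := by
  induction L with
  | nil => exact Or.inl rfl
  | cons e L ih =>
    by_cases h : e.pos ≤ x ∧ x < e.pos + e.width
    · exact Or.inr ⟨e, by simp, h.1, h.2, by rw [bumpProfile, if_pos h]⟩
    · rw [bumpProfile, if_neg h]
      exact ih.imp_right fun ⟨e', he', h'⟩ => ⟨e', List.mem_cons_of_mem _ he', h'⟩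

namespace GridRect

variable {R P Q : GridRect} {i j : Fin 4} {z w : ℤ × ℤ} {e e' : Bump} {a D : ℤ}

theorem IsBump.exists_mem (h : R.IsBump P i e) (h0 : e.height ≠ 0) {m : ℤ} (hm : e.pos ≤ m)
    (hm' : m < e.pos + e.width) :
    ∃ z ∈ P.cells, (R.side i z).1 = m ∧ -1 ≤ (R.side i z).2 ∧ (R.side i z).2 ≤ 0 := by
  obtain ⟨z, hz⟩ := R.exists_side_eq i (m, if 0 < e.height then 0 else -1)
  refine ⟨z, (h.mem z).2 ?_, ?_⟩ <;> rw [hz] <;> dsimp only <;> split_ifs <;> omega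

theorem IsBump.far_from_ends (h : R.IsBump P i e) (h0 : e.height ≠ 0) (hw : 0 < e.width)
    (ha : 1 < a) (hc : ∀ z ∈ P.cells, ∀ c ∈ R.corners, a ≤ rho z c) :
    a ≤ e.pos ∧ e.pos + e.width + a ≤ sideLen R.w R.h i := by
  obtain ⟨z, hz, hz1, hz2, hz3⟩ := h.exists_mem h0 le_rfl (by omega)
  obtain ⟨w, hw, hw1, hw2, hw3⟩ := h.exists_mem h0 (m := e.pos + e.width - 1) (by omega) (by omega)
  have h1 := (le_rho_side_corners (hc z hz) i).1
  have h2 := (le_rho_side_corners (hc w hw) i).2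
  have := h.pos
  have := h.le
  simp only [rho, le_max_iff, le_abs] at h1 h2
  omega

/-- Both bumps contain points in the layers `-1` or `0` along the side, over any of their columns,
so a large distance between the rectangles must be realised along the side. -/
theorem IsBump.far (h : R.IsBump P i e) (h' : R.IsBump Q i e') (h0 : e.height ≠ 0)
    (h0' : e'.height ≠ 0) (hw : 0 < e.width) (hw' : 0 < e'.width) (ha : 50 < a)
    (hc : ∀ z ∈ P.cells, ∀ z' ∈ Q.cells, a ≤ rho z z') :
    e.pos + e.width + 50 ≤ e'.pos ∨ e'.pos + e'.width + 50 ≤ e.pos := by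
  by_contra hcon
  obtain ⟨m, m', hm1, hm2, hm1', hm2', hmm, hmm'⟩ : ∃ m m', e.pos ≤ m ∧ m < e.pos + e.width ∧
      e'.pos ≤ m' ∧ m' < e'.pos + e'.width ∧ m - m' ≤ 50 ∧ m' - m ≤ 50 := by
    by_cases hle : e.pos ≤ e'.pos
    · exact ⟨min (e.pos + e.width - 1) e'.pos, e'.pos, by omega, by omega, by omega, by omega,
        by omega, by omega⟩
    · exact ⟨e.pos, min (e'.pos + e'.width - 1) e.pos, by omega, by omega, by omega, by omega,
        by omega, by omega⟩
  obtain ⟨z, hz, hz1, hz2, hz3⟩ := h.exists_mem h0 hm1 hm2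
  obtain ⟨w, hw, hw1, hw2, hw3⟩ := h'.exists_mem h0' hm1' hm2'
  have h1 := hc z hz w hw
  rw [← rho_side (R := R) (i := i)] at h1
  simp only [rho, le_max_iff, le_abs] at h1
  omega

/-- A point on the profile of a side and far from the corners is not near any other side. -/
theorem side_near_unique (hij : i ≠ j) (ha : 2 * D + 10 ≤ a)
    (hlen : ∀ i, a ≤ sideLen R.w R.h i) (hc : ∀ c ∈ R.corners, a ≤ rho z c)
    (hup : ∀ i, (R.side i z).2 < D) (hi : -D - 3 ≤ (R.side i z).2) :
    (R.side j z).2 < -D - 3 ∧ a - 1 ≤ (R.side i z).1 ∧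
      (R.side i z).1 + a ≤ sideLen R.w R.h i := by
  have h1 := le_rho_side_corners hc i
  have h2 := hup i
  have h3 := hup (i + 1)
  have h4 := hup (i + 3)
  have h5 := hlen i
  have h6 := hlen (i + 1)
  have h7 := R.side_fst i z
  have h8 := side_of_ne (R := R) hij z
  simp only [rho, le_max_iff, le_abs] at h1
  omega

end GridRect

section

variable {R : GridRect} {A S : Finset GridRect} {σ : GridRect → Fin 4} {β : GridRect → Bump}
  {L : Fin 4 → List Bump} {D : ℤ}

/-- A point of an added bump lies beyond the ends of the neighbouring sides, where their profiles
vanish, and deeper than any cut on the opposite side reaches. So the four profiles, imposed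
simultaneously, do not interfere. -/
theorem mem_modifiedRegion_iff_side (hA : ∀ P ∈ A, R.IsBump P (σ P) (β P) ∧ 0 < (β P).height)
    (hS : ∀ P ∈ S, R.IsBump P (σ P) (β P) ∧ (β P).height < 0)
    (hL : ∀ i e, e ∈ L i ↔ ∃ P, (P ∈ A ∨ P ∈ S) ∧ σ P = i ∧ β P = e)
    (hgap : ∀ i, (L i).Pairwise fun e e' => e.pos + e.width + 50 ≤ e'.pos)
    (hD : 0 ≤ D) (hLD : ∀ i, ∀ e ∈ L i, -D ≤ e.height) (hlen : ∀ i, D ≤ sideLen R.w R.h i)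
    (z : ℤ × ℤ) : z ∈ modifiedRegion R A S ↔
      ∀ i, (R.side i z).2 < bumpProfile (L i) (R.side i z).1 := by
  have hbump : ∀ i, ∀ e ∈ L i, 0 ≤ e.pos ∧ e.pos + e.width ≤ sideLen R.w R.h i := by
    intro i e he
    obtain ⟨P, hP | hP, rfl, rfl⟩ := (hL i e).1 he
    exacts [⟨(hA P hP).1.pos, (hA P hP).1.le⟩, ⟨(hS P hP).1.pos, (hS P hP).1.le⟩]
  have hval : ∀ P, P ∈ A ∨ P ∈ S → (β P).pos ≤ (R.side (σ P) z).1 →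
      (R.side (σ P) z).1 < (β P).pos + (β P).width →
      bumpProfile (L (σ P)) (R.side (σ P) z).1 = (β P).height := fun P hP h h' =>
    bumpProfile_eq_height ((hL _ _).2 ⟨P, hP, rfl, rfl⟩) (hgap _) h h'
  simp only [modifiedRegion, Finset.mem_union, Finset.mem_sdiff, Finset.mem_biUnion, not_exists,
    not_and]
  constructor
  · rintro (⟨hz, hzS⟩ | ⟨P, hP, hz⟩) i
    · have hr := GridRect.mem_cells_iff_side.1 hz i
      obtain h | ⟨e, he, h1, h2, h⟩ := bumpProfile_cases (L i) (R.side i z).1 <;> rw [h]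
      · exact hr
      · obtain ⟨P, hP | hP, rfl, rfl⟩ := (hL i e).1 he
        · have := (hA P hP).2
          omega
        · have := mt ((hS P hP).1.mem z).2 (hzS P hP)
          omega
    · have hm := ((hA P hP).1.mem z).1 hz
      have h0 := (hA P hP).2
      have hle := (hA P hP).1.le
      have hpos := (hA P hP).1.pos
      by_cases hi : σ P = i
      · subst hi
        rw [hval P (Or.inl hP) (by omega) (by omega)]
        omega
      · have hne := GridRect.side_of_ne (R := R) hi z
        obtain h | ⟨e, he, h1, h2, h⟩ := bumpProfile_cases (L i) (R.side i z).1 <;> rw [h]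
        · have := hlen (σ P + 1)
          omega
        · have := hbump i e he
          have := hLD i e he
          have := hlen (σ P + 1)
          omega
  · intro h
    by_cases hz : z ∈ R.cells
    · refine Or.inl ⟨hz, fun P hP hzP => ?_⟩
      have hm := ((hS P hP).1.mem z).1 hzP
      have := hval P (Or.inr hP) (by omega) (by omega)
      have := h (σ P)
      have := (hS P hP).2
      omega
    · right
      rw [GridRect.mem_cells_iff_side] at hz
      push Not at hz
      obtain ⟨i, hi⟩ := hz
      have := h i
      obtain h' | ⟨e, he, h1, h2, h'⟩ := bumpProfile_cases (L i) (R.side i z).1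
      · omega
      · obtain ⟨P, hP | hP, rfl, rfl⟩ := (hL i e).1 he
        · exact ⟨P, hP, ((hA P hP).1.mem z).2 (by omega)⟩
        · have := (hS P hP).2
          omega

end

theorem IsParityChange.exists_bumps {p q k a : ℕ} {R : GridRect} {A S : Finset GridRect}
    {b D M : ℤ} (h : IsParityChange p q k a R A S) (hp : p % 2 = 1) (hp1 : 1 < p) (hq : q % 2 = 1)
    (hq1 : 1 < q) (hpD : p ≤ D) (hqD : q ≤ D) (hbD : D + 3 ≤ b) (ha : 50 < a)
    (hM : ∀ i, 2 * M ≤ sideLen R.w R.h i) (hDM : D ≤ 2 * M) (hMk : 1 ≤ k → M ≤ k * a)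
    (htc : totalCharge (modifiedRegion R A S) = 0) :
    ∃ L : Fin 4 → List Bump, Bumpy b R.w R.h M L ∧ ∑ i, (L i).length ≤ k ∧
      (∑ i, ((L i).map fun e => parSign (e.pos + sideShift R.w R.h i)).sum =
        if (R.w : ℤ) % 2 = 1 ∧ (R.h : ℤ) % 2 = 1 then 1 else 0) ∧
      (∀ i, ∀ e ∈ L i, -D ≤ e.height ∧ e.height ≤ D) ∧
      ∀ z, z ∈ modifiedRegion R A S ↔
        ∀ i, (R.side i z).2 < bumpProfile (L i) (R.side i z).1 := by
  classical
  set κ := parSign (R.x + R.y + R.h) with hκ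
  have hodd : ∀ P : GridRect, P ∈ A ∨ P ∈ S → P.w % 2 = 1 ∧ P.h % 2 = 1 ∧ 1 < P.w ∧ 1 < P.h ∧
      P.w ≤ D ∧ P.h ≤ D := by
    intro P hP
    have := h.dims P hP
    simp only [GridRect.HasDims] at this
    omega
  obtain ⟨σ, β, hAβ, hSβ⟩ : ∃ (σ : GridRect → Fin 4) (β : GridRect → Bump),
      (∀ P ∈ A, R.IsBump P (σ P) (β P) ∧ 0 < (β P).height ∧
        totalCharge P.cells = κ * parSign ((β P).pos + sideShift R.w R.h (σ P))) ∧
      ∀ P ∈ S, R.IsBump P (σ P) (β P) ∧ (β P).height < 0 ∧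
        totalCharge P.cells = -(κ * parSign ((β P).pos + sideShift R.w R.h (σ P))) := by
    have key : ∀ P : GridRect, ∃ i e, (P ∈ A → R.IsBump P i e ∧ 0 < e.height ∧
        totalCharge P.cells = κ * parSign (e.pos + sideShift R.w R.h i)) ∧
        (P ∉ A → P ∈ S → R.IsBump P i e ∧ e.height < 0 ∧
        totalCharge P.cells = -(κ * parSign (e.pos + sideShift R.w R.h i))) := by
      intro P
      by_cases hA : P ∈ A
      · have := hodd P (Or.inl hA)
        obtain ⟨i, e, he⟩ := (h.added P hA).exists_isBump this.1 this.2.1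
        exact ⟨i, e, fun _ => he, fun h => absurd hA h⟩
      · by_cases hS : P ∈ S
        · have := hodd P (Or.inr hS)
          obtain ⟨i, e, he⟩ := (h.subtracted P hS).exists_isBump this.1 this.2.1
          exact ⟨i, e, fun h => absurd h hA, fun _ _ => he⟩
        · exact ⟨0, ⟨0, 0, 0⟩, fun h => absurd h hA, fun _ h => absurd h hS⟩
    choose σ β h1 h2 using key
    -- No nonempty rectangle is attached both outside and inside, so the choice of bump does not
    -- depend on the set to which it belongs.
    refine ⟨σ, β, h1, fun P hP => h2 P (fun hPA => ?_) hP⟩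
    have h1 := h.added P hPA
    obtain ⟨h2, h3, -⟩ := h.subtracted P hP
    have := hodd P (Or.inr hP)
    simp only [GridRect.AttachedOutside, GridRect.ColsWithin, GridRect.RowsWithin] at h1 h2 h3
    omega
  have hβ : ∀ P, P ∈ A ∨ P ∈ S → R.IsBump P (σ P) (β P) ∧ (β P).height ≠ 0 := by
    rintro P (hP | hP)
    · exact ⟨(hAβ P hP).1, (hAβ P hP).2.1.ne'⟩
    · exact ⟨(hSβ P hP).1, (hSβ P hP).2.1.ne⟩
  have hdims : ∀ P, P ∈ A ∨ P ∈ S → (β P).width % 2 = 1 ∧ 3 ≤ (β P).width ∧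
      (β P).height % 2 = 1 ∧ -D ≤ (β P).height ∧ (β P).height ≤ D := by
    intro P hP
    have := (hβ P hP).1.dims
    have := hodd P hP
    omega
  have hAS : Disjoint A S := by
    rw [Finset.disjoint_left]
    intro P hA hS
    have := (hAβ P hA).2.1
    have := (hSβ P hS).2.1
    omega
  have hex : ∀ i, ∃ L : List Bump,
      L.Perm (((A ∪ S).filter (σ · = i)).toList.map β) ∧
      L.Pairwise fun e e' => e.pos + e.width + 50 ≤ e'.pos := by
    intro i
    refine exists_sorted_bumps _ β (fun P hP Q hQ hne => ?_) fun P hP => ?_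
    · simp only [Finset.mem_filter, Finset.mem_union] at hP hQ
      have hP' := hdims P hP.1
      have hQ' := hdims Q hQ.1
      obtain ⟨h1, h2⟩ := hβ P hP.1
      obtain ⟨h3, h4⟩ := hβ Q hQ.1
      rw [hP.2] at h1
      rw [hQ.2] at h3
      exact h1.far h3 h2 h4 (by omega) (by omega) (a := a) (by omega)
        (h.apart P Q hP.1 hQ.1 hne)
    · simp only [Finset.mem_filter, Finset.mem_union] at hP
      have := hdims P hP.1
      omega
  choose L hperm hgap using hex
  have hL : ∀ i e, e ∈ L i ↔ ∃ P, (P ∈ A ∨ P ∈ S) ∧ σ P = i ∧ β P = e := by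
    intro i e
    simp [(hperm i).mem_iff, and_assoc]
  have hsum : ∀ F : Fin 4 → Bump → ℤ, ∑ i, ((L i).map (F i)).sum =
      ∑ P ∈ A ∪ S, F (σ P) (β P) := by
    intro F
    rw [← Finset.sum_fiberwise (A ∪ S) σ]
    refine Finset.sum_congr rfl fun i _ => ?_
    rw [((hperm i).map (F i)).sum_eq, List.map_map, Finset.sum_map_toList]
    refine Finset.sum_congr rfl fun P hP => ?_
    rw [Function.comp_apply, (Finset.mem_filter.1 hP).2]
  have hLD : ∀ i, ∀ e ∈ L i, -D ≤ e.height ∧ e.height ≤ D := by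
    intro i e he
    obtain ⟨P, hP, rfl, rfl⟩ := (hL i e).1 he
    exact (hdims P hP).2.2.2
  refine ⟨L, ⟨fun i e he => ?_, hM, fun i e he => ?_, hgap⟩, ?_, ?_, hLD, ?_⟩
  · obtain ⟨P, hP, rfl, rfl⟩ := (hL i e).1 he
    have := hdims P hP
    omega
  · obtain ⟨P, hP, rfl, rfl⟩ := (hL i e).1 he
    have hk : 1 ≤ k := by
      refine le_trans ?_ h.card_le
      rw [← Finset.card_union_of_disjoint hAS]
      exact Finset.card_pos.2 ⟨P, Finset.mem_union.2 hP⟩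
    have hka := hMk hk
    have h1 : a ≤ k * a := Nat.le_mul_of_pos_left a hk
    obtain ⟨h2, h3⟩ := (hβ P hP).1.far_from_ends (hβ P hP).2 (by have := hdims P hP; omega)
      (a := k * a) (by exact_mod_cast (by omega : 1 < k * a)) (h.far_from_corners P hP)
    omega
  · have := hsum fun _ _ => 1
    simp only [List.map_const', List.sum_replicate, Finset.sum_const, nsmul_eq_mul, mul_one] at this
    rw [Finset.card_union_of_disjoint hAS] at this
    have h' : ∑ i, (L i).length = A.card + S.card := by exact_mod_cast this
    rw [h']
    exact h.card_le
  · rw [hsum fun i e => parSign (e.pos + sideShift R.w R.h i), Finset.sum_union hAS]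
    rw [totalCharge_modifiedRegion, totalCharge_cells,
      Finset.sum_congr rfl fun P hP => (hAβ P hP).2.2,
      Finset.sum_congr rfl fun P hP => (hSβ P hP).2.2, Finset.sum_neg_distrib, ← Finset.mul_sum,
      ← Finset.mul_sum] at htc
    · have hκ' : parSign (R.x + R.y + R.h) = 1 ∨ parSign (R.x + R.y + R.h) = -1 := by
        simp only [parSign]; split_ifs <;> simp
      -- A rectangle of odd area has charge `-κ`: the factor `κ` is evaluated one row above its top
      -- row. Cancelling `κ` from the vanishing total charge gives the condition on the signs.
      have hR : (if R.w % 2 = 1 ∧ R.h % 2 = 1 then parSign (R.x + R.y) else 0) =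
          -κ * if (R.w : ℤ) % 2 = 1 ∧ (R.h : ℤ) % 2 = 1 then 1 else 0 := by
        simp only [hκ, parSign]; split_ifs <;> omega
      rw [hR] at htc
      rw [← hκ] at hκ'
      obtain h1 | h1 := hκ' <;> rw [h1] at htc <;> linarith
    · intro P Q hP hQ hne
      rw [Finset.disjoint_left]
      intro z hz hz'
      have := h.apart P Q hP hQ hne z hz z hz'
      simp [rho] at this
      omega
    · intro P hP
      rw [Finset.disjoint_left]
      intro z hz hz'
      have h1 := GridRect.mem_cells_iff_side.1 hz (σ P)
      have h2 := ((hAβ P hP).1.mem z).1 hz'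
      have h3 := (hAβ P hP).2.1
      omega
    · intro P hP z hz
      obtain ⟨h1, h2, -⟩ := h.subtracted P hP
      rw [GridRect.mem_cells] at hz ⊢
      simp only [GridRect.ColsWithin, GridRect.RowsWithin] at h1 h2
      omega
  · exact mem_modifiedRegion_iff_side (D := D) (fun P hP => ⟨(hAβ P hP).1, (hAβ P hP).2.1⟩)
      (fun P hP => ⟨(hSβ P hP).1, (hSβ P hP).2.1⟩) hL hgap (by omega)
      (fun i e he => (hLD i e he).1) fun i => hDM.trans (hM i)

section

variable {R : GridRect} {F : Finset (ℤ × ℤ)} {f : Fin 4 → ℤ → ℤ} {x y : ℤ × ℤ} {a D : ℤ}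

theorem exists_onProfile_of_mem_gridBoundary
    (hF : ∀ z, z ∈ F ↔ ∀ i, (R.side i z).2 < f i (R.side i z).1)
    (hx : x ∈ gridBoundary (F : Set (ℤ × ℤ))) : ∃ i, OnProfile (f i) (R.side i x) := by
  obtain ⟨hxF, z, hz, hxz⟩ := hx
  rw [Finset.mem_coe, hF] at hxF hz
  push Not at hz
  obtain ⟨i, hi⟩ := hz
  rw [← GridRect.rho_side (R := R) (i := i)] at hxz
  have h1 : |(R.side i x).1 - (R.side i z).1| ≤ 1 := (le_max_left _ _).trans hxz.le
  have h2 : |(R.side i x).2 - (R.side i z).2| ≤ 1 := (le_max_right _ _).trans hxz.le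
  rw [abs_le] at h1 h2
  exact ⟨i, hxF i, (R.side i z).1, by omega, by omega, by omega⟩

/-- Adjacent points of the boundary far from the corners belong to the same side. -/
theorem exists_common_side (hF : ∀ z, z ∈ F ↔ ∀ i, (R.side i z).2 < f i (R.side i z).1)
    (hf : ∀ i m, -D ≤ f i m ∧ f i m ≤ D) (ha : 2 * D + 10 ≤ a)
    (hlen : ∀ i, a ≤ sideLen R.w R.h i) (hx : x ∈ gridBoundary (F : Set (ℤ × ℤ)))
    (hy : y ∈ gridBoundary (F : Set (ℤ × ℤ))) (hxy : gridGraph.Adj x y)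
    (hcx : ∀ c ∈ R.corners, a ≤ rho x c) (hcy : ∀ c ∈ R.corners, a ≤ rho y c) :
    ∃ i, ∀ z, z = x ∨ z = y → OnProfile (f i) (R.side i z) ∧ a - 1 ≤ (R.side i z).1 ∧
      (R.side i z).1 + a ≤ sideLen R.w R.h i := by
  obtain ⟨i, hi⟩ := exists_onProfile_of_mem_gridBoundary hF hx
  obtain ⟨j, hj⟩ := exists_onProfile_of_mem_gridBoundary hF hy
  have hup : ∀ z ∈ F, ∀ i, (R.side i z).2 < D := fun z hz i =>
    ((hF z).1 hz i).trans_le (hf i _).2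
  have hlow : ∀ {z i}, OnProfile (f i) (R.side i z) → -D - 1 ≤ (R.side i z).2 := by
    rintro z i ⟨-, m, -, -, hm⟩
    have := hf i m
    omega
  have hne : i + 1 ≠ i := by omega
  have h1 := hlow hi
  have h2 := hlow hj
  have hrho : rho x y ≤ 1 := by
    rw [gridGraph_adj] at hxy
    simp only [rho, max_le_iff, abs_le]
    omega
  rw [← GridRect.rho_side (R := R) (i := j)] at hrho
  simp only [rho, max_le_iff, abs_le] at hrho
  -- On different sides, `x` would be deeper than `D + 3` with respect to side `j`, while its
  -- neighbour `y` lies on the profile of that side, at depth at most `D + 1`.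
  obtain rfl : i = j := by
    by_contra hij
    have := (GridRect.side_near_unique hij ha hlen hcx (hup x hx.1) (by omega)).1
    omega
  refine ⟨i, ?_⟩
  rintro z (rfl | rfl)
  · exact ⟨hi, (GridRect.side_near_unique hne.symm ha hlen hcx (hup _ hx.1) (by omega)).2⟩
  · exact ⟨hj, (GridRect.side_near_unique hne.symm ha hlen hcy (hup _ hy.1) (by omega)).2⟩

end

/-! ### Choice of the constant -/

theorem mainTheorem11 (p₀ q₀ : ℕ) (hp : Odd p₀) (hp1 : 1 < p₀) (hq : Odd q₀) (hq1 : 1 < q₀) :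
    ∃ a₀ : ℕ, ∀ (k : ℕ) (R : GridRect) (A S : Finset GridRect),
      a₀ ≤ R.w → a₀ ≤ R.h → k * a₀ ≤ R.w → k * a₀ ≤ R.h →
      IsParityChange p₀ q₀ k a₀ R A S →
      totalCharge (modifiedRegion R A S) = 0 →
      ∀ x y : ℤ × ℤ,
        x ∈ gridBoundary (modifiedRegion R A S) → y ∈ gridBoundary (modifiedRegion R A S) →
        gridGraph.Adj x y →
        (∀ c ∈ R.corners, (a₀ : ℤ) ≤ rho x c) → (∀ c ∈ R.corners, (a₀ : ℤ) ≤ rho y c) →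
        ∃ L : gridGraph.Walk x y, IsLining (modifiedRegion R A S) L := by
  rw [Nat.odd_iff] at hp hq
  obtain ⟨D, hpD, hqD⟩ : ∃ D : ℕ, p₀ ≤ D ∧ q₀ ≤ D := ⟨max p₀ q₀, le_max_left _ _, le_max_right _ _⟩
  -- With `b = 2 * D + 4`, which exceeds every cut by at least 3, one ring consumes `b + 8 = 2 * D +
  -- 12` of the margin `M`. At most `2 * k + 6 ≤ 8 * K` such units are needed, with `K` the maximum
  -- of `k` and 1. The factor 16 gives sides of length at least `2 * M` for `M = K * (8 * (2 * D +
  -- 12))`.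
  refine ⟨16 * (2 * D + 12), fun k R A S hw hh hkw hkh hpar htc x y hx hy hxy hcx hcy => ?_⟩
  obtain ⟨K, hK1, hkK, hKw, hKh, hKk⟩ : ∃ K : ℕ, 1 ≤ K ∧ k ≤ K ∧ K * (16 * (2 * D + 12)) ≤ R.w ∧
      K * (16 * (2 * D + 12)) ≤ R.h ∧ (1 ≤ k → K = k) := by
    rcases Nat.eq_zero_or_pos k with rfl | hk
    · exact ⟨1, le_rfl, by omega, by omega, by omega, by omega⟩
    · exact ⟨k, hk, le_rfl, hkw, hkh, fun _ => rfl⟩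
  have hlen : ∀ (a : ℕ) (i : Fin 4), a ≤ R.w → a ≤ R.h → (a : ℤ) ≤ sideLen R.w R.h i := by
    intro a i h1 h2
    fin_cases i <;> simp [sideLen, h1, h2]
  have hKD : 8 * (2 * D + 12) ≤ K * (8 * (2 * D + 12)) := Nat.le_mul_of_pos_left _ hK1
  obtain ⟨L, hL, hLk, hsum, hLD, hF⟩ := hpar.exists_bumps (b := 2 * D + 4) (D := D)
    (M := (K * (8 * (2 * D + 12)) : ℕ)) hp hp1 hq hq1 (by exact_mod_cast hpD)
    (by exact_mod_cast hqD) (by omega) (by omega)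
    (fun i => by
      have := hlen _ i hKw hKh
      rw [← mul_assoc, mul_comm K 16, mul_assoc] at this
      push_cast at this ⊢
      linarith) (by omega)
    (fun hk => by
      rw [hKk hk]
      exact_mod_cast Nat.mul_le_mul_left k (by omega)) htc
  have hprof : ∀ i m, -(D : ℤ) ≤ bumpProfile (L i) m ∧ bumpProfile (L i) m ≤ D := fun i m =>
    bumpProfile_induction (P := fun t => -(D : ℤ) ≤ t ∧ t ≤ D) (by omega) (hLD i) m
  obtain ⟨i, hi⟩ := exists_common_side hF hprof (by push_cast; omega) (hlen _ · hw hh) hx hy hxy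
    hcx hcy
  have h := hamPath_bumpy (x := (x.1 - R.x, x.2 - (R.y + R.h)))
    (y := (y.1 - R.x, y.2 - (R.y + R.h))) (by omega) (by omega) (n := k) (by
      have h1 : (2 * (k : ℤ) + 6) ≤ 8 * K := by omega
      have := mul_le_mul_of_nonneg_right h1 (show (0 : ℤ) ≤ 2 * D + 12 by omega)
      push_cast
      linarith) i hL hLk hsum
    (by rw [gridGraph_adj] at hxy ⊢; dsimp only; omega) (fun z hz => by
      have key : ∀ w, w = x ∨ w = y → z = (w.1 - R.x, w.2 - (R.y + R.h)) →
          OnProfile (bumpProfile (L i)) (sideCoord R.w R.h i z) ∧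
          3 * (2 * D + 4 : ℤ) + 10 ≤ (sideCoord R.w R.h i z).1 ∧
          (sideCoord R.w R.h i z).1 + 3 * (2 * D + 4) + 10 ≤ sideLen R.w R.h i := by
        rintro w hw rfl
        obtain ⟨h1, h2, h3⟩ := hi w hw
        rw [GridRect.side] at h1 h2 h3
        exact ⟨h1, by omega, by omega⟩
      exact hz.elim (key x (Or.inl rfl)) (key y (Or.inr rfl)))
  have h' := h.translate R.x (R.y + R.h) (G := ↑(modifiedRegion R A S)) fun z => by
    rw [Finset.mem_coe, hF, mem_region_iff_sideCoord]
    rfl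
  simp only [sub_add_cancel] at h'
  exact h'
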